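/- **Conventions.** For a category $\mathcal D$, $\Delta^\circ\mathcal D$ is the category of simplicial objects, $A\times\Delta$ is the constant simplicial object on $A$, and $\Upsilon:\Delta^\circ\mathcal D\to\Delta^\circ\mathcal D$ is the functor induced by reversing the order of the objects of $\Delta$. For a bisimplicial object $Z$, $\mathrm DZ=(n\mapsto Z_{n,n})$ is its diagonal and $\Delta^\circ\mathbf s Z=(n\mapsto \mathbf s(m\mapsto Z_{n,m}))$ for a functor $\mathbf s:\Delta^\circ\mathcal D\to\mathcal D$. For a simplicial object $X$, $X\times\Delta$ and $\Delta\times X$ are the bisimplicial objects with $(X\times\Delta)_{n,m}=X_n$ and $(\Delta\times X)_{n,m}=X_m$. If $\mathrm E$ is a class of morphisms of $\mathcal D$, then $Fun(\mathcal I,\mathcal D)[\mathrm E^{-1}]$ is the localization of the functor category by the natural transformations all of whose components are in $\mathrm E$. **Cones and suspension.** Let $\mathcal D$ have finite coproducts (hence an initial object $0$) and a final object $*$. For $Y\stackrel{f}{\leftarrow}X\stackrel{g}{\rightarrow}Z$ in $\Delta^\circ\mathcal D$, $Cyl(f,g)$ is the pushout of $f\sqcup g:X\sqcup X\to Y\sqcup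 Z$ along $d^0\sqcup d^1:X\sqcup X\to X\boxtimes\Delta[1]$, where $(X\boxtimes\Delta[1])_n=\coprod_{\Delta[1]_n}X_n$; in degree $n$ it is $Y_n\sqcup\coprod^{n}X_n\sqcup Z_n$. Given $\mathbf s:\Delta^\circ\mathcal D\to\mathcal D$, the cone of $f:A\to B$ in $\mathcal D$ is $c(f)=\mathbf s\,Cyl(f\times\Delta,\ A\times\Delta\to *\times\Delta)$, and the suspension is $\Sigma A=c(A\to *)$; let $p:c(f)\to\Sigma A$ be induced by $B\to *$. **Definition.** A *simplicial descent category* is a category $\mathcal D$ with finite coproducts and a final object, with a class $\mathrm E$ of morphisms (equivalences), a functor $\mathbf s:\Delta^\circ\mathcal D\to\mathcal D$, an isomorphism $\mu:\mathbf s\mathrm D\simeq\mathbf s\Delta^\circ\mathbf s$ in $Fun(\Delta^\circ\Delta^\circ\mathcal D,\mathcal D)[\mathrm E^{-1}]$ and a natural transformation $\lambda:\mathbf s(-\times\Delta)\to Id_{\mathcal D}$ such that: 1. $\mathrm E$ is saturated (a morphism is in $\mathrm E$ if and only if it is invertible in $\mathcal D[\mathrm E^{-1}]$), and $f\sqcup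 g\in\mathrm E$ if $f,g\in\mathrm E$; 2. the canonical morphisms $\mathbf sX\sqcup\mathbf sY\to\mathbf s(X\sqcup Y)$ are in $\mathrm E$; 3. $\lambda_A\in\mathrm E$ for all $A$, and $\lambda$ has a natural section $\rho:Id_{\mathcal D}\to\mathbf s(-\times\Delta)$, $\lambda\circ\rho=Id$; 4. $\mu$ and $\lambda$ are compatible: the composition $\mathbf sX\to\mathbf s((\mathbf sX)\times\Delta)\to\mathbf sX$ of $\mu_{\Delta\times X}$ and $\lambda_{\mathbf sX}$, and the composition $\mathbf sX\to\mathbf s(n\mapsto\mathbf s(X_n\times\Delta))\to\mathbf sX$ of $\mu_{X\times\Delta}$ and $\mathbf s(\lambda_{X_n})$, are the identity in $Fun(\Delta^\circ\mathcal D,\mathcal D)[\mathrm E^{-1}]$; 5. if $f_n\in\mathrm E$ for all $n$, then $\mathbf sf\in\mathrm E$; 6. a morphism $f$ of $\mathcal D$ is in $\mathrm E$ if and only if $c(f)\to *$ is in $\mathrm E$; 7. for $f$ in $\Delta^\circ\mathcal D$, $\mathbf s\Upsilon f\in\mathrm E$ if and only if $\mathbf sf\in\mathrm E$. Write $Ho\mathcal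 D=\mathcal D[\mathrm E^{-1}]$. Then $\Sigma$ induces a functor $\Sigma:Ho\mathcal D\to Ho\mathcal D$, and $\mathcal D$ is *stable* if the latter is an equivalence of categories. Let $i:B\to c(f)$ be the composition of $\rho_B$ with $\mathbf s$ of the inclusion of $B\times\Delta$ in the cylinder. A *cofiber sequence* is a triangle $X\to Y\to Z\to\Sigma X$ of $Ho\mathcal D$ that is isomorphic, in $Ho\mathcal D$, to $A\stackrel{f}{\to}B\stackrel{i}{\to}c(f)\stackrel{p}{\to}\Sigma A$ for some morphism $f$ of $\mathcal D$. A *descent functor* $F:\mathcal D\to\mathcal D'$ between simplicial descent categories is a functor with $F(\mathrm E)\subseteq\mathrm E'$, such that the canonical morphisms $FA\sqcup FB\to F(A\sqcup B)$ and $F(*)\to *$ are in $\mathrm E'$, and such that there is an isomorphism $\Theta:F\mathbf s\simeq\mathbf s'\Delta^\circ F$ in $Fun(\Delta^\circ\mathcal D,\mathcal D')[\mathrm E'^{-1}]$ compatible with $\lambda,\lambda'$ and $\mu,\mu'$, that is, $\lambda'_{FA}\circ\Theta_{A\times\Delta}=F(\lambda_A)$ in $Fun(\mathcal D,\mathcal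 D')[\mathrm E'^{-1}]$ and $\mu'_{FZ}\circ\Theta_{\mathrm DZ}=\mathbf s'(\Theta_{Z_{n,\bullet}})\circ\Theta_{\Delta^\circ\mathbf s Z}\circ F(\mu_Z)$ in $Fun(\Delta^\circ\Delta^\circ\mathcal D,\mathcal D')[\mathrm E'^{-1}]$. **Theorem.** Let $\mathcal D$ be a stable simplicial descent category. Then $Ho\mathcal D$ is additive, and it is a triangulated category in the sense of Verdier, with the suspension $\Sigma$ as translation functor (up to natural isomorphism) and the cofiber sequences as distinguished triangles. If $\mathcal D'$ is a second stable simplicial descent category and $F:\mathcal D\to\mathcal D'$ is a descent functor, then the induced functor $F:Ho\mathcal D\to Ho\mathcal D'$ is triangulated: for any such triangulated structures on $Ho\mathcal D$ and $Ho\mathcal D'$, it commutes with the translation functors up to a natural isomorphism, with respect to which it sends distinguished triangles to distinguished triangles. -/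

import Mathlib

open CategoryTheory CategoryTheory.Limits Opposite Simplicial

universe v u v' u'

noncomputable section

namespace SimplicialDescent

/-! ### Cylinders and cones of simplicial objects -/

section Cylinder

instance finite_hom (n m : SimplexCategory) : Finite (n ⟶ m) :=
  Finite.of_injective (fun f => (f.toOrderHom : Fin (n.len + 1) → Fin (m.len + 1))) (by
    intro f g h
    ext x : 3
    exact congrFun h x)

/-- The part of a cylinder that a simplex `σ : [n] → [1]` of `Δ[1]` indexes: the constant simplex
`1` (resp. `0`) indexes the end of the cylinder glued along the left (resp. right) leg of a span,
and every nonconstant simplex indexes a copy of the middle of the span. -/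
def position {n : SimplexCategory} (σ : n ⟶ ⦋1⦌) : WalkingSpan :=
  if σ = SimplexCategory.const n ⦋1⦌ 1 then WalkingSpan.left
  else if σ = SimplexCategory.const n ⦋1⦌ 0 then WalkingSpan.right
  else WalkingSpan.zero

lemma const_ne (n : SimplexCategory) :
    SimplexCategory.const n ⦋1⦌ 0 ≠ SimplexCategory.const n ⦋1⦌ 1 := by
  intro h
  have h' := congrArg (fun f : n ⟶ ⦋1⦌ => f.toOrderHom 0) h
  simp [SimplexCategory.const_apply] at h'

@[simp] lemma position_const_one (n : SimplexCategory) :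
    position (SimplexCategory.const n ⦋1⦌ 1) = WalkingSpan.left := by
  simp [position]

@[simp] lemma position_const_zero (n : SimplexCategory) :
    position (SimplexCategory.const n ⦋1⦌ 0) = WalkingSpan.right := by
  simp [position, const_ne]

lemma position_eq_left {n : SimplexCategory} {σ : n ⟶ ⦋1⦌} (h : position σ = WalkingSpan.left) :
    σ = SimplexCategory.const n ⦋1⦌ 1 := by
  unfold position at h
  split_ifs at h <;> first | assumption | cases h

lemma position_eq_right {n : SimplexCategory} {σ : n ⟶ ⦋1⦌} (h : position σ = WalkingSpan.right) :
    σ = SimplexCategory.const n ⦋1⦌ 0 := by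
  unfold position at h
  split_ifs at h <;> first | assumption | cases h

lemma comp_const {m n : SimplexCategory} (θ : m ⟶ n) (i : Fin 2) :
    θ ≫ SimplexCategory.const n ⦋1⦌ i = SimplexCategory.const m ⦋1⦌ i := by
  ext x : 3
  rfl

lemma nonempty_positionHom {m n : SimplexCategory} (θ : m ⟶ n) (σ : n ⟶ ⦋1⦌) :
    Nonempty (position σ ⟶ position (θ ≫ σ)) := by
  rcases h : position σ with _ | _ | _
  · rcases position (θ ≫ σ) with _ | j
    · exact ⟨𝟙 _⟩
    · exact ⟨WidePushoutShape.Hom.init j⟩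
  · obtain rfl := position_eq_left h
    rw [comp_const, position_const_one]
    exact ⟨𝟙 _⟩
  · obtain rfl := position_eq_right h
    rw [comp_const, position_const_zero]
    exact ⟨𝟙 _⟩

/-- The unique morphism from the position of a simplex to the position of one of its faces or
degeneracies (`WalkingSpan` is a thin category). -/
def positionHom {m n : SimplexCategory} (θ : m ⟶ n) (σ : n ⟶ ⦋1⦌) :
    position σ ⟶ position (θ ≫ σ) :=
  (nonempty_positionHom θ σ).some

variable {D : Type u} [Category.{v} D] [HasFiniteCoproducts D]

/-- The object of `n`-simplices of the cylinder of a span of simplicial objects. -/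
abbrev cylObj (F : WalkingSpan ⥤ SimplicialObject D) (n : SimplexCategoryᵒᵖ) : D :=
  ∐ fun σ : n.unop ⟶ ⦋1⦌ => (F.obj (position σ)).obj n

/-- The inclusion into the cylinder of the summand indexed by a simplex of `Δ[1]`. -/
abbrev cylι (F : WalkingSpan ⥤ SimplicialObject D) (n : SimplexCategoryᵒᵖ) (σ : n.unop ⟶ ⦋1⦌) :
    (F.obj (position σ)).obj n ⟶ cylObj F n :=
  Sigma.ι (fun σ : n.unop ⟶ ⦋1⦌ => (F.obj (position σ)).obj n) σ

/-- The simplicial operators of the cylinder of a span of simplicial objects. -/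
def cylOp (F : WalkingSpan ⥤ SimplicialObject D) {n m : SimplexCategoryᵒᵖ} (θ : n ⟶ m) :
    cylObj F n ⟶ cylObj F m :=
  Sigma.desc fun σ =>
    (F.map (positionHom θ.unop σ)).app n ≫ (F.obj (position (θ.unop ≫ σ))).map θ ≫
      cylι F m (θ.unop ≫ σ)

lemma ι_cylOp (F : WalkingSpan ⥤ SimplicialObject D) {n m : SimplexCategoryᵒᵖ} (θ : n ⟶ m)
    (σ : n.unop ⟶ ⦋1⦌) (τ : m.unop ⟶ ⦋1⦌) (h : θ.unop ≫ σ = τ) (a : position σ ⟶ position τ) :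
    cylι F n σ ≫ cylOp F θ = (F.map a).app n ≫ (F.obj (position τ)).map θ ≫ cylι F m τ := by
  subst h
  obtain rfl : a = positionHom θ.unop σ := Subsingleton.elim _ _
  simp [cylOp, cylι]

/-- The simplicial cylinder `Cyl(f, g)` of a span `Y ←f- X -g→ Z` of simplicial objects
(`Y` is the value at `WalkingSpan.left`, and `Z` the value at `WalkingSpan.right`):
`Cyl(f, g)ₙ = Yₙ ⨿ ∐ Xₙ ⨿ Zₙ`, where the `n` copies of `Xₙ` are indexed by the nonconstant
`n`-simplices of `Δ[1]`. See `isPushout_cyl` for its universal property. -/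
@[simps obj_obj obj_map map_app]
def Cyl : (WalkingSpan ⥤ SimplicialObject D) ⥤ SimplicialObject D where
  obj F :=
    { obj n := cylObj F n
      map θ := cylOp F θ
      map_id n := by
        refine Sigma.hom_ext _ _ fun σ => ?_
        refine (ι_cylOp F (𝟙 n) σ σ (Category.id_comp σ) (𝟙 _)).trans ?_
        simp
      map_comp {n m k} θ θ' := by
        refine Sigma.hom_ext _ _ fun σ => ?_
        refine (ι_cylOp F (θ ≫ θ') σ (θ'.unop ≫ θ.unop ≫ σ) (by simp)
          (positionHom θ.unop σ ≫ positionHom θ'.unop _)).trans ?_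
        refine Eq.trans ?_ (Category.assoc _ _ _)
        refine Eq.trans ?_ (congrArg (· ≫ cylOp F θ')
          (ι_cylOp F θ σ (θ.unop ≫ σ) rfl (positionHom θ.unop σ)).symm)
        simp only [Category.assoc]
        rw [ι_cylOp F θ' (θ.unop ≫ σ) _ rfl (positionHom θ'.unop _)]
        simp }
  map {F G} α :=
    { app n := Limits.Sigma.map fun σ => (α.app (position σ)).app n
      naturality n m θ := by
        refine Sigma.hom_ext _ _ fun σ => ?_
        have h := fun F : WalkingSpan ⥤ SimplicialObject D =>
          ι_cylOp F θ σ (θ.unop ≫ σ) rfl (positionHom θ.unop σ)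
        simp only [cylι] at h
        rw [← Category.assoc, h F]
        simp only [Category.assoc, Sigma.ι_map, Sigma.ι_map_assoc, h G]
        have h1 := congrArg (fun t => t.app n) (α.naturality (positionHom θ.unop σ))
        have h2 := (α.app (position (θ.unop ≫ σ))).naturality θ
        dsimp at h1
        rw [reassoc_of% h2, reassoc_of% h1] }
  map_id F := by
    refine NatTrans.ext (funext fun n => Sigma.hom_ext _ _ fun σ => ?_)
    simp
  map_comp α β := by
    refine NatTrans.ext (funext fun n => Sigma.hom_ext _ _ fun σ => ?_)
    simp [Sigma.ι_map, Sigma.ι_map_assoc]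

/-- The inclusion of the left end of a cylinder. -/
def Cyl.inl (F : WalkingSpan ⥤ SimplicialObject D) : F.obj WalkingSpan.left ⟶ Cyl.obj F where
  app n := (F.map (eqToHom (position_const_one n.unop).symm)).app n ≫
    cylι F n (SimplexCategory.const n.unop ⦋1⦌ 1)
  naturality n m θ := by
    have h : (F.obj _).map θ ≫ (F.map (eqToHom (position_const_one m.unop).symm)).app m ≫
        cylι F m (SimplexCategory.const m.unop ⦋1⦌ 1) =
        ((F.map (eqToHom (position_const_one n.unop).symm)).app n ≫
        cylι F n (SimplexCategory.const n.unop ⦋1⦌ 1)) ≫ cylOp F θ := by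
      rw [Category.assoc, ι_cylOp F θ _ _ (comp_const θ.unop 1) (eqToHom (by simp)),
        ← NatTrans.comp_app_assoc, ← F.map_comp, eqToHom_trans, NatTrans.naturality_assoc]
    exact h

/-- The inclusion of the right end of a cylinder. -/
def Cyl.inr (F : WalkingSpan ⥤ SimplicialObject D) : F.obj WalkingSpan.right ⟶ Cyl.obj F where
  app n := (F.map (eqToHom (position_const_zero n.unop).symm)).app n ≫
    cylι F n (SimplexCategory.const n.unop ⦋1⦌ 0)
  naturality n m θ := by
    have h : (F.obj _).map θ ≫ (F.map (eqToHom (position_const_zero m.unop).symm)).app m ≫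
        cylι F m (SimplexCategory.const m.unop ⦋1⦌ 0) =
        ((F.map (eqToHom (position_const_zero n.unop).symm)).app n ≫
        cylι F n (SimplexCategory.const n.unop ⦋1⦌ 0)) ≫ cylOp F θ := by
      rw [Category.assoc, ι_cylOp F θ _ _ (comp_const θ.unop 0) (eqToHom (by simp)),
        ← NatTrans.comp_app_assoc, ← F.map_comp, eqToHom_trans, NatTrans.naturality_assoc]
    exact h

/-- The simplicial object `X ⊠ Δ[1]`, with `(X ⊠ Δ[1])ₙ` the coproduct of copies of `Xₙ` indexed
by the `n`-simplices `[n] → [1]` of `Δ[1]`. -/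
@[simps]
def prism (X : SimplicialObject D) : SimplicialObject D where
  obj n := ∐ fun _ : n.unop ⟶ ⦋1⦌ => X.obj n
  map {n m} θ := Sigma.desc fun σ =>
    X.map θ ≫ Sigma.ι (fun _ : m.unop ⟶ ⦋1⦌ => X.obj m) (θ.unop ≫ σ)
  map_id n := by
    refine Sigma.hom_ext _ _ fun σ => ?_
    simp
  map_comp θ θ' := by
    refine Sigma.hom_ext _ _ fun σ => ?_
    simp

/-- The inclusion `X ⟶ X ⊠ Δ[1]` given by a vertex `i` of `Δ[1]`. The coface map `d⁰` is the vertex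
`1`, and `d¹` is the vertex `0`. -/
def prismEnd (X : SimplicialObject D) (i : Fin 2) : X ⟶ prism X where
  app n := Sigma.ι (fun _ : n.unop ⟶ ⦋1⦌ => X.obj n) (SimplexCategory.const n.unop ⦋1⦌ i)
  naturality n m θ := by
    refine Eq.symm ((Sigma.ι_desc _ _).trans ?_)
    rw [comp_const]
    rfl

/-- The unique morphism in `WalkingSpan` from its initial object. -/
def fromZero (w : WalkingSpan) : WalkingSpan.zero ⟶ w :=
  match w with
  | WalkingSpan.zero => 𝟙 _
  | WalkingSpan.left => WalkingSpan.Hom.fst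
  | WalkingSpan.right => WalkingSpan.Hom.snd

/-- The canonical morphism `X ⊠ Δ[1] ⟶ Cyl(f, g)`. -/
def prismToCyl (F : WalkingSpan ⥤ SimplicialObject D) :
    prism (F.obj WalkingSpan.zero) ⟶ Cyl.obj F where
  app n := Sigma.desc fun σ => (F.map (fromZero (position σ))).app n ≫ cylι F n σ
  naturality n m θ := by
    have h : Sigma.desc (fun σ : n.unop ⟶ ⦋1⦌ => (F.obj WalkingSpan.zero).map θ ≫
        Sigma.ι (fun _ : m.unop ⟶ ⦋1⦌ => (F.obj WalkingSpan.zero).obj m) (θ.unop ≫ σ)) ≫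
        Sigma.desc (fun σ => (F.map (fromZero (position σ))).app m ≫ cylι F m σ) =
        Sigma.desc (fun σ => (F.map (fromZero (position σ))).app n ≫ cylι F n σ) ≫
          cylOp F θ := by
      refine Sigma.hom_ext _ _ fun σ => ?_
      simp only [Sigma.ι_desc_assoc, Category.assoc, Sigma.ι_desc]
      rw [ι_cylOp F θ σ _ rfl (positionHom θ.unop σ), ← NatTrans.comp_app_assoc, ← F.map_comp,
        Subsingleton.elim (fromZero (position σ) ≫ positionHom θ.unop σ) (fromZero _),
        NatTrans.naturality_assoc]
    exact h

section Desc

variable {F : WalkingSpan ⥤ SimplicialObject D} {T : SimplicialObject D}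
  (y : F.obj WalkingSpan.left ⟶ T) (z : F.obj WalkingSpan.right ⟶ T)
  (h : prism (F.obj WalkingSpan.zero) ⟶ T)

/-- The components of the morphism out of a cylinder. -/
def cylDescAux (n : SimplexCategoryᵒᵖ) (σ : n.unop ⟶ ⦋1⦌) (w : WalkingSpan) :
    (F.obj w).obj n ⟶ T.obj n :=
  match w with
  | WalkingSpan.zero =>
    Sigma.ι (fun _ : n.unop ⟶ ⦋1⦌ => (F.obj WalkingSpan.zero).obj n) σ ≫ h.app n
  | WalkingSpan.left => y.app n
  | WalkingSpan.right => z.app n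

lemma map_comp_cylDescAux (hy : prismEnd _ 1 ≫ h = F.map WalkingSpan.Hom.fst ≫ y)
    (hz : prismEnd _ 0 ≫ h = F.map WalkingSpan.Hom.snd ≫ z)
    (n : SimplexCategoryᵒᵖ) (σ : n.unop ⟶ ⦋1⦌) (w : WalkingSpan)
    (hw : w = position σ) (a : WalkingSpan.zero ⟶ w) :
    (F.map a).app n ≫ cylDescAux y z h n σ w =
      Sigma.ι (fun _ : n.unop ⟶ ⦋1⦌ => (F.obj WalkingSpan.zero).obj n) σ ≫ h.app n := by
  rcases w with _ | _ | _
  · obtain rfl : a = 𝟙 _ := Subsingleton.elim _ _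
    simp [cylDescAux]
  · obtain rfl := position_eq_left hw.symm
    obtain rfl : a = WalkingSpan.Hom.fst := Subsingleton.elim _ _
    exact (congrArg (fun t => t.app n) hy).symm
  · obtain rfl := position_eq_right hw.symm
    obtain rfl : a = WalkingSpan.Hom.snd := Subsingleton.elim _ _
    exact (congrArg (fun t => t.app n) hz).symm

lemma cylDescAux_naturality (hy : prismEnd _ 1 ≫ h = F.map WalkingSpan.Hom.fst ≫ y)
    (hz : prismEnd _ 0 ≫ h = F.map WalkingSpan.Hom.snd ≫ z)
    {n m : SimplexCategoryᵒᵖ} (θ : n ⟶ m) (σ : n.unop ⟶ ⦋1⦌)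
    (w : WalkingSpan) (hw : w = position σ) (a : w ⟶ position (θ.unop ≫ σ)) :
    (F.map a).app n ≫ (F.obj _).map θ ≫ cylDescAux y z h m (θ.unop ≫ σ) (position (θ.unop ≫ σ)) =
      cylDescAux y z h n σ w ≫ T.map θ := by
  rw [← NatTrans.naturality_assoc]
  rcases w with _ | _ | _
  · rw [map_comp_cylDescAux y z h hy hz m (θ.unop ≫ σ) _ rfl a]
    have h1 := h.naturality θ
    simp only [cylDescAux]
    refine Eq.trans ?_ (Category.assoc _ _ _).symm
    refine Eq.trans ?_ (congrArg (Sigma.ι (fun _ : n.unop ⟶ ⦋1⦌ =>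
      (F.obj WalkingSpan.zero).obj n) σ ≫ ·) h1)
    simp only [prism_map]
    refine Eq.trans ?_ (Category.assoc _ _ _)
    refine Eq.trans ?_ (congrArg (· ≫ h.app m) (Sigma.ι_desc (fun σ : n.unop ⟶ ⦋1⦌ =>
      (F.obj WalkingSpan.zero).map θ ≫ Sigma.ι (fun _ : m.unop ⟶ ⦋1⦌ =>
        (F.obj WalkingSpan.zero).obj m) (θ.unop ≫ σ)) σ).symm)
    exact (Category.assoc _ _ _).symm
  · obtain rfl := position_eq_left hw.symm
    have e := congrArg position (comp_const θ.unop 1)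
    rw [position_const_one] at e
    generalize position (θ.unop ≫ SimplexCategory.const n.unop ⦋1⦌ 1) = w' at *
    subst e
    obtain rfl : a = 𝟙 _ := Subsingleton.elim _ _
    simp [cylDescAux]
  · obtain rfl := position_eq_right hw.symm
    have e := congrArg position (comp_const θ.unop 0)
    rw [position_const_zero] at e
    generalize position (θ.unop ≫ SimplexCategory.const n.unop ⦋1⦌ 0) = w' at *
    subst e
    obtain rfl : a = 𝟙 _ := Subsingleton.elim _ _
    simp [cylDescAux]

/-- The morphism out of a cylinder determined by compatible morphisms out of its two ends and out
of `X ⊠ Δ[1]`. -/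
def Cyl.desc (hy : prismEnd _ 1 ≫ h = F.map WalkingSpan.Hom.fst ≫ y)
    (hz : prismEnd _ 0 ≫ h = F.map WalkingSpan.Hom.snd ≫ z) : Cyl.obj F ⟶ T where
  app n := Sigma.desc fun σ => cylDescAux y z h n σ (position σ)
  naturality n m θ := by
    have H : cylOp F θ ≫ Sigma.desc (fun σ => cylDescAux y z h m σ (position σ)) =
        Sigma.desc (fun σ => cylDescAux y z h n σ (position σ)) ≫ T.map θ := by
      refine Sigma.hom_ext _ _ fun σ => ?_
      have h1 := ι_cylOp F θ σ _ rfl (positionHom θ.unop σ)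
      dsimp only [cylι] at h1
      rw [reassoc_of% h1, Sigma.ι_desc, Sigma.ι_desc_assoc]
      exact cylDescAux_naturality y z h hy hz θ σ _ rfl _
    exact H

lemma cylι_desc_app (hy : prismEnd _ 1 ≫ h = F.map WalkingSpan.Hom.fst ≫ y)
    (hz : prismEnd _ 0 ≫ h = F.map WalkingSpan.Hom.snd ≫ z)
    (n : SimplexCategoryᵒᵖ) (σ : n.unop ⟶ ⦋1⦌) :
    cylι F n σ ≫ (Cyl.desc y z h hy hz).app n = cylDescAux y z h n σ (position σ) :=
  Sigma.ι_desc _ _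

lemma map_eqToHom_cylDescAux (n : SimplexCategoryᵒᵖ) (σ : n.unop ⟶ ⦋1⦌) {w w' : WalkingSpan}
    (e : w = w') :
    (F.map (eqToHom e)).app n ≫ cylDescAux y z h n σ w' = cylDescAux y z h n σ w := by
  subst e
  simp

lemma Cyl.inl_desc (hy : prismEnd _ 1 ≫ h = F.map WalkingSpan.Hom.fst ≫ y)
    (hz : prismEnd _ 0 ≫ h = F.map WalkingSpan.Hom.snd ≫ z) :
    Cyl.inl F ≫ Cyl.desc y z h hy hz = y := by
  ext n
  refine (Category.assoc _ _ _).trans ((congrArg ((F.map _).app n ≫ ·)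
    (cylι_desc_app y z h hy hz n _)).trans ?_)
  exact map_eqToHom_cylDescAux y z h n _ _

lemma Cyl.inr_desc (hy : prismEnd _ 1 ≫ h = F.map WalkingSpan.Hom.fst ≫ y)
    (hz : prismEnd _ 0 ≫ h = F.map WalkingSpan.Hom.snd ≫ z) :
    Cyl.inr F ≫ Cyl.desc y z h hy hz = z := by
  ext n
  refine (Category.assoc _ _ _).trans ((congrArg ((F.map _).app n ≫ ·)
    (cylι_desc_app y z h hy hz n _)).trans ?_)
  exact map_eqToHom_cylDescAux y z h n _ _

lemma prismToCyl_desc (hy : prismEnd _ 1 ≫ h = F.map WalkingSpan.Hom.fst ≫ y)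
    (hz : prismEnd _ 0 ≫ h = F.map WalkingSpan.Hom.snd ≫ z) :
    prismToCyl F ≫ Cyl.desc y z h hy hz = h := by
  ext n
  refine Sigma.hom_ext _ _ fun σ => ?_
  refine (Category.assoc _ _ _).symm.trans ?_
  refine (congrArg (· ≫ (Cyl.desc y z h hy hz).app n) (Sigma.ι_desc _ _)).trans ?_
  refine (Category.assoc _ _ _).trans ((congrArg ((F.map _).app n ≫ ·)
    (cylι_desc_app y z h hy hz n _)).trans ?_)
  exact map_comp_cylDescAux y z h hy hz n σ _ rfl _

lemma Cyl.hom_ext {t t' : Cyl.obj F ⟶ T} (h₁ : Cyl.inl F ≫ t = Cyl.inl F ≫ t')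
    (h₂ : Cyl.inr F ≫ t = Cyl.inr F ≫ t') (h₃ : prismToCyl F ≫ t = prismToCyl F ≫ t') :
    t = t' := by
  refine NatTrans.ext (funext fun n => Sigma.hom_ext _ _ fun σ => ?_)
  change cylι F n σ ≫ t.app n = cylι F n σ ≫ t'.app n
  have hσ : position σ = WalkingSpan.zero ∨ position σ = WalkingSpan.left ∨
      position σ = WalkingSpan.right := by
    rcases position σ with _ | _ | _
    exacts [Or.inl rfl, Or.inr (Or.inl rfl), Or.inr (Or.inr rfl)]
  rcases hσ with hσ | hσ | hσ
  · have : IsIso (fromZero (position σ)) := by rw [hσ]; exact inferInstanceAs (IsIso (𝟙 _))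
    have h₄ := congrArg (fun t => Sigma.ι (fun _ : n.unop ⟶ ⦋1⦌ =>
      (F.obj WalkingSpan.zero).obj n) σ ≫ t.app n) h₃
    have h₅ : Sigma.ι (fun _ : n.unop ⟶ ⦋1⦌ => (F.obj WalkingSpan.zero).obj n) σ ≫
      (prismToCyl F).app n = (F.map (fromZero (position σ))).app n ≫ cylι F n σ :=
      Sigma.ι_desc _ _
    rw [← cancel_epi ((F.map (fromZero (position σ))).app n)]
    refine (Category.assoc _ _ _).symm.trans (Eq.trans ?_ (Category.assoc _ _ _))
    refine (congrArg (· ≫ t.app n) h₅).symm.trans (Eq.trans ?_ (congrArg (· ≫ t'.app n) h₅))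
    exact (Category.assoc _ _ _).trans (h₄.trans (Category.assoc _ _ _).symm)
  · obtain rfl := position_eq_left hσ
    rw [← cancel_epi ((F.map (eqToHom (position_const_one n.unop).symm)).app n)]
    refine (Category.assoc _ _ _).symm.trans (Eq.trans ?_ (Category.assoc _ _ _))
    exact congrArg (fun t => t.app n) h₁
  · obtain rfl := position_eq_right hσ
    rw [← cancel_epi ((F.map (eqToHom (position_const_zero n.unop).symm)).app n)]
    refine (Category.assoc _ _ _).symm.trans (Eq.trans ?_ (Category.assoc _ _ _))
    exact congrArg (fun t => t.app n) h₂

end Desc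

lemma prismEnd_one_toCyl (F : WalkingSpan ⥤ SimplicialObject D) :
    prismEnd _ 1 ≫ prismToCyl F = F.map WalkingSpan.Hom.fst ≫ Cyl.inl F := by
  ext n
  refine (Sigma.ι_desc _ _).trans ?_
  refine Eq.trans ?_ (Category.assoc _ _ _)
  rw [← NatTrans.comp_app, ← F.map_comp]
  refine congrArg (fun a => (F.map a).app n ≫ cylι F n _) (Subsingleton.elim _ _)

lemma prismEnd_zero_toCyl (F : WalkingSpan ⥤ SimplicialObject D) :
    prismEnd _ 0 ≫ prismToCyl F = F.map WalkingSpan.Hom.snd ≫ Cyl.inr F := by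
  ext n
  refine (Sigma.ι_desc _ _).trans ?_
  refine Eq.trans ?_ (Category.assoc _ _ _)
  rw [← NatTrans.comp_app, ← F.map_comp]
  refine congrArg (fun a => (F.map a).app n ≫ cylι F n _) (Subsingleton.elim _ _)

/-- The cylinder of `Y ←f- X -g→ Z` is the pushout of `f ⨿ g : X ⨿ X ⟶ Y ⨿ Z` along
`d⁰ ⨿ d¹ : X ⨿ X ⟶ X ⊠ Δ[1]`. -/
theorem isPushout_cyl (F : WalkingSpan ⥤ SimplicialObject D) :
    IsPushout (coprod.desc (prismEnd (F.obj WalkingSpan.zero) 1) (prismEnd _ 0))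
      (coprod.map (F.map WalkingSpan.Hom.fst) (F.map WalkingSpan.Hom.snd))
      (prismToCyl F) (coprod.desc (Cyl.inl F) (Cyl.inr F)) := by
  have hl (T : SimplicialObject D) (p : prism (F.obj WalkingSpan.zero) ⟶ T)
      (q : F.obj WalkingSpan.left ⨿ F.obj WalkingSpan.right ⟶ T)
      (e : coprod.desc (prismEnd (F.obj WalkingSpan.zero) 1) (prismEnd _ 0) ≫ p =
        coprod.map (F.map WalkingSpan.Hom.fst) (F.map WalkingSpan.Hom.snd) ≫ q) :
      prismEnd _ 1 ≫ p = F.map WalkingSpan.Hom.fst ≫ coprod.inl ≫ q ∧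
        prismEnd _ 0 ≫ p = F.map WalkingSpan.Hom.snd ≫ coprod.inr ≫ q := by
    constructor
    · have : coprod.inl ≫ _ = coprod.inl ≫ _ := congrArg (coprod.inl ≫ ·) e
      rwa [coprod.inl_desc_assoc, coprod.inl_map_assoc] at this
    · have : coprod.inr ≫ _ = coprod.inr ≫ _ := congrArg (coprod.inr ≫ ·) e
      rwa [coprod.inr_desc_assoc, coprod.inr_map_assoc] at this
  refine ⟨⟨?_⟩, ⟨PushoutCocone.IsColimit.mk _
    (fun c => Cyl.desc (coprod.inl ≫ c.inr) (coprod.inr ≫ c.inr) c.inl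
      (hl _ _ _ c.condition).1 (hl _ _ _ c.condition).2) ?_ ?_ ?_⟩⟩
  · refine coprod.hom_ext ?_ ?_
    · rw [coprod.inl_desc_assoc, coprod.inl_map_assoc, coprod.inl_desc, prismEnd_one_toCyl]
    · rw [coprod.inr_desc_assoc, coprod.inr_map_assoc, coprod.inr_desc, prismEnd_zero_toCyl]
  · intro c
    exact prismToCyl_desc _ _ _ _ _
  · intro c
    refine coprod.hom_ext ?_ ?_
    · rw [coprod.inl_desc_assoc, Cyl.inl_desc]
    · rw [coprod.inr_desc_assoc, Cyl.inr_desc]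
  · intro c t h₁ h₂
    refine Cyl.hom_ext ?_ ?_ ?_
    · rw [Cyl.inl_desc, ← h₂, coprod.inl_desc_assoc]
    · rw [Cyl.inr_desc, ← h₂, coprod.inr_desc_assoc]
    · rw [prismToCyl_desc, ← h₁]

end Cylinder

/-! ### Bisimplicial objects -/

section Bisimplicial

variable {D : Type u} [Category.{v} D] {D' : Type u'} [Category.{v'} D']

/-- The functor `Z ↦ (n ↦ Z_{n,n})` from bisimplicial to simplicial objects. -/
def diagonal (D : Type u) [Category.{v} D] :
    SimplicialObject (SimplicialObject D) ⥤ SimplicialObject D where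
  obj Z :=
    { obj n := (Z.obj n).obj n
      map {n m} θ := (Z.map θ).app n ≫ (Z.obj m).map θ }
  map α := { app n := (α.app n).app n }

/-- The functor induced by `F` on simplicial objects, in each degree. -/
abbrev degreewise (F : D ⥤ D') : SimplicialObject D ⥤ SimplicialObject D' :=
  (SimplicialObject.whiskering D D').obj F

/-- The iterated simple functor `Z ↦ s(n ↦ s(m ↦ Z_{n,m}))`. -/
abbrev iterated (s : SimplicialObject D ⥤ D) : SimplicialObject (SimplicialObject D) ⥤ D :=
  degreewise s ⋙ s

/-- The functor `X ↦ Δ × X`, where `(Δ × X)_{n,m} = X_m`. -/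
abbrev constLeft (D : Type u) [Category.{v} D] :
    SimplicialObject D ⥤ SimplicialObject (SimplicialObject D) :=
  SimplicialObject.const (SimplicialObject D)

/-- The functor `X ↦ X × Δ`, where `(X × Δ)_{n,m} = X_n`. -/
abbrev constRight (D : Type u) [Category.{v} D] :
    SimplicialObject D ⥤ SimplicialObject (SimplicialObject D) :=
  degreewise (SimplicialObject.const D)

/-- The diagonal of `Δ × X` is `X`. -/
def constLeftDiagonal (D : Type u) [Category.{v} D] : constLeft D ⋙ diagonal D ≅ 𝟭 _ :=
  NatIso.ofComponents (fun X => NatIso.ofComponents (fun _ => Iso.refl _)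
    (by intro n m θ; exact Category.comp_id _))
    (by
      intro X Y f
      ext; exact (Category.comp_id _).trans (Category.id_comp _).symm)

/-- The diagonal of `X × Δ` is `X`. -/
def constRightDiagonal (D : Type u) [Category.{v} D] : constRight D ⋙ diagonal D ≅ 𝟭 _ :=
  NatIso.ofComponents (fun X => NatIso.ofComponents (fun _ => Iso.refl _)
    (by
      intro n m θ
      exact (Category.comp_id _).trans ((Category.comp_id _).trans (Category.id_comp _).symm)))
    (by
      intro X Y f
      ext; exact (Category.comp_id _).trans (Category.id_comp _).symm)

/-- The iterated simple of `Δ × X` is the simple of the constant simplicial object `s X`. -/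
def constLeftIterated (s : SimplicialObject D ⥤ D) :
    constLeft D ⋙ iterated s ≅ s ⋙ SimplicialObject.const D ⋙ s :=
  NatIso.ofComponents (fun X => s.mapIso (Functor.constComp _ X s))
    (by
      intro X Y f
      refine (s.map_comp _ _).symm.trans (Eq.trans (congrArg s.map ?_) (s.map_comp _ _))
      ext; exact (Category.comp_id _).trans (Category.id_comp _).symm)

/-- The iterated simple of `X × Δ` is `s(n ↦ s(Xₙ × Δ))`. -/
def constRightIterated (s : SimplicialObject D ⥤ D) :
    constRight D ⋙ iterated s ≅ degreewise (SimplicialObject.const D ⋙ s) ⋙ s :=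
  Iso.refl _

/-- Applying functors in each degree is compatible with composition. -/
def degreewiseComp {D'' : Type*} [Category* D''] (F : D ⥤ D') (G : D' ⥤ D'') :
    degreewise F ⋙ degreewise G ≅ degreewise (F ⋙ G) :=
  Iso.refl _

/-- Applying a functor in each degree commutes with taking diagonals. -/
def diagonalDegreewise (F : D ⥤ D') :
    diagonal D ⋙ degreewise F ≅ degreewise (degreewise F) ⋙ diagonal D' :=
  NatIso.ofComponents (fun Z => NatIso.ofComponents (fun _ => Iso.refl _)
    (by
      intro n m θ
      refine (Category.comp_id _).trans (Eq.trans ?_ (Category.id_comp _).symm)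
      exact F.map_comp _ _))
    (by
      intro Z W f
      ext; exact (Category.comp_id _).trans (Category.id_comp _).symm)

/-- Applying a functor in each degree to constant simplicial objects. -/
def constDegreewise (F : D ⥤ D') :
    SimplicialObject.const D ⋙ degreewise F ≅ F ⋙ SimplicialObject.const D' :=
  NatIso.ofComponents (fun X => Functor.constComp _ X F) (by
    intro X Y f
    ext; exact (Category.comp_id _).trans (Category.id_comp _).symm)

end Bisimplicial

/-! ### Localizations of functor categories -/

section Localization

variable {A : Type*} [Category* A] {B : Type*} [Category* B]

lemma isInvertedBy_comp_Q {W : MorphismProperty A} {W' : MorphismProperty B} (H : A ⥤ B)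
    (hH : W ≤ W'.inverseImage H) : W.IsInvertedBy (H ⋙ W'.Q) :=
  fun _ _ f hf => Localization.inverts W'.Q W' _ (hH f hf)

/-- The functor between localized categories induced by a functor preserving the classes of
morphisms to be inverted. -/
def locFunctor {W : MorphismProperty A} {W' : MorphismProperty B} (H : A ⥤ B)
    (hH : W ≤ W'.inverseImage H) : W.Localization ⥤ W'.Localization :=
  Localization.lift (H ⋙ W'.Q) (isInvertedBy_comp_Q H hH) W.Q

/-- The functor induced on localized categories is compatible with the localization functors. -/
def locFunctorFac {W : MorphismProperty A} {W' : MorphismProperty B} (H : A ⥤ B)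
    (hH : W ≤ W'.inverseImage H) : W.Q ⋙ locFunctor H hH ≅ H ⋙ W'.Q :=
  Localization.fac (H ⋙ W'.Q) (isInvertedBy_comp_Q H hH) W.Q

/-- The image of a morphism of a localized category under the functor induced by a functor
preserving the classes of morphisms to be inverted. -/
def locMap {W : MorphismProperty A} {W' : MorphismProperty B} (H : A ⥤ B)
    (hH : W ≤ W'.inverseImage H) {X Y : A} (f : W.Q.obj X ⟶ W.Q.obj Y) :
    W'.Q.obj (H.obj X) ⟶ W'.Q.obj (H.obj Y) :=
  (locFunctorFac H hH).inv.app X ≫ (locFunctor H hH).map f ≫ (locFunctorFac H hH).hom.app Y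

variable {D : Type u} [Category.{v} D] {D' : Type u'} [Category.{v'} D']

/-- The functor `Fun(B, D) ⥤ Fun(A, D)` of precomposition by a functor `A ⥤ B`, on morphisms of the
localizations by the objectwise equivalences. -/
def locPrecomp (E : MorphismProperty D) (G : A ⥤ B) {F₁ F₂ : B ⥤ D}
    (f : (E.functorCategory B).Q.obj F₁ ⟶ (E.functorCategory B).Q.obj F₂) :
    (E.functorCategory A).Q.obj (G ⋙ F₁) ⟶ (E.functorCategory A).Q.obj (G ⋙ F₂) :=
  locMap (W' := E.functorCategory A) ((Functor.whiskeringLeft A B D).obj G)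
    (fun _ _ _ hf a => hf (G.obj a)) f

/-- The functor `Fun(A, D) ⥤ Fun(A, D')` of postcomposition by a functor `H : D ⥤ D'` that preserves
equivalences, on morphisms of the localizations by the objectwise equivalences. -/
def locPostcomp {E : MorphismProperty D} {E' : MorphismProperty D'} (H : D ⥤ D')
    (hH : E ≤ E'.inverseImage H) {F₁ F₂ : A ⥤ D}
    (f : (E.functorCategory A).Q.obj F₁ ⟶ (E.functorCategory A).Q.obj F₂) :
    (E'.functorCategory A).Q.obj (F₁ ⋙ H) ⟶ (E'.functorCategory A).Q.obj (F₂ ⋙ H) :=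
  locMap (W' := E'.functorCategory A) ((Functor.whiskeringRight A D D').obj H)
    (fun _ _ _ hf a => hH _ (hf a)) f

/-- The functor `Fun(A, D) ⥤ Fun(ΔᵒᵖA, D)` that sends `F` to `X ↦ s(n ↦ F(Xₙ))`, where `s` preserves
degreewise equivalences, on morphisms of the localizations by the objectwise equivalences. -/
def locSimple {E : MorphismProperty D} (s : SimplicialObject D ⥤ D)
    (hs : ∀ ⦃X Y : SimplicialObject D⦄ (f : X ⟶ Y), (∀ n, E (f.app n)) → E (s.map f))
    {F₁ F₂ : A ⥤ D}
    (f : (E.functorCategory A).Q.obj F₁ ⟶ (E.functorCategory A).Q.obj F₂) :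
    (E.functorCategory (SimplicialObject A)).Q.obj (degreewise F₁ ⋙ s) ⟶
      (E.functorCategory (SimplicialObject A)).Q.obj (degreewise F₂ ⋙ s) :=
  locMap (W' := E.functorCategory (SimplicialObject A))
    (SimplicialObject.whiskering A D ⋙
      (Functor.whiskeringRight (SimplicialObject A) (SimplicialObject D) D).obj s)
    (fun _ _ _ hf X => hs _ fun n => hf (X.obj n)) f

end Localization

/-! ### Simplicial descent categories -/

/-- A coproduct indexed by `Option α` as a binary coproduct. -/
def sigmaOptionIso {D : Type u} [Category.{v} D] [HasFiniteCoproducts D] {α : Type} [Finite α]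
    (X : Option α → D) : ∐ X ≅ X none ⨿ ∐ (fun a => X (some a)) where
  hom := Sigma.desc fun j => match j with
    | none => coprod.inl
    | some a => Sigma.ι (fun a => X (some a)) a ≫ coprod.inr
  inv := coprod.desc (Sigma.ι X none) (Sigma.desc fun a => Sigma.ι X (some a))
  hom_inv_id := by
    refine Sigma.hom_ext _ _ fun j => ?_
    rcases j with _ | a
    · simp [coprod.inl_desc]
    · simp [coprod.inr_desc]
  inv_hom_id := by
    refine coprod.hom_ext ?_ (Eq.trans ?_ (Category.comp_id _).symm)
    · simp [coprod.inl_desc]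
    · rw [coprod.inr_desc_assoc]
      refine Sigma.hom_ext _ _ fun a => ?_
      simp

section Constructions

variable {D : Type u} [Category.{v} D]

section Spans

variable [HasTerminal D]

/-- The span `B ←f- A ⟶ *`. -/
abbrev coneSpan {A B : D} (f : A ⟶ B) : WalkingSpan ⥤ D :=
  span f (terminal.from A)

/-- The span `* ⟵ A ⟶ *`. -/
abbrev suspSpan (A : D) : WalkingSpan ⥤ D :=
  span (terminal.from A) (terminal.from A)

/-- The morphism of spans induced by a morphism of their middle objects. -/
def suspSpanMap {A B : D} (f : A ⟶ B) : suspSpan A ⟶ suspSpan B :=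
  spanHomMk f (𝟙 _) (𝟙 _) (terminal.hom_ext _ _) (terminal.hom_ext _ _)

lemma suspSpanMap_id (A : D) : suspSpanMap (𝟙 A) = 𝟙 _ := by
  ext (_ | _ | _) <;> rfl

lemma suspSpanMap_comp {A B C : D} (f : A ⟶ B) (g : B ⟶ C) :
    suspSpanMap (f ≫ g) = suspSpanMap f ≫ suspSpanMap g := by
  ext (_ | _ | _)
  · rfl
  · exact (Category.id_comp _).symm
  · exact (Category.id_comp _).symm

/-- The morphism of spans from `B ←f- A ⟶ *` to `* ⟵ A ⟶ *`. -/
def coneSpanToSusp {A B : D} (f : A ⟶ B) : coneSpan f ⟶ suspSpan A :=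
  spanHomMk (𝟙 _) (terminal.from B) (𝟙 _) (terminal.hom_ext _ _) (terminal.hom_ext _ _)

end Spans

variable [HasFiniteCoproducts D]

/-- The functor `cyl(f, g) = s Cyl(f × Δ, g × Δ)` on spans of `D`, where `- × Δ` is the constant
simplicial object. -/
abbrev cyl (s : SimplicialObject D ⥤ D) : (WalkingSpan ⥤ D) ⥤ D :=
  (Functor.whiskeringRight WalkingSpan D (SimplicialObject D)).obj (SimplicialObject.const D) ⋙
    Cyl ⋙ s

variable [HasTerminal D]

/-- The cone `c(f) = cyl(B ←f- A ⟶ *)` of a morphism `f : A ⟶ B`. -/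
abbrev cone (s : SimplicialObject D ⥤ D) {A B : D} (f : A ⟶ B) : D :=
  (cyl s).obj (coneSpan f)

/-- The suspension functor `Σ A = cyl(* ⟵ A ⟶ *)`. -/
def susp (s : SimplicialObject D ⥤ D) : D ⥤ D where
  obj A := (cyl s).obj (suspSpan A)
  map f := (cyl s).map (suspSpanMap f)
  map_id A := by
    rw [suspSpanMap_id, CategoryTheory.Functor.map_id]
  map_comp f g := by
    rw [suspSpanMap_comp, CategoryTheory.Functor.map_comp]

/-- The morphism `p : c(f) ⟶ Σ A` induced by the morphism from `f : A ⟶ B` to `A ⟶ *`. -/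
def coneToSusp (s : SimplicialObject D ⥤ D) {A B : D} (f : A ⟶ B) : cone s f ⟶ (susp s).obj A :=
  (cyl s).map (coneSpanToSusp f)

/-- The morphism `s(B × Δ) ⟶ c(f)` induced by the inclusion of `B × Δ` in the simplicial cone. -/
def simpleInlCone (s : SimplicialObject D ⥤ D) {A B : D} (f : A ⟶ B) :
    s.obj ((SimplicialObject.const D).obj B) ⟶ cone s f :=
  s.map (Cyl.inl (coneSpan f ⋙ SimplicialObject.const D))

end Constructions

section Compatibility

variable {D : Type u} [Category.{v} D]

/-- The identification of `s X` with `s` of the diagonal of `Δ × X`. -/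
def toConstLeft (s : SimplicialObject D ⥤ D) : s ⟶ constLeft D ⋙ diagonal D ⋙ s :=
  s.leftUnitor.inv ≫ Functor.whiskerRight (constLeftDiagonal D).inv s ≫
    (Functor.associator _ _ _).hom

/-- The identification of `s X` with `s` of the diagonal of `X × Δ`. -/
def toConstRight (s : SimplicialObject D ⥤ D) : s ⟶ constRight D ⋙ diagonal D ⋙ s :=
  s.leftUnitor.inv ≫ Functor.whiskerRight (constRightDiagonal D).inv s ≫
    (Functor.associator _ _ _).hom

/-- The transformation `λ_{s X} : s(s X × Δ) ⟶ s X`. -/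
def fromConstLeft {s : SimplicialObject D ⥤ D} (lam : SimplicialObject.const D ⋙ s ⟶ 𝟭 D) :
    constLeft D ⋙ iterated s ⟶ s :=
  (constLeftIterated s).hom ≫ Functor.whiskerLeft s lam ≫ s.rightUnitor.hom

/-- The transformation `s(λ_X) : s(n ↦ s(Xₙ × Δ)) ⟶ s X`. -/
def fromConstRight {s : SimplicialObject D ⥤ D} (lam : SimplicialObject.const D ⋙ s ⟶ 𝟭 D) :
    constRight D ⋙ iterated s ⟶ s :=
  (constRightIterated s).hom ≫
    Functor.whiskerRight ((SimplicialObject.whiskering D D).map lam) s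

end Compatibility

/-- A simplicial descent category structure `(E, s, μ, λ)` on a category `D` with finite coproducts
and a final object. -/
structure SimplicialDescentCategory (D : Type u) [Category.{v} D] [HasFiniteCoproducts D]
    [HasTerminal D] where
  /-- The class of equivalences. -/
  E : MorphismProperty D
  /-- The class of equivalences is saturated: it contains every morphism that becomes invertible in
  the localization of `D` by the equivalences. -/
  saturated {A B : D} (f : A ⟶ B) (hf : IsIso (E.Q.map f)) : E f
  coprod_map_mem {A B A' B' : D} (f : A ⟶ B) (g : A' ⟶ B') (hf : E f) (hg : E g) :
    E (coprod.map f g)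
  /-- The simple functor. -/
  s : SimplicialObject D ⥤ D
  coprodComparison_mem (X Y : SimplicialObject D) : E (coprodComparison s X Y)
  /-- The isomorphism between the simple of the diagonal and the iterated simple, in the category of
  functors from bisimplicial objects to `D` localized by the objectwise equivalences. -/
  μ : (E.functorCategory (SimplicialObject (SimplicialObject D))).Q.obj (diagonal D ⋙ s) ≅
    (E.functorCategory (SimplicialObject (SimplicialObject D))).Q.obj (iterated s)
  /-- The natural transformation `λ_A : s(A × Δ) ⟶ A`. -/
  lam : SimplicialObject.const D ⋙ s ⟶ 𝟭 D
  lam_mem (A : D) : E (lam.app A)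
  exists_section : ∃ ρ : 𝟭 D ⟶ SimplicialObject.const D ⋙ s, ρ ≫ lam = 𝟙 _
  /-- The simple of a degreewise equivalence is an equivalence. -/
  simple_mem ⦃X Y : SimplicialObject D⦄ (f : X ⟶ Y) (hf : ∀ n, E (f.app n)) : E (s.map f)
  /-- A morphism is an equivalence if and only if its cone is acyclic. -/
  mem_iff {A B : D} (f : A ⟶ B) : E f ↔ E (terminal.from (cone s f))
  /-- The equivalences are compatible with the order reversing involution of simplicial objects. -/
  rev_mem_iff {X Y : SimplicialObject D} (f : X ⟶ Y) :
    E (s.map (SimplicialObject.opFunctor.map f)) ↔ E (s.map f)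
  /-- The composition `s X ⟶ s(s X × Δ) ⟶ s X` of `μ` and `λ` is the identity. -/
  mu_lam_left :
    (E.functorCategory (SimplicialObject D)).Q.map (toConstLeft s) ≫
      locPrecomp E (constLeft D) μ.hom ≫
        (E.functorCategory (SimplicialObject D)).Q.map (fromConstLeft lam) = 𝟙 _
  /-- The composition `s X ⟶ s(n ↦ s(Xₙ × Δ)) ⟶ s X` of `μ` and `λ` is the identity. -/
  mu_lam_right :
    (E.functorCategory (SimplicialObject D)).Q.map (toConstRight s) ≫
      locPrecomp E (constRight D) μ.hom ≫
        (E.functorCategory (SimplicialObject D)).Q.map (fromConstRight lam) = 𝟙 _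

namespace SimplicialDescentCategory

variable {D : Type u} [Category.{v} D] [HasFiniteCoproducts D] [HasTerminal D]
  (S : SimplicialDescentCategory D)

/-- The homotopy category `D[E⁻¹]`. -/
abbrev Ho := S.E.Localization

lemma mem_iff_isIso {A B : D} (f : A ⟶ B) : S.E f ↔ IsIso (S.E.Q.map f) :=
  ⟨fun hf => Localization.inverts S.E.Q S.E f hf, S.saturated f⟩

lemma mem_of_isIso {A B : D} (f : A ⟶ B) [IsIso f] : S.E f :=
  S.saturated f inferInstance

lemma comp_mem {A B C : D} (f : A ⟶ B) (g : B ⟶ C) (hf : S.E f) (hg : S.E g) : S.E (f ≫ g) := by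
  rw [mem_iff_isIso] at *
  rw [Functor.map_comp]
  infer_instance

lemma sigma_map_mem_aux (J : Type) : ∀ (_ : Finite J) {X Y : J → D} (f : ∀ j, X j ⟶ Y j)
    (_ : ∀ j, S.E (f j)), S.E (Limits.Sigma.map f) := by
  refine fun hJ => Finite.induction_empty_option (P := fun J => ∀ (_ : Finite J) {X Y : J → D}
    (f : ∀ j, X j ⟶ Y j) (_ : ∀ j, S.E (f j)), S.E (Limits.Sigma.map f)) ?_ ?_ ?_ J hJ
  · intro α β e ih _ X Y f hf
    have : Finite α := Finite.of_equiv β e.symm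
    have h := ih this (fun a => f (e a)) (fun a => hf (e a))
    have h' : Limits.Sigma.map f = (Sigma.reindex e X).inv ≫
        Limits.Sigma.map (fun a => f (e a)) ≫ (Sigma.reindex e Y).hom := by
      rw [Iso.eq_inv_comp]
      refine Sigma.hom_ext _ _ fun a => ?_
      have h₁ := Sigma.ι_reindex_hom e X a
      have h₂ := Sigma.ι_reindex_hom e Y a
      rw [← Category.assoc, h₁, Sigma.ι_map, ← Category.assoc]
      refine Eq.trans ?_ (congrArg (· ≫ (Sigma.reindex e Y).hom)
        (Sigma.ι_map (fun a => f (e a)) a).symm)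
      refine Eq.trans ?_ (Category.assoc _ _ _).symm
      exact congrArg (f (e a) ≫ ·) h₂.symm
    rw [h']
    exact S.comp_mem _ _ (S.mem_of_isIso _) (S.comp_mem _ _ h (S.mem_of_isIso _))
  · intro _ X Y f hf
    have : IsIso (Limits.Sigma.map f) :=
      ⟨Sigma.desc (fun j => j.elim), Sigma.hom_ext _ _ fun j => j.elim,
        Sigma.hom_ext _ _ fun j => j.elim⟩
    exact S.mem_of_isIso _
  · intro α _ ih _ X Y f hf
    have h := S.coprod_map_mem _ _ (hf none)
      (ih inferInstance (fun a => f (some a)) (fun a => hf (some a)))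
    have h' : Limits.Sigma.map f = (sigmaOptionIso X).hom ≫
        coprod.map (f none) (Limits.Sigma.map (fun a => f (some a))) ≫
          (sigmaOptionIso Y).inv := by
      refine Sigma.hom_ext _ _ fun j => ?_
      rcases j with _ | a
      · simp [sigmaOptionIso, coprod.inl_desc]
      · simp [sigmaOptionIso, coprod.inr_desc]
    rw [h']
    exact S.comp_mem _ _ (S.mem_of_isIso _) (S.comp_mem _ _ h (S.mem_of_isIso _))

lemma sigma_map_mem {J : Type} [hJ : Finite J] {X Y : J → D} (f : ∀ j, X j ⟶ Y j)
    (hf : ∀ j, S.E (f j)) : S.E (Limits.Sigma.map f) :=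
  S.sigma_map_mem_aux J hJ f hf

lemma susp_map_mem {A B : D} (f : A ⟶ B) (hf : S.E f) : S.E ((susp S.s).map f) := by
  refine S.simple_mem _ fun n => S.sigma_map_mem
    (fun σ : n.unop ⟶ ⦋1⦌ => (suspSpanMap f).app (position σ)) fun σ => ?_
  rcases position σ with _ | _ | _
  · exact hf
  · exact S.mem_of_isIso (𝟙 _)
  · exact S.mem_of_isIso (𝟙 _)

/-- The suspension functor `Σ` on the homotopy category. -/
def hoSusp : S.Ho ⥤ S.Ho :=
  locFunctor (susp S.s) fun _ _ f hf => S.susp_map_mem f hf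

/-- The suspension functors of `D` and of its homotopy category are compatible. -/
def hoSuspFac : S.E.Q ⋙ S.hoSusp ≅ susp S.s ⋙ S.E.Q :=
  locFunctorFac _ _

/-- A simplicial descent category is stable if the suspension functor on its homotopy category is an
equivalence of categories. -/
def IsStable : Prop := S.hoSusp.IsEquivalence

/-- A natural section `ρ` of `λ`. -/
def rho : 𝟭 D ⟶ SimplicialObject.const D ⋙ S.s := S.exists_section.choose

/-- The canonical morphism `i : B ⟶ c(f)`. -/
def coneInl {A B : D} (f : A ⟶ B) : B ⟶ cone S.s f :=
  S.rho.app B ≫ simpleInlCone S.s f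

/-- The morphism `p : c(f) ⟶ Σ A` in the homotopy category. -/
def coneProj {A B : D} (f : A ⟶ B) :
    S.E.Q.obj (cone S.s f) ⟶ S.hoSusp.obj (S.E.Q.obj A) :=
  S.E.Q.map (coneToSusp S.s f) ≫ S.hoSuspFac.inv.app A

/-- The triangle `X -u→ Y -v→ Z -w→ Σ X` of the homotopy category is a cofiber sequence: it is
isomorphic to `A -f→ B -i→ c(f) -p→ Σ A` for some morphism `f` of `D`. -/
def IsCofiberSequence {X Y Z : S.Ho} (u : X ⟶ Y) (v : Y ⟶ Z) (w : Z ⟶ S.hoSusp.obj X) : Prop :=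
  ∃ (A B : D) (f : A ⟶ B) (e₁ : X ≅ S.E.Q.obj A) (e₂ : Y ≅ S.E.Q.obj B)
    (e₃ : Z ≅ S.E.Q.obj (cone S.s f)),
    u ≫ e₂.hom = e₁.hom ≫ S.E.Q.map f ∧
    v ≫ e₃.hom = e₂.hom ≫ S.E.Q.map (S.coneInl f) ∧
    w ≫ S.hoSusp.map e₁.hom = e₃.hom ≫ S.coneProj f

/-- A structure of triangulated category (in the sense of Verdier) on the homotopy category, whose
shift functor is the suspension and whose distinguished triangles are the cofiber sequences. -/
structure TriangulatedStructure where
  [preadditive : Preadditive S.Ho]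
  [hasZeroObject : HasZeroObject S.Ho]
  [hasFiniteBiproducts : HasFiniteBiproducts S.Ho]
  [hasShift : HasShift S.Ho ℤ]
  [additive_shiftFunctor : ∀ n : ℤ, (shiftFunctor S.Ho n).Additive]
  /-- The shift functor is the suspension. -/
  shiftIso : shiftFunctor S.Ho (1 : ℤ) ≅ S.hoSusp
  [pretriangulated : Pretriangulated S.Ho]
  [isTriangulated : IsTriangulated S.Ho]
  distinguished_iff (T : Pretriangulated.Triangle S.Ho) :
    T ∈ Pretriangulated.distinguishedTriangles ↔
      S.IsCofiberSequence T.mor₁ T.mor₂ (T.mor₃ ≫ shiftIso.hom.app T.obj₁)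

end SimplicialDescentCategory

section DescentFunctor

variable {D : Type u} [Category.{v} D] [HasFiniteCoproducts D] [HasTerminal D]
  {D' : Type u'} [Category.{v'} D'] [HasFiniteCoproducts D'] [HasTerminal D']
  (S : SimplicialDescentCategory D) (S' : SimplicialDescentCategory D') (F : D ⥤ D')

/-- The compatibility of a comparison `Θ : F s ⟶ s' F` with `λ` and `λ'`: the composition
`F(s(A × Δ)) ⟶ s'(F A × Δ) ⟶ F A` of `Θ` and `λ'` is `F(λ_A)`. -/
def CompatibleLam (Θ : (S'.E.functorCategory (SimplicialObject D)).Q.obj (S.s ⋙ F) ⟶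
    (S'.E.functorCategory (SimplicialObject D)).Q.obj (degreewise F ⋙ S'.s)) : Prop :=
  locPrecomp S'.E (SimplicialObject.const D) Θ ≫
    (S'.E.functorCategory D).Q.map ((Functor.associator _ _ _).inv ≫
      Functor.whiskerRight (constDegreewise F).hom S'.s ≫ (Functor.associator _ _ _).hom ≫
        Functor.whiskerLeft F S'.lam ≫ F.rightUnitor.hom) =
  (S'.E.functorCategory D).Q.map ((Functor.associator _ _ _).inv ≫
    Functor.whiskerRight S.lam F ≫ F.leftUnitor.hom)

/-- The compatibility of a comparison `Θ : F s ⟶ s' F` with `μ` and `μ'`: the composition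
`F(s D Z) ⟶ s'(D F Z) ⟶ s' s' F Z` of `Θ` and `μ'` is equal to the composition
`F(s D Z) ⟶ F(s s Z) ⟶ s'(F s Z) ⟶ s' s' F Z` of `F(μ)`, `Θ` and `s'(Θ)`. -/
def CompatibleMu (hF : S.E ≤ S'.E.inverseImage F)
    (Θ : (S'.E.functorCategory (SimplicialObject D)).Q.obj (S.s ⋙ F) ⟶
      (S'.E.functorCategory (SimplicialObject D)).Q.obj (degreewise F ⋙ S'.s)) : Prop :=
  locPrecomp S'.E (diagonal D) Θ ≫
    (S'.E.functorCategory _).Q.map ((Functor.associator _ _ _).inv ≫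
      Functor.whiskerRight (diagonalDegreewise F).hom S'.s ≫ (Functor.associator _ _ _).hom) ≫
    locPrecomp S'.E (degreewise (degreewise F)) S'.μ.hom =
  (S'.E.functorCategory _).Q.map (Functor.associator _ _ _).inv ≫
    locPostcomp F hF S.μ.hom ≫
    (S'.E.functorCategory _).Q.map (Functor.associator _ _ _).hom ≫
    locPrecomp S'.E (degreewise S.s) Θ ≫
    (S'.E.functorCategory _).Q.map ((Functor.associator _ _ _).inv ≫
      Functor.whiskerRight (degreewiseComp S.s F).hom S'.s) ≫
    locSimple S'.s S'.simple_mem Θ ≫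
    (S'.E.functorCategory _).Q.map
      (Functor.whiskerRight (degreewiseComp (degreewise F) S'.s).inv S'.s ≫ (Functor.associator _ _ _).hom)

/-- Descent functors between simplicial descent categories. -/
structure IsDescentFunctor : Prop where
  map_mem : S.E ≤ S'.E.inverseImage F
  coprodComparison_mem (A B : D) : S'.E (coprodComparison F A B)
  terminal_mem : S'.E (terminal.from (F.obj (⊤_ D)))
  exists_comparison : ∃ Θ : (S'.E.functorCategory (SimplicialObject D)).Q.obj (S.s ⋙ F) ≅
      (S'.E.functorCategory (SimplicialObject D)).Q.obj (degreewise F ⋙ S'.s),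
    CompatibleLam S S' F Θ.hom ∧ CompatibleMu S S' F map_mem Θ.hom

variable {S S' F}

/-- The functor induced by a descent functor on homotopy categories. -/
def IsDescentFunctor.hoFunctor (hF : IsDescentFunctor S S' F) : S.Ho ⥤ S'.Ho :=
  locFunctor F hF.map_mem

/-- A functor between homotopy categories is triangulated with respect to given triangulated
structures: it commutes with the shift functors, up to a natural isomorphism with respect to which
it preserves distinguished triangles. -/
def IsTriangulatedFunctor (T : S.TriangulatedStructure) (T' : S'.TriangulatedStructure)
    (G : S.Ho ⥤ S'.Ho) : Prop :=
  letI := T.preadditive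
  letI := T.hasZeroObject
  letI := T.hasShift
  letI := T.additive_shiftFunctor
  letI := T.pretriangulated
  letI := T'.preadditive
  letI := T'.hasZeroObject
  letI := T'.hasShift
  letI := T'.additive_shiftFunctor
  letI := T'.pretriangulated
  ∃ _ : G.CommShift ℤ, G.IsTriangulated

end DescentFunctor

end SimplicialDescent

/-! The basic object is the homotopy pushout `cy f g` of a span, of which cones and suspensions are
special cases. It is invariant under objectwise equivalences, because `s` and finite coproducts are.
The isomorphism `μ` enters through double cylinders: a span of spans gives a bisimplicial object
whose iterated simple is the iterated homotopy pushout, up to equivalence, and whose diagonal does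
not depend on the order of the two directions. Since `μ` makes the iterated simple and the simple of
the diagonal detect the same equivalences, homotopy pushouts commute with each other in the sense
needed here (`cyl_cyl_map_mem_iff`). Glueing along one end of a cylinder is the case in which some
spans are trivial (`cy_inl_mem`, `cy_inr_mem`). Together with the acyclicity criterion for
equivalences, and order reversal for the other side, glueing shows that equivalences are stable
under homotopy cobase change (`inr_mem`, `inl_mem`).

Cobase change gives a weak calculus of fractions. Every morphism of the homotopy category is a
fraction `A → V ← B`. The connected components of such cospans form a functor of `B` that inverts
equivalences, so two morphisms of `D` that agree in the homotopy category are joined by a zigzag of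
strict morphisms of cospans (`eqvGen_of_Q_map_eq`). Every step of the zigzag acts on cones, and thus
any square that commutes in the homotopy category extends to a morphism of cofiber sequences,
invertible if its two given sides are (`exists_isFill`). The same zigzags show that binary
coproducts of `D` remain coproducts in the homotopy category.

The homotopies needed for the other axioms all come from one fact: of two consecutive cylinders,
collapsing the first or the second gives the same morphism in the homotopy category
(`Q_collapse_eq`). The comparison `θ` of the two collapses is invertible, and the relations between
the three collapses of a triple cylinder make it idempotent. This yields the octahedron, by
comparing the cones of `f`, `f ≫ g` and `g` with those of `𝟙 B`, `g` and `g` (`Q_octM`). It also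
locates the sign in the rotation, by comparing the two ways of collapsing one half of a double cone.

Stability makes the final object a zero object: the suspension of the initial object is `* ⨿ *`,
which is then initial and has `*` as a retract. The pinch of a suspension to a wedge has components
`𝟙` and an automorphism `hoNeg`, and its composition with the fold factors through an acyclic cone.
Correcting the second component by the inverse of `hoNeg` gives a natural counital comultiplication
on suspensions. By stability every object is a suspension and every morphism between suspensions is
one, so coproducts are biproducts, and the vanishing of the fold says that `hoNeg` is `-𝟙`.

The autoequivalence `Σ` becomes a shift by `ℤ` after passing to sequences `X n` with isomorphisms `Σ
(X n) ≅ X (n + 1)`: translation acts on these, and evaluation at `0` is an equivalence. The axioms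
of Verdier then follow from the cone constructions.

A descent functor `F` preserves the coproducts in a cylinder up to equivalence and commutes with
simples through `Θ`, so it sends cones to cones; compatibility with `λ` matches the inclusions of
the bases. A commutation with the shift by `1` extends to all of `ℤ` because that shift is an
equivalence (`exists_commShift`). -/

namespace SimplicialDescent

/-! ### Maps out of cylinders -/

section CylinderMaps

variable {D : Type u} [Category.{v} D] [HasFiniteCoproducts D]

/-- The inclusion into a cylinder of the summand indexed by a simplex of `Δ[1]`. -/
def cylIn (F : WalkingSpan ⥤ SimplicialObject D) (n : SimplexCategoryᵒᵖ) (σ : n.unop ⟶ ⦋1⦌) :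
    (F.obj (position σ)).obj n ⟶ (Cyl.obj F).obj n :=
  cylι F n σ

lemma cyl_hom_ext {F : WalkingSpan ⥤ SimplicialObject D} {n : SimplexCategoryᵒᵖ} {T : D}
    {t t' : (Cyl.obj F).obj n ⟶ T} (h : ∀ σ, cylIn F n σ ≫ t = cylIn F n σ ≫ t') : t = t' :=
  Sigma.hom_ext _ _ h

/-- The morphism out of the object of `n`-simplices of a cylinder with given components. -/
def cylDesc {F : WalkingSpan ⥤ SimplicialObject D} {n : SimplexCategoryᵒᵖ} {T : D}
    (t : ∀ σ : n.unop ⟶ ⦋1⦌, (F.obj (position σ)).obj n ⟶ T) : (Cyl.obj F).obj n ⟶ T :=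
  Sigma.desc t

lemma cylIn_cylDesc {F : WalkingSpan ⥤ SimplicialObject D} {n : SimplexCategoryᵒᵖ} {T : D}
    (t : ∀ σ : n.unop ⟶ ⦋1⦌, (F.obj (position σ)).obj n ⟶ T) (σ : n.unop ⟶ ⦋1⦌) :
    cylIn F n σ ≫ cylDesc t = t σ :=
  Sigma.ι_desc _ _

lemma cylIn_map (F : WalkingSpan ⥤ SimplicialObject D) {n m : SimplexCategoryᵒᵖ} (θ : n ⟶ m)
    (σ : n.unop ⟶ ⦋1⦌) :
    cylIn F n σ ≫ (Cyl.obj F).map θ = (F.map (positionHom θ.unop σ)).app n ≫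
      (F.obj (position (θ.unop ≫ σ))).map θ ≫ cylIn F m (θ.unop ≫ σ) :=
  ι_cylOp F θ σ _ rfl _

lemma cylIn_app {F G : WalkingSpan ⥤ SimplicialObject D} (α : F ⟶ G) (n : SimplexCategoryᵒᵖ)
    (σ : n.unop ⟶ ⦋1⦌) :
    cylIn F n σ ≫ (Cyl.map α).app n = (α.app (position σ)).app n ≫ cylIn G n σ :=
  Sigma.ι_map (fun σ => (α.app (position σ)).app n) σ

lemma Cyl.inl_app (F : WalkingSpan ⥤ SimplicialObject D) (n : SimplexCategoryᵒᵖ) :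
    (Cyl.inl F).app n = (F.map (eqToHom (position_const_one n.unop).symm)).app n ≫
      cylIn F n (SimplexCategory.const n.unop ⦋1⦌ 1) :=
  rfl

lemma Cyl.inr_app (F : WalkingSpan ⥤ SimplicialObject D) (n : SimplexCategoryᵒᵖ) :
    (Cyl.inr F).app n = (F.map (eqToHom (position_const_zero n.unop).symm)).app n ≫
      cylIn F n (SimplexCategory.const n.unop ⦋1⦌ 0) :=
  rfl

/-- The morphism from a cylinder to the point of a cocone on its span. -/
def cylToCocone {F : WalkingSpan ⥤ SimplicialObject D} {T : SimplicialObject D}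
    (c : F ⟶ (Functor.const _).obj T) : Cyl.obj F ⟶ T where
  app n := cylDesc fun σ => (c.app (position σ)).app n
  naturality n m θ := by
    refine cyl_hom_ext fun σ => ?_
    have h2 := congrArg (fun t => t.app n) (c.naturality (positionHom θ.unop σ))
    have h3 := (c.app (position σ)).naturality θ
    have h4 := (c.app (position (θ.unop ≫ σ))).naturality θ
    dsimp at h2 h3 h4
    rw [Category.comp_id] at h2
    rw [reassoc_of% (cylIn_map F θ σ), cylIn_cylDesc, reassoc_of% (cylIn_cylDesc
      (F := F) (n := n)), h4, ← h2]
    simp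

lemma cylIn_cylToCocone_app {F : WalkingSpan ⥤ SimplicialObject D} {T : SimplicialObject D}
    (c : F ⟶ (Functor.const _).obj T) (n : SimplexCategoryᵒᵖ) (σ : n.unop ⟶ ⦋1⦌) :
    cylIn F n σ ≫ (cylToCocone c).app n = (c.app (position σ)).app n :=
  cylIn_cylDesc _ _

lemma Cyl.inl_cylToCocone {F : WalkingSpan ⥤ SimplicialObject D} {T : SimplicialObject D}
    (c : F ⟶ (Functor.const _).obj T) :
    Cyl.inl F ≫ cylToCocone c = c.app WalkingSpan.left := by
  ext n
  rw [NatTrans.comp_app, Cyl.inl_app, Category.assoc, cylIn_cylToCocone_app]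
  simp

lemma Cyl.inr_cylToCocone {F : WalkingSpan ⥤ SimplicialObject D} {T : SimplicialObject D}
    (c : F ⟶ (Functor.const _).obj T) :
    Cyl.inr F ≫ cylToCocone c = c.app WalkingSpan.right := by
  ext n
  rw [NatTrans.comp_app, Cyl.inr_app, Category.assoc, cylIn_cylToCocone_app]
  simp

lemma Cyl.map_cylToCocone {F G : WalkingSpan ⥤ SimplicialObject D} (α : F ⟶ G)
    {T : SimplicialObject D} (c : G ⟶ (Functor.const _).obj T) :
    Cyl.map α ≫ cylToCocone c = cylToCocone (α ≫ c) := by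
  refine NatTrans.ext (funext fun n => cyl_hom_ext fun σ => ?_)
  rw [NatTrans.comp_app, reassoc_of% (cylIn_app α n σ), cylIn_cylToCocone_app,
    cylIn_cylToCocone_app]
  rfl

lemma cylToCocone_comp {F : WalkingSpan ⥤ SimplicialObject D} {T T' : SimplicialObject D}
    (c : F ⟶ (Functor.const _).obj T) (t : T ⟶ T') :
    cylToCocone c ≫ t = cylToCocone (c ≫ (Functor.const _).map t) := by
  refine NatTrans.ext (funext fun n => cyl_hom_ext fun σ => ?_)
  rw [NatTrans.comp_app, reassoc_of% (cylIn_cylToCocone_app c n σ), cylIn_cylToCocone_app]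
  rfl

lemma Cyl.inl_map {F G : WalkingSpan ⥤ SimplicialObject D} (α : F ⟶ G) :
    Cyl.inl F ≫ Cyl.map α = α.app WalkingSpan.left ≫ Cyl.inl G := by
  ext n
  have h := congrArg (fun t => t.app n)
    (α.naturality (eqToHom (position_const_one n.unop).symm))
  dsimp only [NatTrans.comp_app] at h
  rw [NatTrans.comp_app, NatTrans.comp_app, Cyl.inl_app, Cyl.inl_app, Category.assoc, cylIn_app,
    reassoc_of% h]

lemma Cyl.inr_map {F G : WalkingSpan ⥤ SimplicialObject D} (α : F ⟶ G) :
    Cyl.inr F ≫ Cyl.map α = α.app WalkingSpan.right ≫ Cyl.inr G := by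
  ext n
  have h := congrArg (fun t => t.app n)
    (α.naturality (eqToHom (position_const_zero n.unop).symm))
  dsimp only [NatTrans.comp_app] at h
  rw [NatTrans.comp_app, NatTrans.comp_app, Cyl.inr_app, Cyl.inr_app, Category.assoc, cylIn_app,
    reassoc_of% h]

end CylinderMaps

/-! ### Closure properties of equivalences, and strict maps into and out of homotopy pushouts. -/

namespace SimplicialDescentCategory

variable {D : Type u} [Category.{v} D] [HasFiniteCoproducts D] [HasTerminal D]
  (S : SimplicialDescentCategory D)

lemma rho_lam (A : D) : S.rho.app A ≫ S.lam.app A = 𝟙 A :=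
  congrArg (fun t => t.app A) S.exists_section.choose_spec

lemma of_comp_right {A B C : D} {f : A ⟶ B} {g : B ⟶ C} (hf : S.E f) (h : S.E (f ≫ g)) :
    S.E g := by
  rw [mem_iff_isIso] at *
  rw [Functor.map_comp] at h
  exact IsIso.of_isIso_comp_left (S.E.Q.map f) _

lemma of_comp_left {A B C : D} {f : A ⟶ B} {g : B ⟶ C} (hg : S.E g) (h : S.E (f ≫ g)) :
    S.E f := by
  rw [mem_iff_isIso] at *
  rw [Functor.map_comp] at h
  exact IsIso.of_isIso_comp_right _ (S.E.Q.map g)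

lemma id_mem (A : D) : S.E (𝟙 A) := S.mem_of_isIso _

/-- A square of morphisms with parallel sides in the class of equivalences. -/
lemma mem_iff_of_square {A B A' B' : D} {f : A ⟶ B} {f' : A' ⟶ B'} {a : A ⟶ A'} {b : B ⟶ B'}
    (ha : S.E a) (hb : S.E b) (w : f ≫ b = a ≫ f') : S.E f ↔ S.E f' :=
  ⟨fun h => S.of_comp_right ha (w ▸ S.comp_mem _ _ h hb),
    fun h => S.of_comp_left hb (w ▸ S.comp_mem _ _ ha h)⟩

variable {X Y Z X' Y' Z' X'' Y'' Z'' : D}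

/-- The homotopy pushout of `Y ←f- X -g→ Z`. -/
abbrev cy (f : X ⟶ Y) (g : X ⟶ Z) : D := (cyl S.s).obj (span f g)

variable {f : X ⟶ Y} {g : X ⟶ Z} {f' : X' ⟶ Y'} {g' : X' ⟶ Z'} {f'' : X'' ⟶ Y''} {g'' : X'' ⟶ Z''}

/-- The functoriality of homotopy pushouts. -/
def cyMap (x : X ⟶ X') (y : Y ⟶ Y') (z : Z ⟶ Z') (hy : f ≫ y = x ≫ f') (hz : g ≫ z = x ≫ g') :
    S.cy f g ⟶ S.cy f' g' :=
  (cyl S.s).map (spanHomMk (F := span f g) (G := span f' g') x y z hy hz)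

lemma cyMap_comp (x : X ⟶ X') (y : Y ⟶ Y') (z : Z ⟶ Z') (hy : f ≫ y = x ≫ f')
    (hz : g ≫ z = x ≫ g') (x' : X' ⟶ X'') (y' : Y' ⟶ Y'') (z' : Z' ⟶ Z'')
    (hy' : f' ≫ y' = x' ≫ f'') (hz' : g' ≫ z' = x' ≫ g'') :
    S.cyMap x y z hy hz ≫ S.cyMap x' y' z' hy' hz' =
      S.cyMap (x ≫ x') (y ≫ y') (z ≫ z') (by rw [reassoc_of% hy, hy', Category.assoc])
        (by rw [reassoc_of% hz, hz', Category.assoc]) := by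
  refine ((cyl S.s).map_comp _ _).symm.trans (congrArg (cyl S.s).map ?_)
  ext (_ | _ | _) <;> rfl

lemma cyl_map_mem {F G : WalkingSpan ⥤ D} (α : F ⟶ G) (h : ∀ i, S.E (α.app i)) :
    S.E ((cyl S.s).map α) :=
  S.simple_mem _ fun n => S.sigma_map_mem
    (fun σ : n.unop ⟶ ⦋1⦌ => α.app (position σ)) fun _ => h _

lemma cyMap_mem (x : X ⟶ X') (y : Y ⟶ Y') (z : Z ⟶ Z') (hy : f ≫ y = x ≫ f')
    (hz : g ≫ z = x ≫ g') (hx : S.E x) (hy' : S.E y) (hz' : S.E z) : S.E (S.cyMap x y z hy hz) :=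
  S.cyl_map_mem _ (by rintro (_ | _ | _) <;> assumption)

variable (f g) in
/-- The inclusion of the left object in a homotopy pushout. -/
def inl : Y ⟶ S.cy f g :=
  S.rho.app Y ≫ S.s.map (Cyl.inl (span f g ⋙ SimplicialObject.const D))

variable (f g) in
/-- The inclusion of the right object in a homotopy pushout. -/
def inr : Z ⟶ S.cy f g :=
  S.rho.app Z ≫ S.s.map (Cyl.inr (span f g ⋙ SimplicialObject.const D))

lemma inl_cyMap (x : X ⟶ X') (y : Y ⟶ Y') (z : Z ⟶ Z') (hy : f ≫ y = x ≫ f')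
    (hz : g ≫ z = x ≫ g') : S.inl f g ≫ S.cyMap x y z hy hz = y ≫ S.inl f' g' := by
  have h := S.rho.naturality y
  have h2 := congrArg S.s.map (Cyl.inl_map (Functor.whiskerRight (spanHomMk (F := span f g) (G := span f' g') x y z hy hz)
    (SimplicialObject.const D)))
  refine (Category.assoc _ _ _).trans ?_
  refine (congrArg (S.rho.app Y ≫ ·) ((S.s.map_comp _ _).symm.trans
    (h2.trans (S.s.map_comp _ _)))).trans ?_
  refine (Category.assoc _ _ _).symm.trans (Eq.trans ?_ (Category.assoc _ _ _))
  exact congrArg (· ≫ S.s.map (Cyl.inl (span f' g' ⋙ SimplicialObject.const D))) h.symm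

lemma inr_cyMap (x : X ⟶ X') (y : Y ⟶ Y') (z : Z ⟶ Z') (hy : f ≫ y = x ≫ f')
    (hz : g ≫ z = x ≫ g') : S.inr f g ≫ S.cyMap x y z hy hz = z ≫ S.inr f' g' := by
  have h := S.rho.naturality z
  have h2 := congrArg S.s.map (Cyl.inr_map (Functor.whiskerRight (spanHomMk (F := span f g) (G := span f' g') x y z hy hz)
    (SimplicialObject.const D)))
  refine (Category.assoc _ _ _).trans ?_
  refine (congrArg (S.rho.app Z ≫ ·) ((S.s.map_comp _ _).symm.trans
    (h2.trans (S.s.map_comp _ _)))).trans ?_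
  refine (Category.assoc _ _ _).symm.trans (Eq.trans ?_ (Category.assoc _ _ _))
  exact congrArg (· ≫ S.s.map (Cyl.inr (span f' g' ⋙ SimplicialObject.const D))) h.symm

/-- The cocone on a span of constant simplicial objects given by a commutative square. -/
def spanCocone {T : D} (y : Y ⟶ T) (z : Z ⟶ T) (h : f ≫ y = g ≫ z) :
    span f g ⋙ SimplicialObject.const D ⟶
      (Functor.const _).obj ((SimplicialObject.const D).obj T) where
  app i := (SimplicialObject.const D).map ((PushoutCocone.mk y z h).ι.app i)
  naturality i j a := by
    have := (PushoutCocone.mk y z h).w a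
    exact ((SimplicialObject.const D).map_comp _ _).symm.trans
      ((congrArg (SimplicialObject.const D).map this).trans (Category.comp_id _).symm)

/-- The morphism from a homotopy pushout determined by a strictly commutative square. -/
def cyDesc {T : D} (y : Y ⟶ T) (z : Z ⟶ T) (h : f ≫ y = g ≫ z) : S.cy f g ⟶ T :=
  S.s.map (cylToCocone (spanCocone y z h)) ≫
    S.lam.app T

lemma inl_cyDesc {T : D} (y : Y ⟶ T) (z : Z ⟶ T) (h : f ≫ y = g ≫ z) :
    S.inl f g ≫ S.cyDesc y z h = y := by
  have h1 := S.lam.naturality y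
  have h2 := congrArg S.s.map (Cyl.inl_cylToCocone (spanCocone y z h))
  refine (Category.assoc _ _ _).trans ?_
  refine (congrArg (S.rho.app Y ≫ ·) ((Category.assoc _ _ _).symm.trans
    (congrArg (· ≫ S.lam.app T) ((S.s.map_comp _ _).symm.trans h2)))).trans ?_
  refine (congrArg (S.rho.app Y ≫ ·) h1).trans ?_
  exact (Category.assoc _ _ _).symm.trans ((congrArg (· ≫ y) (S.rho_lam Y)).trans
    (Category.id_comp _))

lemma inr_cyDesc {T : D} (y : Y ⟶ T) (z : Z ⟶ T) (h : f ≫ y = g ≫ z) :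
    S.inr f g ≫ S.cyDesc y z h = z := by
  have h1 := S.lam.naturality z
  have h2 := congrArg S.s.map (Cyl.inr_cylToCocone (spanCocone y z h))
  refine (Category.assoc _ _ _).trans ?_
  refine (congrArg (S.rho.app Z ≫ ·) ((Category.assoc _ _ _).symm.trans
    (congrArg (· ≫ S.lam.app T) ((S.s.map_comp _ _).symm.trans h2)))).trans ?_
  refine (congrArg (S.rho.app Z ≫ ·) h1).trans ?_
  exact (Category.assoc _ _ _).symm.trans ((congrArg (· ≫ z) (S.rho_lam Z)).trans
    (Category.id_comp _))

lemma cyMap_cyDesc (x : X ⟶ X') (y : Y ⟶ Y') (z : Z ⟶ Z') (hy : f ≫ y = x ≫ f')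
    (hz : g ≫ z = x ≫ g') {T : D} (y' : Y' ⟶ T) (z' : Z' ⟶ T) (h : f' ≫ y' = g' ≫ z') :
    S.cyMap x y z hy hz ≫ S.cyDesc y' z' h =
      S.cyDesc (y ≫ y') (z ≫ z') (by rw [reassoc_of% hy, reassoc_of% hz, h]) := by
  refine (Category.assoc _ _ _).symm.trans (congrArg (· ≫ S.lam.app T) ?_)
  refine (S.s.map_comp _ _).symm.trans (congrArg S.s.map ?_)
  refine (Cyl.map_cylToCocone _ _).trans ?_
  refine congrArg cylToCocone (NatTrans.ext (funext ?_))
  have e : x ≫ f' ≫ y' = f ≫ y ≫ y' := by rw [reassoc_of% hy]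
  rintro (_ | _ | _)
  · exact ((SimplicialObject.const D).map_comp _ _).symm.trans
      (congrArg (SimplicialObject.const D).map e)
  all_goals exact ((SimplicialObject.const D).map_comp _ _).symm

lemma cyDesc_comp {T T' : D} (y : Y ⟶ T) (z : Z ⟶ T) (h : f ≫ y = g ≫ z) (t : T ⟶ T') :
    S.cyDesc y z h ≫ t = S.cyDesc (y ≫ t) (z ≫ t) (by rw [reassoc_of% h]) := by
  refine (Category.assoc _ _ _).trans ?_
  refine (congrArg (S.s.map _ ≫ ·) (S.lam.naturality t).symm).trans ?_
  refine (Category.assoc _ _ _).symm.trans (congrArg (· ≫ S.lam.app T') ?_)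
  refine (S.s.map_comp _ _).symm.trans (congrArg S.s.map ?_)
  refine (cylToCocone_comp _ _).trans ?_
  refine congrArg cylToCocone (NatTrans.ext (funext ?_))
  rintro (_ | _ | _)
  · exact ((SimplicialObject.const D).map_comp _ _).symm.trans
      (congrArg (SimplicialObject.const D).map (Category.assoc _ _ _))
  all_goals exact ((SimplicialObject.const D).map_comp _ _).symm

/-- The cylinder of a span is determined by its two legs. -/
lemma cyl_map_mem_iff {F G : WalkingSpan ⥤ D} (α : F ⟶ G) :
    S.E ((cyl S.s).map α) ↔
      S.E (S.cyMap (α.app WalkingSpan.zero) (α.app WalkingSpan.left) (α.app WalkingSpan.right)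
        (α.naturality WalkingSpan.Hom.fst) (α.naturality WalkingSpan.Hom.snd)) := by
  refine S.mem_iff_of_square (S.mem_of_isIso ((cyl S.s).map (diagramIsoSpan F).hom))
    (S.mem_of_isIso ((cyl S.s).map (diagramIsoSpan G).hom)) ?_
  refine ((cyl S.s).map_comp _ _).symm.trans (Eq.trans (congrArg (cyl S.s).map ?_)
    ((cyl S.s).map_comp _ _))
  ext (_ | _ | _) <;> exact (Category.comp_id _).trans (Category.id_comp _).symm

end SimplicialDescentCategory

/-! ### Morphisms of localized functor categories -/

section LocEval

/-- An induction principle for morphisms of a localized category. -/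
lemma loc_induction {C : Type*} [Category* C] {W : MorphismProperty C}
    (P : ∀ ⦃A B : C⦄, (W.Q.obj A ⟶ W.Q.obj B) → Prop)
    (map : ∀ ⦃A B : C⦄ (f : A ⟶ B), P (W.Q.map f))
    (inv : ∀ ⦃A B : C⦄ (w : A ⟶ B) (hw : W w), P (Localization.Construction.wInv w hw))
    (comp : ∀ ⦃A B B' : C⦄ (f : W.Q.obj A ⟶ W.Q.obj B) (g : W.Q.obj B ⟶ W.Q.obj B'),
      P f → P g → P (f ≫ g)) {A B : C} (f : W.Q.obj A ⟶ W.Q.obj B) : P f := by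
  let P' : MorphismProperty W.Localization := fun X Y f =>
    P (A := (Localization.Construction.objEquiv W).symm X)
      (B := (Localization.Construction.objEquiv W).symm Y) f
  have : P'.IsStableUnderComposition := ⟨fun f g hf hg => comp f g hf hg⟩
  have h := Localization.Construction.morphismProperty_eq_top P' (fun _ _ f => map f)
    (fun _ _ w hw => inv w hw)
  have h' : P' f := by rw [h]; trivial
  exact h'

variable {A : Type*} [Category* A] {B : Type*} [Category* B]

section

variable {W : MorphismProperty A} {W' : MorphismProperty B} (H : A ⥤ B)
    (hH : W ≤ W'.inverseImage H)

lemma locMap_map {X Y : A} (f : X ⟶ Y) :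
    locMap (W := W) (W' := W') H hH (W.Q.map f) = W'.Q.map (H.map f) := by
  have h := (locFunctorFac (W := W) (W' := W') H hH).hom.naturality f
  dsimp only [locMap]
  exact (congrArg (_ ≫ ·) h).trans (Iso.inv_hom_id_app_assoc _ _ _)

lemma locMap_comp {X Y Z : A} (f : W.Q.obj X ⟶ W.Q.obj Y) (g : W.Q.obj Y ⟶ W.Q.obj Z) :
    locMap (W := W) (W' := W') H hH (f ≫ g) =
      locMap (W := W) (W' := W') H hH f ≫ locMap (W := W) (W' := W') H hH g := by
  simp only [locMap, Category.assoc, Iso.hom_inv_id_app_assoc, Functor.map_comp]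

end

variable {D : Type u} [Category.{v} D] {D' : Type u'} [Category.{v'} D']

lemma isInvertedBy_whiskeringRight_Q (E : MorphismProperty D) (A : Type*) [Category* A] :
    (E.functorCategory A).IsInvertedBy ((Functor.whiskeringRight A D E.Localization).obj E.Q) := by
  intro F G α hα
  have : ∀ a, IsIso ((((Functor.whiskeringRight A D E.Localization).obj E.Q).map α).app a) :=
    fun a => Localization.inverts E.Q E _ (hα a)
  exact NatIso.isIso_of_isIso_app _

/-- The comparison functor from a localized functor category to the functors with values in the
localized category. -/
def locEvalFunctor (E : MorphismProperty D) (A : Type*) [Category* A] :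
    (E.functorCategory A).Localization ⥤ A ⥤ E.Localization :=
  Localization.lift _ (isInvertedBy_whiskeringRight_Q E A) (E.functorCategory A).Q

/-- The comparison functor is compatible with the localization functors. -/
def locEvalFac (E : MorphismProperty D) (A : Type*) [Category* A] :
    (E.functorCategory A).Q ⋙ locEvalFunctor E A ≅
      (Functor.whiskeringRight A D E.Localization).obj E.Q :=
  Localization.fac _ (isInvertedBy_whiskeringRight_Q E A) (E.functorCategory A).Q

/-- The natural transformation of functors with values in the localized category given by a
morphism of the localized functor category. -/
def locEval (E : MorphismProperty D) {F₁ F₂ : A ⥤ D}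
    (f : (E.functorCategory A).Q.obj F₁ ⟶ (E.functorCategory A).Q.obj F₂) :
    F₁ ⋙ E.Q ⟶ F₂ ⋙ E.Q :=
  (locEvalFac E A).inv.app F₁ ≫ (locEvalFunctor E A).map f ≫ (locEvalFac E A).hom.app F₂

lemma locEval_map (E : MorphismProperty D) {F₁ F₂ : A ⥤ D} (f : F₁ ⟶ F₂) :
    locEval E ((E.functorCategory A).Q.map f) = Functor.whiskerRight f E.Q := by
  have h := (locEvalFac E A).hom.naturality f
  dsimp only [locEval]
  exact (congrArg (_ ≫ ·) h).trans (Iso.inv_hom_id_app_assoc _ _ _)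

lemma locEval_comp (E : MorphismProperty D) {F₁ F₂ F₃ : A ⥤ D}
    (f : (E.functorCategory A).Q.obj F₁ ⟶ (E.functorCategory A).Q.obj F₂)
    (g : (E.functorCategory A).Q.obj F₂ ⟶ (E.functorCategory A).Q.obj F₃) :
    locEval E (f ≫ g) = locEval E f ≫ locEval E g := by
  simp [locEval]

lemma locEval_id (E : MorphismProperty D) (F : A ⥤ D) :
    locEval E (𝟙 ((E.functorCategory A).Q.obj F)) = 𝟙 _ := by
  simp [locEval]

lemma isIso_locEval_app (E : MorphismProperty D) {F₁ F₂ : A ⥤ D}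
    (f : (E.functorCategory A).Q.obj F₁ ⟶ (E.functorCategory A).Q.obj F₂) [IsIso f] (a : A) :
    IsIso ((locEval E f).app a) := by
  have : IsIso (locEval E f) := by
    dsimp only [locEval]
    infer_instance
  infer_instance

lemma locPrecomp_map (E : MorphismProperty D) (G : A ⥤ B) {F₁ F₂ : B ⥤ D} (f : F₁ ⟶ F₂) :
    locPrecomp E G ((E.functorCategory B).Q.map f) =
      (E.functorCategory A).Q.map (Functor.whiskerLeft G f) :=
  locMap_map (W := E.functorCategory B) (W' := E.functorCategory A) _ _ f

lemma locPrecomp_comp (E : MorphismProperty D) (G : A ⥤ B) {F₁ F₂ F₃ : B ⥤ D}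
    (f : (E.functorCategory B).Q.obj F₁ ⟶ (E.functorCategory B).Q.obj F₂)
    (g : (E.functorCategory B).Q.obj F₂ ⟶ (E.functorCategory B).Q.obj F₃) :
    locPrecomp E G (f ≫ g) = locPrecomp E G f ≫ locPrecomp E G g :=
  locMap_comp (W := E.functorCategory B) (W' := E.functorCategory A) _ _ f g

lemma locEval_locPrecomp (E : MorphismProperty D) (G : A ⥤ B) {F₁ F₂ : B ⥤ D}
    (f : (E.functorCategory B).Q.obj F₁ ⟶ (E.functorCategory B).Q.obj F₂) (a : A) :
    (locEval E (locPrecomp E G f)).app a = (locEval E f).app (G.obj a) := by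
  refine loc_induction (P := fun F₁ F₂ f => (locEval E (locPrecomp E G f)).app a =
    (locEval E f).app (G.obj a)) ?_ ?_ ?_ f
  · intro F₁ F₂ f
    rw [locPrecomp_map, locEval_map, locEval_map]
    rfl
  · intro F₁ F₂ w hw
    -- For a formal inverse, both sides are inverse to the image of the same component of `w`, so it
    -- suffices to compose with that component.
    have h₁ : (E.functorCategory B).Q.map w ≫ Localization.Construction.wInv w hw = 𝟙 _ :=
      (Localization.Construction.wIso w hw).hom_inv_id
    have h₂ := congrArg (fun t => (locEval E (locPrecomp E G t)).app a) h₁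
    have h₃ := congrArg (fun t => (locEval E t).app (G.obj a)) h₁
    have h₄ : IsIso (E.Q.map (w.app (G.obj a))) := Localization.inverts E.Q E _ (hw _)
    rw [locPrecomp_comp, locPrecomp_map, locEval_comp, locEval_map,
      ← (E.functorCategory B).Q.map_id, locPrecomp_map, locEval_map] at h₂
    rw [locEval_comp, locEval_map, locEval_id] at h₃
    refine (cancel_epi (E.Q.map (w.app (G.obj a)))).1 (h₂.trans (Eq.trans ?_ h₃.symm))
    exact E.Q.map_id _
  · intro F₁ F₂ F₃ f g hf hg
    rw [locPrecomp_comp, locEval_comp, locEval_comp, NatTrans.comp_app, NatTrans.comp_app, hf, hg]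

lemma isIso_iff_of_square {C : Type*} [Category* C] {X Y X' Y' : C} {f : X ⟶ Y} {f' : X' ⟶ Y'}
    {a : X ⟶ X'} {b : Y ⟶ Y'} (w : f ≫ b = a ≫ f') (ha : IsIso a) (hb : IsIso b) :
    IsIso f ↔ IsIso f' := by
  rw [← isIso_comp_right_iff f b, w, isIso_comp_left_iff]

end LocEval

namespace SimplicialDescentCategory

variable {D : Type u} [Category.{v} D] [HasFiniteCoproducts D] [HasTerminal D]
  (S : SimplicialDescentCategory D)

/-! ### Coproducts of simplicial objects -/

/-- The axioms speak of binary coproducts only; this supplies the empty one. An initial simplicial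
object is degreewise isomorphic to the constant one on `I`, and `λ_I` then gives an equivalence back
to `I` that `i` splits. -/
lemma initial_to_simple_mem {I : D} (hI : IsInitial I) {X : SimplicialObject D}
    (hX : IsInitial X) (i : I ⟶ S.s.obj X) : S.E i := by
  let e : X ⟶ (SimplicialObject.const D).obj I := hX.to _
  have he : ∀ n, IsIso (e.app n) := fun n => by
    let j : (SimplicialObject.const D).obj I ⟶ X :=
      { app m := hI.to _
        naturality _ _ _ := hI.hom_ext _ _ }
    refine ⟨j.app n, ?_, hI.hom_ext _ _⟩
    exact congrArg (fun t => t.app n) (hX.hom_ext (e ≫ j) (𝟙 X))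
  have h := S.comp_mem _ _ (S.simple_mem e fun n => S.mem_of_isIso _) (S.lam_mem I)
  exact S.of_comp_left h (by rw [hI.hom_ext (i ≫ _) (𝟙 I)]; exact S.id_mem I)

lemma sigmaComparison_mem_aux (J : Type) : ∀ (_ : Finite J) (X : J → SimplicialObject D),
    S.E (sigmaComparison S.s X) := by
  refine fun hJ => Finite.induction_empty_option (P := fun J => ∀ (_ : Finite J)
    (X : J → SimplicialObject D), S.E (sigmaComparison S.s X)) ?_ ?_ ?_ J hJ
  · intro α β e ih _ X
    have : Finite α := Finite.of_equiv β e.symm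
    have h := ih this (fun a => X (e a))
    have h' : sigmaComparison S.s X = (Sigma.reindex e (fun b => S.s.obj (X b))).inv ≫
        sigmaComparison S.s (fun a => X (e a)) ≫ S.s.map (Sigma.reindex e X).hom := by
      rw [Iso.eq_inv_comp]
      refine Sigma.hom_ext _ _ fun a => ?_
      have h₁ := Sigma.ι_reindex_hom e (fun b => S.s.obj (X b)) a
      have h₂ := Sigma.ι_reindex_hom e X a
      have h₃ := ι_comp_sigmaComparison S.s (fun a => X (e a)) a
      rw [← Category.assoc, h₁, ι_comp_sigmaComparison, ← Category.assoc]
      refine Eq.trans ?_ (congrArg (· ≫ S.s.map (Sigma.reindex e X).hom) h₃.symm)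
      rw [← h₂]
      exact S.s.map_comp _ _
    rw [h']
    exact S.comp_mem _ _ (S.mem_of_isIso _) (S.comp_mem _ _ h (S.mem_of_isIso _))
  · intro _ X
    refine S.initial_to_simple_mem (IsInitial.ofUniqueHom (fun T => Sigma.desc fun j => j.elim)
      fun T m => Sigma.hom_ext _ _ fun j => j.elim) (IsInitial.ofUniqueHom
      (fun T => Sigma.desc fun j => j.elim) fun T m => Sigma.hom_ext _ _ fun j => j.elim) _
  · intro α _ ih _ X
    have h := ih inferInstance (fun a => X (some a))
    have h' : sigmaComparison S.s X = (sigmaOptionIso (fun a => S.s.obj (X a))).hom ≫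
        coprod.map (𝟙 _) (sigmaComparison S.s (fun a => X (some a))) ≫
          coprodComparison S.s (X none) (∐ fun a => X (some a)) ≫
            S.s.map (sigmaOptionIso X).inv := by
      refine Sigma.hom_ext _ _ fun j => ?_
      rcases j with _ | a
      · simp [sigmaOptionIso, coprod.inl_desc, coprodComparison_inl_assoc, ← S.s.map_comp]
      · simp [sigmaOptionIso, coprod.inr_desc, coprodComparison_inr_assoc, ← S.s.map_comp]
    rw [h']
    exact S.comp_mem _ _ (S.mem_of_isIso _) (S.comp_mem _ _ (S.coprod_map_mem _ _ (S.id_mem _) h)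
      (S.comp_mem _ _ (S.coprodComparison_mem _ _) (S.mem_of_isIso _)))

/-- The simple functor preserves finite coproducts up to equivalence. -/
lemma sigma_desc_simple_mem {J : Type} [hJ : Finite J] {X : J → SimplicialObject D}
    {T : SimplicialObject D} (i : ∀ j, X j ⟶ T) (hT : IsColimit (Cofan.mk T i)) :
    S.E (Sigma.desc fun j => S.s.map (i j)) := by
  have h := S.sigmaComparison_mem_aux J hJ X
  have h' : IsIso (Sigma.desc i) := by
    have e : Sigma.desc i = ((colimit.isColimit _).coconePointUniqueUpToIso hT).hom :=
      Sigma.hom_ext _ _ fun j => (Sigma.ι_desc _ _).trans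
        ((colimit.isColimit (Discrete.functor X)).comp_coconePointUniqueUpToIso_hom hT ⟨j⟩).symm
    rw [e]
    infer_instance
  have h'' := S.comp_mem _ _ h (S.mem_of_isIso (S.s.map (Sigma.desc i)))
  rwa [sigmaComparison_map_desc] at h''

/-- The simple of the diagonal and the iterated simple detect the same equivalences. -/
lemma iterated_map_mem_iff {Z Z' : SimplicialObject (SimplicialObject D)} (φ : Z ⟶ Z') :
    S.E ((iterated S.s).map φ) ↔ S.E (S.s.map ((diagonal D).map φ)) := by
  rw [mem_iff_isIso, mem_iff_isIso]
  -- `μ` lives only in a localized functor category. Its evaluation is still a natural isomorphism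
  -- with values in the homotopy category, and by saturation this is enough to compare equivalences.
  exact (isIso_iff_of_square ((locEval S.E S.μ.hom).naturality φ)
    (isIso_locEval_app S.E S.μ.hom Z) (isIso_locEval_app S.E S.μ.hom Z')).symm

end SimplicialDescentCategory

/-! ### Double cylinders -/

section Double

variable {D : Type u} [Category.{v} D] [HasFiniteCoproducts D]

/-- The inclusion of a summand in a cylinder of a span of constant simplicial objects. -/
def constIn (F : WalkingSpan ⥤ D) (n : SimplexCategoryᵒᵖ) (σ : n.unop ⟶ ⦋1⦌) :
    F.obj (position σ) ⟶ (Cyl.obj (F ⋙ SimplicialObject.const D)).obj n :=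
  cylIn (F ⋙ SimplicialObject.const D) n σ

/-- The morphism out of a cylinder of a span of constant simplicial objects with given
components. -/
def constDesc {F : WalkingSpan ⥤ D} {n : SimplexCategoryᵒᵖ} {T : D}
    (t : ∀ σ : n.unop ⟶ ⦋1⦌, F.obj (position σ) ⟶ T) :
    (Cyl.obj (F ⋙ SimplicialObject.const D)).obj n ⟶ T :=
  cylDesc (F := F ⋙ SimplicialObject.const D) t

lemma constIn_constDesc {F : WalkingSpan ⥤ D} {n : SimplexCategoryᵒᵖ} {T : D}
    (t : ∀ σ : n.unop ⟶ ⦋1⦌, F.obj (position σ) ⟶ T) (σ : n.unop ⟶ ⦋1⦌) :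
    constIn F n σ ≫ constDesc t = t σ :=
  cylIn_cylDesc (F := F ⋙ SimplicialObject.const D) t σ

lemma const_hom_ext {F : WalkingSpan ⥤ D} {n : SimplexCategoryᵒᵖ} {T : D}
    {t t' : (Cyl.obj (F ⋙ SimplicialObject.const D)).obj n ⟶ T}
    (h : ∀ σ, constIn F n σ ≫ t = constIn F n σ ≫ t') : t = t' :=
  cyl_hom_ext h

lemma constIn_map (F : WalkingSpan ⥤ D) {n m : SimplexCategoryᵒᵖ} (θ : n ⟶ m)
    (σ : n.unop ⟶ ⦋1⦌) :
    constIn F n σ ≫ (Cyl.obj (F ⋙ SimplicialObject.const D)).map θ =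
      F.map (positionHom θ.unop σ) ≫ constIn F m (θ.unop ≫ σ) :=
  (cylIn_map (F ⋙ SimplicialObject.const D) θ σ).trans
    (congrArg (F.map (positionHom θ.unop σ) ≫ ·) (Category.id_comp _))

lemma constIn_app {F G : WalkingSpan ⥤ D} (α : F ⟶ G) (n : SimplexCategoryᵒᵖ)
    (σ : n.unop ⟶ ⦋1⦌) :
    constIn F n σ ≫ (Cyl.map (Functor.whiskerRight α (SimplicialObject.const D))).app n =
      α.app (position σ) ≫ constIn G n σ :=
  cylIn_app (Functor.whiskerRight α (SimplicialObject.const D)) n σ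

/-- The objects of the double cylinder of a span of spans. -/
def dblObj (M : WalkingSpan ⥤ WalkingSpan ⥤ D) (n m : SimplexCategoryᵒᵖ) : D :=
  ∐ fun p : (n.unop ⟶ ⦋1⦌) × (m.unop ⟶ ⦋1⦌) => (M.obj (position p.1)).obj (position p.2)

/-- The inclusion into a double cylinder of one of its summands. -/
def dblIn (M : WalkingSpan ⥤ WalkingSpan ⥤ D) (n m : SimplexCategoryᵒᵖ) (σ : n.unop ⟶ ⦋1⦌)
    (τ : m.unop ⟶ ⦋1⦌) : (M.obj (position σ)).obj (position τ) ⟶ dblObj M n m :=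
  Sigma.ι (fun p : (n.unop ⟶ ⦋1⦌) × (m.unop ⟶ ⦋1⦌) => (M.obj (position p.1)).obj (position p.2))
    (σ, τ)

/-- The morphism out of a double cylinder with given components. -/
def dblDesc {M : WalkingSpan ⥤ WalkingSpan ⥤ D} {n m : SimplexCategoryᵒᵖ} {T : D}
    (t : ∀ (σ : n.unop ⟶ ⦋1⦌) (τ : m.unop ⟶ ⦋1⦌), (M.obj (position σ)).obj (position τ) ⟶ T) :
    dblObj M n m ⟶ T :=
  Sigma.desc fun p => t p.1 p.2

lemma dblIn_dblDesc {M : WalkingSpan ⥤ WalkingSpan ⥤ D} {n m : SimplexCategoryᵒᵖ} {T : D}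
    (t : ∀ (σ : n.unop ⟶ ⦋1⦌) (τ : m.unop ⟶ ⦋1⦌), (M.obj (position σ)).obj (position τ) ⟶ T)
    (σ : n.unop ⟶ ⦋1⦌) (τ : m.unop ⟶ ⦋1⦌) : dblIn M n m σ τ ≫ dblDesc t = t σ τ :=
  Sigma.ι_desc _ _

lemma dbl_hom_ext {M : WalkingSpan ⥤ WalkingSpan ⥤ D} {n m : SimplexCategoryᵒᵖ} {T : D}
    {t t' : dblObj M n m ⟶ T} (h : ∀ σ τ, dblIn M n m σ τ ≫ t = dblIn M n m σ τ ≫ t') : t = t' :=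
  Sigma.hom_ext _ _ fun p => h p.1 p.2

/-- The simplicial operators of a double cylinder. -/
def dblOp (M : WalkingSpan ⥤ WalkingSpan ⥤ D) {n n' m m' : SimplexCategoryᵒᵖ} (θ : n ⟶ n')
    (η : m ⟶ m') : dblObj M n m ⟶ dblObj M n' m' :=
  dblDesc fun σ τ => (M.map (positionHom θ.unop σ)).app _ ≫
    (M.obj _).map (positionHom η.unop τ) ≫ dblIn M n' m' (θ.unop ≫ σ) (η.unop ≫ τ)

lemma dblIn_dblOp (M : WalkingSpan ⥤ WalkingSpan ⥤ D) {n n' m m' : SimplexCategoryᵒᵖ}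
    (θ : n ⟶ n') (η : m ⟶ m') {σ : n.unop ⟶ ⦋1⦌} {τ : m.unop ⟶ ⦋1⦌} {σ' : n'.unop ⟶ ⦋1⦌}
    {τ' : m'.unop ⟶ ⦋1⦌} (hσ : θ.unop ≫ σ = σ') (hτ : η.unop ≫ τ = τ')
    (a : position σ ⟶ position σ') (b : position τ ⟶ position τ') :
    dblIn M n m σ τ ≫ dblOp M θ η = (M.map a).app _ ≫ (M.obj _).map b ≫ dblIn M n' m' σ' τ' := by
  subst hσ hτ
  obtain rfl : a = positionHom θ.unop σ := Subsingleton.elim _ _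
  obtain rfl : b = positionHom η.unop τ := Subsingleton.elim _ _
  exact dblIn_dblDesc _ _ _

lemma dblOp_id (M : WalkingSpan ⥤ WalkingSpan ⥤ D) (n m : SimplexCategoryᵒᵖ) :
    dblOp M (𝟙 n) (𝟙 m) = 𝟙 _ :=
  dbl_hom_ext fun σ τ => by
    rw [dblIn_dblOp M (𝟙 n) (𝟙 m) (Category.id_comp σ) (Category.id_comp τ) (𝟙 _) (𝟙 _)]
    simp

lemma dblOp_comp (M : WalkingSpan ⥤ WalkingSpan ⥤ D) {n n' n'' m m' m'' : SimplexCategoryᵒᵖ}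
    (θ : n ⟶ n') (η : m ⟶ m') (θ' : n' ⟶ n'') (η' : m' ⟶ m'') :
    dblOp M θ η ≫ dblOp M θ' η' = dblOp M (θ ≫ θ') (η ≫ η') :=
  dbl_hom_ext fun σ τ => by
    rw [reassoc_of% (dblIn_dblOp M θ η rfl rfl (positionHom θ.unop σ) (positionHom η.unop τ)),
      dblIn_dblOp M θ' η' rfl rfl (positionHom _ _) (positionHom _ _),
      dblIn_dblOp M (θ ≫ θ') (η ≫ η') (by simp) (by simp)
        (positionHom θ.unop σ ≫ positionHom θ'.unop _)
        (positionHom η.unop τ ≫ positionHom η'.unop _)]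
    simp

/-- The bisimplicial object given by the cylinders of a span of spans in both directions. -/
def double (M : WalkingSpan ⥤ WalkingSpan ⥤ D) : SimplicialObject (SimplicialObject D) where
  obj n :=
    { obj m := dblObj M n m
      map η := dblOp M (𝟙 n) η
      map_id m := dblOp_id M n m
      map_comp η η' := by rw [dblOp_comp, Category.comp_id] }
  map θ :=
    { app m := dblOp M θ (𝟙 m)
      naturality m m' η := by
        rw [dblOp_comp, dblOp_comp]
        simp }
  map_id n := by
    ext m
    exact dblOp_id M n m
  map_comp θ θ' := by
    refine NatTrans.ext (funext fun m => ?_)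
    exact ((dblOp_comp M θ (𝟙 m) θ' (𝟙 m)).trans
      (congrArg (dblOp M (θ ≫ θ')) (Category.comp_id _))).symm

/-- The functoriality of double cylinders, on objects. -/
def dblMap {M N : WalkingSpan ⥤ WalkingSpan ⥤ D} (φ : M ⟶ N) (n m : SimplexCategoryᵒᵖ) :
    dblObj M n m ⟶ dblObj N n m :=
  dblDesc fun σ τ => (φ.app (position σ)).app (position τ) ≫ dblIn N n m σ τ

lemma dblIn_dblMap {M N : WalkingSpan ⥤ WalkingSpan ⥤ D} (φ : M ⟶ N) (n m : SimplexCategoryᵒᵖ)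
    (σ : n.unop ⟶ ⦋1⦌) (τ : m.unop ⟶ ⦋1⦌) : dblIn M n m σ τ ≫ dblMap φ n m =
      (φ.app (position σ)).app (position τ) ≫ dblIn N n m σ τ :=
  dblIn_dblDesc _ _ _

lemma dblMap_dblOp {M N : WalkingSpan ⥤ WalkingSpan ⥤ D} (φ : M ⟶ N)
    {n n' m m' : SimplexCategoryᵒᵖ} (θ : n ⟶ n') (η : m ⟶ m') :
    dblMap φ n m ≫ dblOp N θ η = dblOp M θ η ≫ dblMap φ n' m' :=
  dbl_hom_ext fun σ τ => by
    have h₁ := congrArg (fun t => t.app (position τ)) (φ.naturality (positionHom θ.unop σ))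
    have h₂ := (φ.app (position (θ.unop ≫ σ))).naturality (positionHom η.unop τ)
    dsimp at h₁ h₂
    rw [reassoc_of% (dblIn_dblMap φ n m), dblIn_dblOp N θ η rfl rfl (positionHom _ _)
      (positionHom _ _), reassoc_of% (dblIn_dblOp M θ η rfl rfl (positionHom θ.unop σ)
      (positionHom η.unop τ)), dblIn_dblMap, ← reassoc_of% h₁, ← reassoc_of% h₂]

/-- The functoriality of double cylinders. -/
def doubleMap {M N : WalkingSpan ⥤ WalkingSpan ⥤ D} (φ : M ⟶ N) : double M ⟶ double N where
  app n :=
    { app m := dblMap φ n m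
      naturality m m' η := (dblMap_dblOp φ (𝟙 n) η).symm }
  naturality n n' θ := by
    ext m
    exact (dblMap_dblOp φ θ (𝟙 m)).symm

/-- The exchange of the two directions of a double cylinder, on objects. -/
def dblSwapObj (M : WalkingSpan ⥤ WalkingSpan ⥤ D) (n m : SimplexCategoryᵒᵖ) :
    dblObj M n m ⟶ dblObj M.flip m n :=
  dblDesc fun σ τ => dblIn M.flip m n τ σ

lemma dblIn_dblSwapObj (M : WalkingSpan ⥤ WalkingSpan ⥤ D) (n m : SimplexCategoryᵒᵖ)
    (σ : n.unop ⟶ ⦋1⦌) (τ : m.unop ⟶ ⦋1⦌) :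
    dblIn M n m σ τ ≫ dblSwapObj M n m = dblIn M.flip m n τ σ :=
  dblIn_dblDesc _ _ _

lemma dblOp_dblSwapObj (M : WalkingSpan ⥤ WalkingSpan ⥤ D) {n n' m m' : SimplexCategoryᵒᵖ}
    (θ : n ⟶ n') (η : m ⟶ m') :
    dblOp M θ η ≫ dblSwapObj M n' m' = dblSwapObj M n m ≫ dblOp M.flip η θ :=
  dbl_hom_ext fun σ τ => by
    rw [reassoc_of% (dblIn_dblOp M θ η rfl rfl (positionHom θ.unop σ) (positionHom η.unop τ)),
      dblIn_dblSwapObj, reassoc_of% (dblIn_dblSwapObj M n m), dblIn_dblOp M.flip η θ rfl rfl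
      (positionHom _ _) (positionHom _ _)]
    simp

/-- The exchange of the two directions of a double cylinder, on diagonals. -/
def dblSwap (M : WalkingSpan ⥤ WalkingSpan ⥤ D) :
    (diagonal D).obj (double M) ⟶ (diagonal D).obj (double M.flip) where
  app n := dblSwapObj M n n
  naturality n m θ := by
    change (dblOp M θ (𝟙 n) ≫ dblOp M (𝟙 m) θ) ≫ dblSwapObj M m m =
      dblSwapObj M n n ≫ dblOp M.flip θ (𝟙 n) ≫ dblOp M.flip (𝟙 m) θ
    rw [dblOp_comp, dblOp_comp, dblOp_dblSwapObj]
    simp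

lemma dblSwap_flip (M : WalkingSpan ⥤ WalkingSpan ⥤ D) : dblSwap M ≫ dblSwap M.flip = 𝟙 _ := by
  refine NatTrans.ext (funext fun n => ?_)
  change dblSwapObj M n n ≫ dblSwapObj M.flip n n = 𝟙 (dblObj M n n)
  refine dbl_hom_ext fun σ τ => ?_
  rw [reassoc_of% (dblIn_dblSwapObj M n n), dblIn_dblSwapObj]
  exact (Category.comp_id _).symm

instance (M : WalkingSpan ⥤ WalkingSpan ⥤ D) : IsIso (dblSwap M) :=
  ⟨dblSwap M.flip, dblSwap_flip M, dblSwap_flip M.flip⟩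

/-- The natural transformation between flipped functors. -/
def flipMap {M N : WalkingSpan ⥤ WalkingSpan ⥤ D} (φ : M ⟶ N) : M.flip ⟶ N.flip :=
  (flipFunctor WalkingSpan WalkingSpan D).map φ

lemma dblSwap_naturality {M N : WalkingSpan ⥤ WalkingSpan ⥤ D} (φ : M ⟶ N) :
    (diagonal D).map (doubleMap φ) ≫ dblSwap N =
      dblSwap M ≫ (diagonal D).map (doubleMap (flipMap φ)) := by
  refine NatTrans.ext (funext fun n => ?_)
  change dblMap φ n n ≫ dblSwapObj N n n = dblSwapObj M n n ≫ dblMap (flipMap φ) n n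
  refine dbl_hom_ext fun σ τ => ?_
  rw [reassoc_of% (dblIn_dblMap φ n n), dblIn_dblSwapObj, reassoc_of% (dblIn_dblSwapObj M n n),
    dblIn_dblMap]
  rfl

/-- The inclusion of the cylinder of one of the spans in a double cylinder, on objects. -/
def cylToDblObj (M : WalkingSpan ⥤ WalkingSpan ⥤ D) (n m : SimplexCategoryᵒᵖ)
    (σ : n.unop ⟶ ⦋1⦌) :
    (Cyl.obj (M.obj (position σ) ⋙ SimplicialObject.const D)).obj m ⟶ dblObj M n m :=
  constDesc fun τ => dblIn M n m σ τ

lemma constIn_cylToDblObj (M : WalkingSpan ⥤ WalkingSpan ⥤ D) (n m : SimplexCategoryᵒᵖ)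
    (σ : n.unop ⟶ ⦋1⦌) (τ : m.unop ⟶ ⦋1⦌) :
    constIn (M.obj (position σ)) m τ ≫ cylToDblObj M n m σ = dblIn M n m σ τ :=
  constIn_constDesc _ _

lemma cylToDblObj_dblOp (M : WalkingSpan ⥤ WalkingSpan ⥤ D) {n n' m : SimplexCategoryᵒᵖ}
    (θ : n ⟶ n') (σ : n.unop ⟶ ⦋1⦌) :
    (Cyl.map (Functor.whiskerRight (M.map (positionHom θ.unop σ))
        (SimplicialObject.const D))).app m ≫ cylToDblObj M n' m (θ.unop ≫ σ) =
      cylToDblObj M n m σ ≫ dblOp M θ (𝟙 m) :=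
  const_hom_ext fun τ => by
    rw [reassoc_of% (constIn_app (M.map (positionHom θ.unop σ)) m τ), constIn_cylToDblObj,
      reassoc_of% (constIn_cylToDblObj M n m σ τ),
      dblIn_dblOp M θ (𝟙 m) rfl (Category.id_comp τ) (positionHom θ.unop σ) (𝟙 _)]
    simp

lemma cylToDblObj_dblMap {M N : WalkingSpan ⥤ WalkingSpan ⥤ D} (φ : M ⟶ N)
    (n m : SimplexCategoryᵒᵖ) (σ : n.unop ⟶ ⦋1⦌) :
    (Cyl.map (Functor.whiskerRight (φ.app (position σ))
        (SimplicialObject.const D))).app m ≫ cylToDblObj N n m σ =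
      cylToDblObj M n m σ ≫ dblMap φ n m :=
  const_hom_ext fun τ => by
    rw [reassoc_of% (constIn_app (φ.app (position σ)) m τ), constIn_cylToDblObj,
      reassoc_of% (constIn_cylToDblObj M n m σ τ), dblIn_dblMap]

lemma map_cylToDblObj (M : WalkingSpan ⥤ WalkingSpan ⥤ D) (n : SimplexCategoryᵒᵖ)
    {m m' : SimplexCategoryᵒᵖ} (η : m ⟶ m') (σ : n.unop ⟶ ⦋1⦌) :
    (Cyl.obj (M.obj (position σ) ⋙ SimplicialObject.const D)).map η ≫ cylToDblObj M n m' σ =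
      cylToDblObj M n m σ ≫ dblOp M (𝟙 n) η :=
  const_hom_ext fun τ => by
    rw [reassoc_of% (constIn_map (M.obj (position σ)) η τ), constIn_cylToDblObj,
      reassoc_of% (constIn_cylToDblObj M n m σ τ),
      dblIn_dblOp M (𝟙 n) η (Category.id_comp σ) rfl (𝟙 _) (positionHom η.unop τ)]
    simp

/-- The inclusion of the cylinder of one of the spans in a double cylinder. -/
def cylToDouble (M : WalkingSpan ⥤ WalkingSpan ⥤ D) (n : SimplexCategoryᵒᵖ)
    (σ : n.unop ⟶ ⦋1⦌) :
    Cyl.obj (M.obj (position σ) ⋙ SimplicialObject.const D) ⟶ (double M).obj n where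
  app m := cylToDblObj M n m σ
  naturality _ _ η := map_cylToDblObj M n η σ

/-- A double cylinder is in each degree a coproduct of cylinders. -/
def isColimitCylToDouble (M : WalkingSpan ⥤ WalkingSpan ⥤ D) (n : SimplexCategoryᵒᵖ) :
    IsColimit (Cofan.mk ((double M).obj n) (cylToDouble M n)) :=
  Cofan.IsColimit.mk _
    (fun c =>
      { app m := dblDesc fun σ τ => constIn (M.obj (position σ)) m τ ≫ (c.inj σ).app m
        naturality m m' η := by
          refine dbl_hom_ext fun σ τ => ?_
          have h := dblIn_dblOp M (𝟙 n) η (Category.id_comp σ) rfl (𝟙 _) (positionHom η.unop τ)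
          have h₃ := (c.inj σ).naturality η
          change dblIn M n m σ τ ≫ dblOp M (𝟙 n) η ≫ dblDesc _ =
            dblIn M n m σ τ ≫ dblDesc _ ≫ c.pt.map η
          rw [reassoc_of% h, dblIn_dblDesc, reassoc_of% (dblIn_dblDesc (M := M)), Category.assoc,
            ← h₃, reassoc_of% (constIn_map (M.obj (position σ)) η τ)]
          simp })
    (fun c σ => by
      refine NatTrans.ext (funext fun m => const_hom_ext fun τ => ?_)
      let d : dblObj M n m ⟶ c.pt.obj m :=
        dblDesc fun σ τ => constIn (M.obj (position σ)) m τ ≫ (c.inj σ).app m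
      change constIn _ m τ ≫ cylToDblObj M n m σ ≫ d = _
      rw [reassoc_of% (constIn_cylToDblObj M n m σ τ)]
      exact dblIn_dblDesc _ σ τ)
    (fun c t ht => by
      refine NatTrans.ext (funext fun m => dbl_hom_ext fun σ τ => ?_)
      have h := constIn_cylToDblObj M n m σ τ
      rw [dblIn_dblDesc, ← ht σ]
      exact (congrArg (· ≫ t.app m) h).symm.trans (Category.assoc _ _ _))

end Double

namespace SimplicialDescentCategory

variable {D : Type u} [Category.{v} D] [HasFiniteCoproducts D] [HasTerminal D]
  (S : SimplicialDescentCategory D)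

/-- The comparison of iterated cylinders with double cylinders, on objects. -/
def iteratedCylObj (M : WalkingSpan ⥤ WalkingSpan ⥤ D) (n : SimplexCategoryᵒᵖ) :
    (Cyl.obj ((M ⋙ cyl S.s) ⋙ SimplicialObject.const D)).obj n ⟶ S.s.obj ((double M).obj n) :=
  constDesc (F := M ⋙ cyl S.s) fun σ => S.s.map (cylToDouble M n σ)

lemma constIn_iteratedCylObj (M : WalkingSpan ⥤ WalkingSpan ⥤ D) (n : SimplexCategoryᵒᵖ)
    (σ : n.unop ⟶ ⦋1⦌) :
    constIn (M ⋙ cyl S.s) n σ ≫ S.iteratedCylObj M n = S.s.map (cylToDouble M n σ) :=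
  constIn_constDesc (F := M ⋙ cyl S.s) _ σ

lemma map_iteratedCylObj (M : WalkingSpan ⥤ WalkingSpan ⥤ D) {n n' : SimplexCategoryᵒᵖ}
    (θ : n ⟶ n') :
    (Cyl.obj ((M ⋙ cyl S.s) ⋙ SimplicialObject.const D)).map θ ≫ S.iteratedCylObj M n' =
      S.iteratedCylObj M n ≫ S.s.map ((double M).map θ) := by
  refine const_hom_ext fun σ => ?_
  have h : Cyl.map (Functor.whiskerRight (M.map (positionHom θ.unop σ))
      (SimplicialObject.const D)) ≫ cylToDouble M n' (θ.unop ≫ σ) =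
      cylToDouble M n σ ≫ (double M).map θ :=
    NatTrans.ext (funext fun m => cylToDblObj_dblOp M θ σ)
  have h' := congrArg S.s.map h
  rw [Functor.map_comp, Functor.map_comp] at h'
  rw [reassoc_of% (constIn_map (M ⋙ cyl S.s) θ σ), constIn_iteratedCylObj,
    reassoc_of% (S.constIn_iteratedCylObj M n σ)]
  exact h'

/-- The comparison of iterated cylinders with double cylinders. -/
def iteratedCyl (M : WalkingSpan ⥤ WalkingSpan ⥤ D) :
    Cyl.obj ((M ⋙ cyl S.s) ⋙ SimplicialObject.const D) ⟶ (degreewise S.s).obj (double M) where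
  app n := S.iteratedCylObj M n
  naturality _ _ θ := S.map_iteratedCylObj M θ

lemma iteratedCyl_naturality {M N : WalkingSpan ⥤ WalkingSpan ⥤ D} (φ : M ⟶ N) :
    Cyl.map (Functor.whiskerRight (Functor.whiskerRight φ (cyl S.s)) (SimplicialObject.const D)) ≫
      S.iteratedCyl N = S.iteratedCyl M ≫ (degreewise S.s).map (doubleMap φ) := by
  refine NatTrans.ext (funext fun n => const_hom_ext fun σ => ?_)
  have h : Cyl.map (Functor.whiskerRight (φ.app (position σ)) (SimplicialObject.const D)) ≫
      cylToDouble N n σ = cylToDouble M n σ ≫ (doubleMap φ).app n :=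
    NatTrans.ext (funext fun m => cylToDblObj_dblMap φ n m σ)
  have h' := congrArg S.s.map h
  rw [Functor.map_comp, Functor.map_comp] at h'
  rw [NatTrans.comp_app, NatTrans.comp_app,
    reassoc_of% (constIn_app (Functor.whiskerRight φ (cyl S.s)) n σ)]
  refine (congrArg (_ ≫ ·) (S.constIn_iteratedCylObj N n σ)).trans (h'.trans ?_)
  exact (congrArg (· ≫ S.s.map ((doubleMap φ).app n))
    (S.constIn_iteratedCylObj M n σ)).symm.trans (Category.assoc _ _ _)

/-- In degree `n` the double cylinder is a finite coproduct of cylinders, and `s` preserves finite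
coproducts up to equivalence. The comparison is therefore a degreewise equivalence, to which `s` is
applied once more. -/
lemma simple_iteratedCyl_mem (M : WalkingSpan ⥤ WalkingSpan ⥤ D) :
    S.E (S.s.map (S.iteratedCyl M)) :=
  S.simple_mem _ fun n => S.sigma_desc_simple_mem (cylToDouble M n) (isColimitCylToDouble M n)

/-- This passes from iterated homotopy pushouts, where the two directions play different roles, to a
diagonal where they are interchangeable. -/
lemma cyl_cyl_map_mem_iff_double {M N : WalkingSpan ⥤ WalkingSpan ⥤ D} (φ : M ⟶ N) :
    S.E ((cyl S.s).map (Functor.whiskerRight φ (cyl S.s))) ↔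
      S.E (S.s.map ((diagonal D).map (doubleMap φ))) := by
  rw [← iterated_map_mem_iff]
  refine S.mem_iff_of_square (S.simple_iteratedCyl_mem M) (S.simple_iteratedCyl_mem N) ?_
  have h := congrArg S.s.map (S.iteratedCyl_naturality φ)
  rw [Functor.map_comp, Functor.map_comp] at h
  exact h

/-- Homotopy pushouts commute with homotopy pushouts. -/
lemma cyl_cyl_map_mem_iff {M N : WalkingSpan ⥤ WalkingSpan ⥤ D} (φ : M ⟶ N) :
    S.E ((cyl S.s).map (Functor.whiskerRight φ (cyl S.s))) ↔
      S.E ((cyl S.s).map (Functor.whiskerRight (flipMap φ) (cyl S.s))) := by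
  rw [cyl_cyl_map_mem_iff_double, cyl_cyl_map_mem_iff_double]
  -- The exchange isomorphism exists on diagonals; the double cylinders themselves have their two
  -- simplicial directions interchanged.
  have h := congrArg S.s.map (dblSwap_naturality φ)
  rw [Functor.map_comp, Functor.map_comp] at h
  exact S.mem_iff_of_square (S.mem_of_isIso _) (S.mem_of_isIso _) h

end SimplicialDescentCategory

/-! ### The inclusions of the ends of a cylinder, and the reversal of cylinders -/

section Reversal

variable {D : Type u} [Category.{v} D] [HasFiniteCoproducts D]

lemma const_hom_ext' {F : WalkingSpan ⥤ D} {n : SimplexCategoryᵒᵖ} {T : D}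
    {t t' : (Cyl.obj (F ⋙ SimplicialObject.const D)).obj n ⟶ T}
    (hl : (Cyl.inl (F ⋙ SimplicialObject.const D)).app n ≫ t =
      (Cyl.inl (F ⋙ SimplicialObject.const D)).app n ≫ t')
    (hr : (Cyl.inr (F ⋙ SimplicialObject.const D)).app n ≫ t =
      (Cyl.inr (F ⋙ SimplicialObject.const D)).app n ≫ t')
    (hz : ∀ σ, position σ = WalkingSpan.zero → constIn F n σ ≫ t = constIn F n σ ≫ t') :
    t = t' := by
  refine const_hom_ext fun σ => ?_
  have hσ : position σ = WalkingSpan.zero ∨ position σ = WalkingSpan.left ∨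
      position σ = WalkingSpan.right := by
    rcases position σ with _ | _ | _ <;> simp
  rcases hσ with h | h | h
  · exact hz σ h
  · obtain rfl := position_eq_left h
    rw [Cyl.inl_app, Category.assoc, Category.assoc] at hl
    exact (cancel_epi _).1 hl
  · obtain rfl := position_eq_right h
    rw [Cyl.inr_app, Category.assoc, Category.assoc] at hr
    exact (cancel_epi _).1 hr

lemma map_constIn_of_eq (F : WalkingSpan ⥤ D) {n : SimplexCategoryᵒᵖ} {σ σ' : n.unop ⟶ ⦋1⦌}
    (h : σ = σ') (a : position σ ⟶ position σ') : F.map a ≫ constIn F n σ' = constIn F n σ := by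
  subst h
  obtain rfl : a = 𝟙 _ := Subsingleton.elim _ _
  simp

/-- The exchange of the legs of a span. -/
abbrev swapSpan : WalkingSpan ⥤ WalkingSpan :=
  span WalkingSpan.Hom.snd WalkingSpan.Hom.fst

/-- The simplex of `Δ[1]` obtained by reversing the order. -/
abbrev revSimplex {n : SimplexCategory} (σ : n ⟶ ⦋1⦌) : n ⟶ ⦋1⦌ :=
  SimplexCategory.rev.map σ

lemma revSimplex_revSimplex {n : SimplexCategory} (σ : n ⟶ ⦋1⦌) :
    revSimplex (revSimplex σ) = σ :=
  SimplexCategory.rev_map_rev_map σ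

lemma revSimplex_const (n : SimplexCategory) (i : Fin 2) :
    revSimplex (SimplexCategory.const n ⦋1⦌ i) = SimplexCategory.const n ⦋1⦌ i.rev := by
  ext x : 3
  rfl

lemma position_revSimplex {n : SimplexCategory} (σ : n ⟶ ⦋1⦌) :
    position (revSimplex σ) = swapSpan.obj (position σ) := by
  rcases h : position σ with _ | _ | _
  · rcases h' : position (revSimplex σ) with _ | _ | _
    · rfl
    · have h₂ := congrArg revSimplex (position_eq_left h')
      rw [revSimplex_revSimplex, revSimplex_const] at h₂
      subst h₂
      exact absurd ((position_const_zero n).symm.trans h) (by simp)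
    · have h₂ := congrArg revSimplex (position_eq_right h')
      rw [revSimplex_revSimplex, revSimplex_const] at h₂
      subst h₂
      exact absurd ((position_const_one n).symm.trans h) (by simp)
  · obtain rfl := position_eq_left h
    rw [revSimplex_const]
    exact position_const_zero n
  · obtain rfl := position_eq_right h
    rw [revSimplex_const]
    exact position_const_one n

/-- The reversal of a cylinder, on objects. -/
def cylRevObj (F : WalkingSpan ⥤ D) (n : SimplexCategoryᵒᵖ) :
    (Cyl.obj ((swapSpan ⋙ F) ⋙ SimplicialObject.const D)).obj n ⟶
      (Cyl.obj (F ⋙ SimplicialObject.const D)).obj n :=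
  constDesc (F := swapSpan ⋙ F) fun σ =>
    F.map (eqToHom (position_revSimplex σ).symm) ≫ constIn F n (revSimplex σ)

lemma constIn_cylRevObj (F : WalkingSpan ⥤ D) (n : SimplexCategoryᵒᵖ) (σ : n.unop ⟶ ⦋1⦌) :
    constIn (swapSpan ⋙ F) n σ ≫ cylRevObj F n =
      F.map (eqToHom (position_revSimplex σ).symm) ≫ constIn F n (revSimplex σ) :=
  constIn_constDesc (F := swapSpan ⋙ F) _ σ

instance (F : WalkingSpan ⥤ D) (n : SimplexCategoryᵒᵖ) : IsIso (cylRevObj F n) := by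
  have e : ∀ τ : n.unop ⟶ ⦋1⦌, position τ = swapSpan.obj (position (revSimplex τ)) := fun τ => by
    rw [← position_revSimplex, revSimplex_revSimplex]
  let k : (Cyl.obj (F ⋙ SimplicialObject.const D)).obj n ⟶
      (Cyl.obj ((swapSpan ⋙ F) ⋙ SimplicialObject.const D)).obj n :=
    constDesc (F := F) fun τ => F.map (eqToHom (e τ)) ≫ constIn (swapSpan ⋙ F) n (revSimplex τ)
  have hk : ∀ τ, constIn F n τ ≫ k =
      F.map (eqToHom (e τ)) ≫ constIn (swapSpan ⋙ F) n (revSimplex τ) :=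
    fun τ => constIn_constDesc (F := F) _ τ
  refine ⟨k, const_hom_ext fun σ => ?_, const_hom_ext fun τ => ?_⟩
  · rw [reassoc_of% (constIn_cylRevObj F n σ), hk, Category.comp_id, ← F.map_comp_assoc,
      ← map_constIn_of_eq (swapSpan ⋙ F) (revSimplex_revSimplex σ).symm
        (eqToHom (by rw [revSimplex_revSimplex]))]
    refine congrArg (· ≫ constIn (swapSpan ⋙ F) n (revSimplex (revSimplex σ))) ?_
    exact congrArg F.map (Subsingleton.elim _ _)
  · rw [reassoc_of% (hk τ), constIn_cylRevObj, Category.comp_id, ← F.map_comp_assoc,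
      map_constIn_of_eq F (revSimplex_revSimplex τ).symm]

/-- The reversal of a cylinder is the cylinder of the span with its legs exchanged. -/
def cylRev (F : WalkingSpan ⥤ D) :
    Cyl.obj ((swapSpan ⋙ F) ⋙ SimplicialObject.const D) ⟶
      SimplicialObject.opFunctor.obj (Cyl.obj (F ⋙ SimplicialObject.const D)) where
  app n := cylRevObj F n
  naturality n m θ := by
    change (Cyl.obj ((swapSpan ⋙ F) ⋙ SimplicialObject.const D)).map θ ≫ cylRevObj F m =
      cylRevObj F n ≫ (Cyl.obj (F ⋙ SimplicialObject.const D)).map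
        (SimplexCategory.rev.map θ.unop).op
    refine const_hom_ext fun σ => ?_
    have h : revSimplex (θ.unop ≫ σ) = (SimplexCategory.rev.map θ.unop).op.unop ≫ revSimplex σ :=
      SimplexCategory.rev.map_comp θ.unop σ
    rw [reassoc_of% (constIn_map (swapSpan ⋙ F) θ σ), constIn_cylRevObj,
      reassoc_of% (constIn_cylRevObj F n σ),
      constIn_map F (n := n) (m := m) (SimplexCategory.rev.map θ.unop).op (revSimplex σ),
      ← F.map_comp_assoc, ← F.map_comp_assoc,
      ← map_constIn_of_eq F h (eqToHom (congrArg position h)),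
      ← F.map_comp_assoc]
    exact congrArg (fun a => F.map a ≫ constIn F m _) (Subsingleton.elim _ _)

end Reversal

namespace SimplicialDescentCategory

variable {D : Type u} [Category.{v} D] [HasFiniteCoproducts D] [HasTerminal D]
  (S : SimplicialDescentCategory D)

/-! ### Homotopy pushouts of homotopy pushouts -/

/-- A morphism of spans of spans induces an equivalence on iterated homotopy pushouts if it does so
on the homotopy pushouts in the other direction. -/
lemma cyMap_cyl_map_mem {F₀ F₁ F₂ G₀ G₁ G₂ : WalkingSpan ⥤ D} {α : F₀ ⟶ F₁} {β : F₀ ⟶ F₂}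
    {α' : G₀ ⟶ G₁} {β' : G₀ ⟶ G₂} (φ₀ : F₀ ⟶ G₀) (φ₁ : F₁ ⟶ G₁) (φ₂ : F₂ ⟶ G₂)
    (h₁ : α ≫ φ₁ = φ₀ ≫ α') (h₂ : β ≫ φ₂ = φ₀ ≫ β')
    {k₁ : (cyl S.s).map α ≫ (cyl S.s).map φ₁ = (cyl S.s).map φ₀ ≫ (cyl S.s).map α'}
    {k₂ : (cyl S.s).map β ≫ (cyl S.s).map φ₂ = (cyl S.s).map φ₀ ≫ (cyl S.s).map β'}
    (h : ∀ t, S.E (S.cyMap (f := α.app t) (g := β.app t) (f' := α'.app t) (g' := β'.app t)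
      (φ₀.app t) (φ₁.app t) (φ₂.app t) (congrArg (fun a => a.app t) h₁)
      (congrArg (fun a => a.app t) h₂))) :
    S.E (S.cyMap ((cyl S.s).map φ₀) ((cyl S.s).map φ₁) ((cyl S.s).map φ₂) k₁ k₂) := by
  -- The data form a morphism of spans of spans. After flipping, the hypothesis `h` says that the
  -- homotopy pushouts taken first in the other direction are equivalent at each of the three
  -- positions.
  let φ : span α β ⟶ span α' β' := spanHomMk φ₀ φ₁ φ₂ h₁ h₂
  have h' := (S.cyl_map_mem_iff (Functor.whiskerRight φ (cyl S.s))).1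
    ((S.cyl_cyl_map_mem_iff φ).2 (S.cyl_map_mem _ fun t =>
      (S.cyl_map_mem_iff ((flipMap φ).app t)).2 (h t)))
  exact h'

/-- The morphism from a coproduct to a homotopy pushout over an initial object. -/
lemma cyDesc_coprod_mem {I P P' : D} (hI : IsInitial I) (a : I ⟶ P) (b : I ⟶ P') :
    S.E (S.cyDesc (f := a) (g := b) (coprod.inl : P ⟶ P ⨿ P') coprod.inr (hI.hom_ext _ _)) := by
  refine S.comp_mem _ _ (S.simple_mem _ fun n => ?_) (S.lam_mem _)
  have hl := congrArg (fun t => t.app n)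
    (Cyl.inl_cylToCocone (spanCocone (f := a) (g := b) (coprod.inl : P ⟶ P ⨿ P') coprod.inr
      (hI.hom_ext _ _)))
  have hr := congrArg (fun t => t.app n)
    (Cyl.inr_cylToCocone (spanCocone (f := a) (g := b) (coprod.inl : P ⟶ P ⨿ P') coprod.inr
      (hI.hom_ext _ _)))
  dsimp only [NatTrans.comp_app] at hl hr
  set c := (cylToCocone (spanCocone (f := a) (g := b) (coprod.inl : P ⟶ P ⨿ P') coprod.inr
    (hI.hom_ext _ _))).app n
  let k : P ⨿ P' ⟶ (Cyl.obj (span a b ⋙ SimplicialObject.const D)).obj n :=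
    coprod.desc ((Cyl.inl (span a b ⋙ SimplicialObject.const D)).app n)
      ((Cyl.inr (span a b ⋙ SimplicialObject.const D)).app n)
  -- All summands in the middle are initial objects, so in every degree the cylinder is just the
  -- coproduct of its two ends.
  have : IsIso c := by
    refine ⟨k, const_hom_ext' ?_ ?_ ?_, coprod.hom_ext ?_ ?_⟩
    · rw [reassoc_of% hl]
      exact (coprod.inl_desc _ _).trans (Category.comp_id _).symm
    · rw [reassoc_of% hr]
      exact (coprod.inr_desc _ _).trans (Category.comp_id _).symm
    · intro σ hσ
      have hI' : IsInitial ((span a b).obj (position σ)) := by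
        rw [hσ]
        exact hI
      exact hI'.hom_ext _ _
    · exact (coprod.inl_desc_assoc _ _ _).trans (hl.trans (Category.comp_id _).symm)
    · exact (coprod.inr_desc_assoc _ _ _).trans (hr.trans (Category.comp_id _).symm)
  exact S.mem_of_isIso c

variable {X Y Z X' Y' Z' B B' P P' : D}

lemma of_terminal {f : X ⟶ Y} (hX : S.E (terminal.from X)) (hY : S.E (terminal.from Y)) : S.E f :=
  S.of_comp_left hY (by rwa [terminal.comp_from])

lemma terminal_mem_iff {f : X ⟶ Y} (hf : S.E f) :
    S.E (terminal.from X) ↔ S.E (terminal.from Y) :=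
  S.mem_iff_of_square hf (S.id_mem _) (by simp)

lemma terminal_terminal_mem : S.E (terminal.from (⊤_ D)) := by
  rw [terminal.hom_ext (terminal.from (⊤_ D)) (𝟙 _)]
  exact S.id_mem _

lemma cy_id_terminal_mem (X : D) : S.E (terminal.from (S.cy (𝟙 X) (terminal.from X))) :=
  (S.mem_iff (𝟙 X)).1 (S.id_mem X)

/-- The reversed cone of an identity is acyclic. -/
lemma cy_terminal_id_mem (X : D) : S.E (terminal.from (S.cy (terminal.from X) (𝟙 X))) := by
  let F := span (terminal.from X) (𝟙 X)
  let e : span (𝟙 X) (terminal.from X) ⟶ swapSpan ⋙ F := spanHomMk (𝟙 _) (𝟙 _) (𝟙 _)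
  have he : S.E ((cyl S.s).map e) := S.cyl_map_mem _ (by
    rintro (_ | _ | _) <;> exact S.id_mem _)
  -- Exchanging the legs of the span reverses the cylinder, so the simple of the reversed cylinder
  -- is equivalent to the ordinary cone of `𝟙 X`, which is acyclic.
  have h₁ := (S.terminal_mem_iff (S.comp_mem _ _ he (S.simple_mem (cylRev F) fun n =>
    S.mem_of_isIso (cylRevObj F n)))).1 (S.cy_id_terminal_mem X)
  let c : Cyl.obj (F ⋙ SimplicialObject.const D) ⟶ (SimplicialObject.const D).obj (⊤_ D) :=
    cylToCocone (spanCocone (f := terminal.from X) (g := 𝟙 X) (𝟙 _) (terminal.from X) (by simp))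
  have h₂ : S.E (terminal.from (S.s.obj ((SimplicialObject.const D).obj (⊤_ D)))) :=
    (S.terminal_mem_iff (S.lam_mem (⊤_ D))).2 S.terminal_terminal_mem
  -- A constant simplicial object is its own reversal, so the axiom on order reversal removes the
  -- reversal from the collapse `c` to the point.
  have h₃ : S.E (S.s.map c) := (S.rev_mem_iff c).1 (S.of_terminal h₁ h₂)
  exact (S.terminal_mem_iff h₃).2 h₂

/-- A span whose homotopy pushout is its left object. -/
abbrev leftSpan (B : D) : WalkingSpan ⥤ D := span (initial.to B) (𝟙 (⊥_ D))

/-- A span whose homotopy pushout is its right object. -/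
abbrev rightSpan (B : D) : WalkingSpan ⥤ D := span (𝟙 (⊥_ D)) (initial.to B)

lemma initial_to_initial_mem : S.E (initial.to (⊥_ D)) := by
  rw [initial.hom_ext (initial.to (⊥_ D)) (𝟙 _)]
  exact S.id_mem _

/-- The homotopy pushout over an initial object is the coproduct, here `B ⨿ ∅`. Trivial spans of
this kind allow single objects to enter a span of spans, and so turn the commutation of homotopy
pushouts into glueing statements. -/
lemma inl_leftSpan_mem (B : D) : S.E (S.inl (initial.to B) (𝟙 (⊥_ D))) := by
  refine S.of_comp_left (S.cyDesc_coprod_mem initialIsInitial (initial.to B) (𝟙 (⊥_ D))) ?_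
  rw [inl_cyDesc]
  have : IsIso (coprod.inl : B ⟶ B ⨿ ⊥_ D) :=
    ⟨coprod.desc (𝟙 _) (initial.to _), coprod.inl_desc _ _,
      coprod.hom_ext (by simp [coprod.inl_desc]) (initial.hom_ext _ _)⟩
  exact S.mem_of_isIso _

lemma inr_rightSpan_mem (B : D) : S.E (S.inr (𝟙 (⊥_ D)) (initial.to B)) := by
  refine S.of_comp_left (S.cyDesc_coprod_mem initialIsInitial (𝟙 (⊥_ D)) (initial.to B)) ?_
  rw [inr_cyDesc]
  have : IsIso (coprod.inr : B ⟶ (⊥_ D) ⨿ B) :=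
    ⟨coprod.desc (initial.to _) (𝟙 _), coprod.inr_desc _ _,
      coprod.hom_ext (initial.hom_ext _ _) (by simp [coprod.inr_desc])⟩
  exact S.mem_of_isIso _

/-! ### Glueing, homotopy cobase change, and cones of morphisms of homotopy pushouts. -/

section Glue

variable {f : X ⟶ Y} {g : X ⟶ Z} {f' : X' ⟶ Y'} {g' : X' ⟶ Z'}

lemma cyMap_congr {x x₁ : X ⟶ X'} {y y₁ : Y ⟶ Y'} {z z₁ : Z ⟶ Z'} {hy : f ≫ y = x ≫ f'}
    {hz : g ≫ z = x ≫ g'} (ex : x = x₁) (ey : y = y₁) (ez : z = z₁) :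
    S.cyMap x y z hy hz = S.cyMap x₁ y₁ z₁ (by rw [← ex, ← ey, hy]) (by rw [← ex, ← ez, hz]) := by
  subst ex ey ez
  rfl

lemma cyMap_mem_iff_of_squares {X₁ Y₁ Z₁ X₁' Y₁' Z₁' : D} {f₁ : X₁ ⟶ Y₁} {g₁ : X₁ ⟶ Z₁}
    {f₁' : X₁' ⟶ Y₁'} {g₁' : X₁' ⟶ Z₁'} {x : X ⟶ X'} {y : Y ⟶ Y'} {z : Z ⟶ Z'}
    {hy : f ≫ y = x ≫ f'} {hz : g ≫ z = x ≫ g'} {x₁ : X₁ ⟶ X₁'} {y₁ : Y₁ ⟶ Y₁'} {z₁ : Z₁ ⟶ Z₁'}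
    {hy₁ : f₁ ≫ y₁ = x₁ ≫ f₁'} {hz₁ : g₁ ≫ z₁ = x₁ ≫ g₁'} (a : X ⟶ X₁) (b : Y ⟶ Y₁) (c : Z ⟶ Z₁)
    (a' : X' ⟶ X₁') (b' : Y' ⟶ Y₁') (c' : Z' ⟶ Z₁') (ha : S.E a) (hb : S.E b) (hc : S.E c)
    (ha' : S.E a') (hb' : S.E b') (hc' : S.E c') (hf : f ≫ b = a ≫ f₁) (hg : g ≫ c = a ≫ g₁)
    (hf' : f' ≫ b' = a' ≫ f₁') (hg' : g' ≫ c' = a' ≫ g₁') (wx : x ≫ a' = a ≫ x₁)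
    (wy : y ≫ b' = b ≫ y₁) (wz : z ≫ c' = c ≫ z₁) :
    S.E (S.cyMap x y z hy hz) ↔ S.E (S.cyMap x₁ y₁ z₁ hy₁ hz₁) := by
  refine S.mem_iff_of_square (S.cyMap_mem a b c hf hg ha hb hc)
    (S.cyMap_mem a' b' c' hf' hg' ha' hb' hc') ?_
  rw [cyMap_comp, cyMap_comp]
  exact S.cyMap_congr wx wy wz

/-- The morphism of spans from `leftSpan B` given by a morphism to the left object. -/
abbrev leftSpanTo (F : WalkingSpan ⥤ D) (b : B ⟶ F.obj WalkingSpan.left) : leftSpan B ⟶ F :=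
  spanHomMk (initial.to _) b (initial.to _) (initial.hom_ext _ _) (initial.hom_ext _ _)

/-- The morphism of spans from `rightSpan B` given by a morphism to the right object. -/
abbrev rightSpanTo (F : WalkingSpan ⥤ D) (b : B ⟶ F.obj WalkingSpan.right) : rightSpan B ⟶ F :=
  spanHomMk (initial.to _) (initial.to _) b (initial.hom_ext _ _) (initial.hom_ext _ _)

lemma leftSpanTo_comp {F G : WalkingSpan ⥤ D} (b : B ⟶ F.obj WalkingSpan.left) (φ : F ⟶ G)
    (β : B ⟶ B') (b' : B' ⟶ G.obj WalkingSpan.left) (h : b ≫ φ.app _ = β ≫ b') :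
    leftSpanTo F b ≫ φ = leftSpanTo (leftSpan B') β ≫ leftSpanTo G b' := by
  ext (_ | _ | _)
  exacts [initial.hom_ext _ _, h, initial.hom_ext _ _]

lemma rightSpanTo_comp {F G : WalkingSpan ⥤ D} (b : B ⟶ F.obj WalkingSpan.right) (φ : F ⟶ G)
    (β : B ⟶ B') (b' : B' ⟶ G.obj WalkingSpan.right) (h : b ≫ φ.app _ = β ≫ b') :
    rightSpanTo F b ≫ φ = rightSpanTo (rightSpan B') β ≫ rightSpanTo G b' := by
  ext (_ | _ | _)
  exacts [initial.hom_ext _ _, initial.hom_ext _ _, h]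

lemma inl_cyl_leftSpanTo (b : B ⟶ Y) :
    S.inl (initial.to B) (𝟙 (⊥_ D)) ≫ (cyl S.s).map (leftSpanTo (span f g) b) = b ≫ S.inl f g :=
  S.inl_cyMap _ _ _ _ _

lemma inr_cyl_rightSpanTo (b : B ⟶ Z) :
    S.inr (𝟙 (⊥_ D)) (initial.to B) ≫ (cyl S.s).map (rightSpanTo (span f g) b) = b ≫ S.inr f g :=
  S.inr_cyMap _ _ _ _ _

lemma map_comp_eq {F G G' H : WalkingSpan ⥤ D} {a : F ⟶ G} {b : G ⟶ H} {a' : F ⟶ G'} {b' : G' ⟶ H}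
    (h : a ≫ b = a' ≫ b') :
    (cyl S.s).map a ≫ (cyl S.s).map b = (cyl S.s).map a' ≫ (cyl S.s).map b' := by
  rw [← Functor.map_comp, h, Functor.map_comp]

/-- Glueing along the left object of a homotopy pushout. -/
lemma cy_inl_mem {b : B ⟶ Y} {b' : B' ⟶ Y'} {h : B ⟶ P} {h' : B' ⟶ P'}
    (x : X ⟶ X') (y : Y ⟶ Y') (z : Z ⟶ Z') (β : B ⟶ B') (p : P ⟶ P')
    (hy : f ≫ y = x ≫ f') (hz : g ≫ z = x ≫ g') (hb : b ≫ y = β ≫ b') (hp : h ≫ p = β ≫ h')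
    (hx : S.E x) (hze : S.E z) (H : S.E (S.cyMap β y p hb hp))
    {k : B ⟶ S.cy f g} {k' : B' ⟶ S.cy f' g'} (hk : k = b ≫ S.inl f g)
    (hk' : k' = b' ≫ S.inl f' g') (w : k ≫ S.cyMap x y z hy hz = β ≫ k') :
    S.E (S.cyMap β (S.cyMap x y z hy hz) p w hp) := by
  -- The span of spans is `span f g ← leftSpan B → leftSpan P`. Taking homotopy pushouts inside each
  -- span gives `cy f g ← B → P`. Taking them across first leaves `x` and `z`, up to initial
  -- objects, at the middle and right positions, and the map of `H` at the left position.
  have h₁ := leftSpanTo_comp (F := span f g) (G := span f' g') b (spanHomMk x y z hy hz) β b' hb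
  have h₂ := leftSpanTo_comp (F := leftSpan P) (G := leftSpan P') h
    (leftSpanTo (leftSpan P') p) β h' hp
  refine (S.cyMap_mem_iff_of_squares (S.inl _ _) (𝟙 _) (S.inl _ _) (S.inl _ _) (𝟙 _) (S.inl _ _)
    (S.inl_leftSpan_mem _) (S.id_mem _) (S.inl_leftSpan_mem _) (S.inl_leftSpan_mem _) (S.id_mem _)
    (S.inl_leftSpan_mem _) ?_ ?_ ?_ ?_ ?_ ?_ ?_).2
    (S.cyMap_cyl_map_mem _ _ _ h₁ h₂ (k₁ := S.map_comp_eq h₁) (k₂ := S.map_comp_eq h₂) ?_)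
  · rw [Category.comp_id, hk, inl_cyl_leftSpanTo]
  · rw [inl_cyl_leftSpanTo]
  · rw [Category.comp_id, hk', inl_cyl_leftSpanTo]
  · rw [inl_cyl_leftSpanTo]
  · rw [inl_cyl_leftSpanTo]
  · rw [Category.comp_id, Category.id_comp]
    rfl
  · rw [inl_cyl_leftSpanTo]
  · rintro (_ | _ | _)
    · exact S.cyMap_mem _ _ _ _ _ S.initial_to_initial_mem hx S.initial_to_initial_mem
    · exact H
    · exact S.cyMap_mem _ _ _ _ _ S.initial_to_initial_mem hze S.initial_to_initial_mem

/-- Glueing along the right object of a homotopy pushout. -/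
lemma cy_inr_mem {b : B ⟶ Z} {b' : B' ⟶ Z'} {h : B ⟶ P} {h' : B' ⟶ P'}
    (x : X ⟶ X') (y : Y ⟶ Y') (z : Z ⟶ Z') (β : B ⟶ B') (p : P ⟶ P')
    (hy : f ≫ y = x ≫ f') (hz : g ≫ z = x ≫ g') (hb : b ≫ z = β ≫ b') (hp : h ≫ p = β ≫ h')
    (hx : S.E x) (hye : S.E y) (H : S.E (S.cyMap β z p hb hp))
    {k : B ⟶ S.cy f g} {k' : B' ⟶ S.cy f' g'} (hk : k = b ≫ S.inr f g)
    (hk' : k' = b' ≫ S.inr f' g') (w : k ≫ S.cyMap x y z hy hz = β ≫ k') :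
    S.E (S.cyMap β (S.cyMap x y z hy hz) p w hp) := by
  have h₁ := rightSpanTo_comp (F := span f g) (G := span f' g') b (spanHomMk x y z hy hz) β b' hb
  have h₂ := rightSpanTo_comp (F := rightSpan P) (G := rightSpan P') h
    (rightSpanTo (rightSpan P') p) β h' hp
  refine (S.cyMap_mem_iff_of_squares (S.inr _ _) (𝟙 _) (S.inr _ _) (S.inr _ _) (𝟙 _) (S.inr _ _)
    (S.inr_rightSpan_mem _) (S.id_mem _) (S.inr_rightSpan_mem _) (S.inr_rightSpan_mem _)
    (S.id_mem _) (S.inr_rightSpan_mem _) ?_ ?_ ?_ ?_ ?_ ?_ ?_).2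
    (S.cyMap_cyl_map_mem _ _ _ h₁ h₂ (k₁ := S.map_comp_eq h₁) (k₂ := S.map_comp_eq h₂) ?_)
  · rw [Category.comp_id, hk, inr_cyl_rightSpanTo]
  · rw [inr_cyl_rightSpanTo]
  · rw [Category.comp_id, hk', inr_cyl_rightSpanTo]
  · rw [inr_cyl_rightSpanTo]
  · rw [inr_cyl_rightSpanTo]
  · rw [Category.comp_id, Category.id_comp]
    rfl
  · rw [inr_cyl_rightSpanTo]
  · rintro (_ | _ | _)
    · exact S.cyMap_mem _ _ _ _ _ S.initial_to_initial_mem hx S.initial_to_initial_mem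
    · exact S.cyMap_mem _ _ _ _ _ S.initial_to_initial_mem hye S.initial_to_initial_mem
    · exact H

/-- Glueing on the right along the left object of a homotopy pushout. -/
lemma cy_inl_mem' {b : B ⟶ Y} {b' : B' ⟶ Y'} {h : B ⟶ P} {h' : B' ⟶ P'}
    (x : X ⟶ X') (y : Y ⟶ Y') (z : Z ⟶ Z') (β : B ⟶ B') (p : P ⟶ P')
    (hy : f ≫ y = x ≫ f') (hz : g ≫ z = x ≫ g') (hb : b ≫ y = β ≫ b') (hp : h ≫ p = β ≫ h')
    (hx : S.E x) (hze : S.E z) (H : S.E (S.cyMap β p y hp hb))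
    {k : B ⟶ S.cy f g} {k' : B' ⟶ S.cy f' g'} (hk : k = b ≫ S.inl f g)
    (hk' : k' = b' ≫ S.inl f' g') (w : k ≫ S.cyMap x y z hy hz = β ≫ k') :
    S.E (S.cyMap β p (S.cyMap x y z hy hz) hp w) := by
  have h₁ := leftSpanTo_comp (F := span f g) (G := span f' g') b (spanHomMk x y z hy hz) β b' hb
  have h₂ := leftSpanTo_comp (F := leftSpan P) (G := leftSpan P') h
    (leftSpanTo (leftSpan P') p) β h' hp
  refine (S.cyMap_mem_iff_of_squares (S.inl _ _) (S.inl _ _) (𝟙 _) (S.inl _ _) (S.inl _ _) (𝟙 _)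
    (S.inl_leftSpan_mem _) (S.inl_leftSpan_mem _) (S.id_mem _) (S.inl_leftSpan_mem _)
    (S.inl_leftSpan_mem _) (S.id_mem _) ?_ ?_ ?_ ?_ ?_ ?_ ?_).2
    (S.cyMap_cyl_map_mem _ _ _ h₂ h₁ (k₁ := S.map_comp_eq h₂) (k₂ := S.map_comp_eq h₁) ?_)
  · rw [inl_cyl_leftSpanTo]
  · rw [Category.comp_id, hk, inl_cyl_leftSpanTo]
  · rw [inl_cyl_leftSpanTo]
  · rw [Category.comp_id, hk', inl_cyl_leftSpanTo]
  · rw [inl_cyl_leftSpanTo]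
  · rw [inl_cyl_leftSpanTo]
  · rw [Category.comp_id, Category.id_comp]
    rfl
  · rintro (_ | _ | _)
    · exact S.cyMap_mem _ _ _ _ _ S.initial_to_initial_mem S.initial_to_initial_mem hx
    · exact H
    · exact S.cyMap_mem _ _ _ _ _ S.initial_to_initial_mem S.initial_to_initial_mem hze

/-- If `f` is an equivalence, then so is its homotopy cobase change. -/
lemma inr_mem (f : X ⟶ Y) (g : X ⟶ Z) (hf : S.E f) : S.E (S.inr f g) := by
  -- For `g = X → *` the cobase change is a map from `*` to the acyclic cone of `f`.
  have h₀ : S.E (S.inr f (terminal.from X)) :=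
    S.of_comp_left ((S.mem_iff f).1 hf) (by
      rw [terminal.hom_ext (_ ≫ _) (𝟙 _)]
      exact S.id_mem _)
  have h₁ : S.E (S.cyMap (terminal.from Z) (terminal.from Z) (𝟙 _) (f := 𝟙 Z)
      (g := terminal.from Z) (f' := 𝟙 (⊤_ D)) (g' := terminal.from (⊤_ D)) (by simp) (by simp)) :=
    S.of_terminal (S.cy_id_terminal_mem _) (S.cy_id_terminal_mem _)
  -- By glueing, the cone of `inr f g` is equivalent to the cone of `* → c(f)`: the only new
  -- ingredient is a map between cones of identities, which are acyclic. The acyclicity criterion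
  -- then carries the special case to any `g`.
  have h₂ := S.cy_inr_mem (f := f) (g := g) (f' := f) (g' := terminal.from X) (𝟙 X) (𝟙 Y)
    (terminal.from Z) (terminal.from Z) (𝟙 _) (by simp) (by simp) _ _ (S.id_mem _) (S.id_mem _)
    h₁ (Category.id_comp _).symm (Category.id_comp _).symm (S.inr_cyMap _ _ _ _ _)
  exact (S.mem_iff _).2 ((S.terminal_mem_iff h₂).2 ((S.mem_iff _).1 h₀))

/-- If `g` is an equivalence, then so is its homotopy cobase change. -/
lemma inl_mem (f : X ⟶ Y) (g : X ⟶ Z) (hg : S.E g) : S.E (S.inl f g) := by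
  have h : S.E (S.inl f (𝟙 X)) := by
    -- Here the target is the reversed cone of an identity, whose acyclicity comes from order
    -- reversal. Glueing extends this from `X → *` to every `f`, still with right leg `𝟙 X`.
    have h₀ : S.E (S.inl (terminal.from X) (𝟙 X)) :=
      S.of_comp_left (S.cy_terminal_id_mem X) (by
        rw [terminal.hom_ext (_ ≫ _) (𝟙 _)]
        exact S.id_mem _)
    have h₁ : S.E (S.cyMap (terminal.from Y) (terminal.from Y) (𝟙 _) (f := 𝟙 Y)
        (g := terminal.from Y) (f' := 𝟙 (⊤_ D)) (g' := terminal.from (⊤_ D)) (by simp) (by simp)) :=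
      S.of_terminal (S.cy_id_terminal_mem _) (S.cy_id_terminal_mem _)
    have h₂ := S.cy_inl_mem (f := f) (g := 𝟙 X) (f' := terminal.from X) (g' := 𝟙 X) (𝟙 X)
      (terminal.from Y) (𝟙 X) (terminal.from Y) (𝟙 _) (by simp) (by simp) _ _ (S.id_mem _)
      (S.id_mem _) h₁ (Category.id_comp _).symm (Category.id_comp _).symm (S.inl_cyMap _ _ _ _ _)
    exact (S.mem_iff _).2 ((S.terminal_mem_iff h₂).2 ((S.mem_iff _).1 h₀))
  -- A general `g` is reached by invariance: replacing the right leg `𝟙 X` by the equivalence `g` is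
  -- an equivalence of homotopy pushouts.
  have h' := S.inl_cyMap (f := f) (g := 𝟙 X) (f' := f) (g' := g) (𝟙 X) (𝟙 Y) g (by simp) (by simp)
  rw [← h'.trans (Category.id_comp _)]
  exact S.comp_mem _ _ h (S.cyMap_mem _ _ _ _ _ (S.id_mem _) (S.id_mem _) hg)

/-- The defining square of a homotopy pushout commutes in the homotopy category. -/
lemma Q_inl_eq_inr (f : X ⟶ Y) (g : X ⟶ Z) :
    S.E.Q.map f ≫ S.E.Q.map (S.inl f g) = S.E.Q.map g ≫ S.E.Q.map (S.inr f g) := by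
  -- In the cylinder of `X` both ends are sections of the same equivalence `r`, so they agree in the
  -- homotopy category. The general square is the image of this universal case.
  let r : S.cy (𝟙 X) (𝟙 X) ⟶ X := S.cyDesc (𝟙 X) (𝟙 X) rfl
  have hr : S.E r := S.of_comp_right (S.inr_mem (𝟙 X) (𝟙 X) (S.id_mem X)) (by
    rw [inr_cyDesc]
    exact S.id_mem X)
  have : IsIso (S.E.Q.map r) := (S.mem_iff_isIso r).1 hr
  have h : S.E.Q.map (S.inl (𝟙 X) (𝟙 X)) = S.E.Q.map (S.inr (𝟙 X) (𝟙 X)) := by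
    rw [← cancel_mono (S.E.Q.map r), ← Functor.map_comp, ← Functor.map_comp, inl_cyDesc, inr_cyDesc]
  have hl := S.inl_cyMap (f := 𝟙 X) (g := 𝟙 X) (f' := f) (g' := g) (𝟙 X) f g (by simp) (by simp)
  have hr := S.inr_cyMap (f := 𝟙 X) (g := 𝟙 X) (f' := f) (g' := g) (𝟙 X) f g (by simp) (by simp)
  rw [← Functor.map_comp, ← Functor.map_comp, ← hl, ← hr, Functor.map_comp, Functor.map_comp, h]

/-- A morphism of arrows between spans induces an equivalence on the cones of the morphisms of
homotopy pushouts if it does so on the cones of the components. -/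
lemma cone_cyl_mem {F G F' G' : WalkingSpan ⥤ D} {α : F ⟶ G} {α' : F' ⟶ G'} (φ : F ⟶ F')
    (γ : G ⟶ G') (w : α ≫ γ = φ ≫ α')
    (h : ∀ t, S.E (S.cyMap (f := α.app t) (g := terminal.from _) (f' := α'.app t)
      (g' := terminal.from _) (φ.app t) (γ.app t) (𝟙 (⊤_ D)) (congrArg (fun a => a.app t) w)
      (terminal.hom_ext _ _)))
    (k : (cyl S.s).map α ≫ (cyl S.s).map γ = (cyl S.s).map φ ≫ (cyl S.s).map α') :
    S.E (S.cyMap (f := (cyl S.s).map α) (g := terminal.from _) (f' := (cyl S.s).map α')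
      (g' := terminal.from _) ((cyl S.s).map φ) ((cyl S.s).map γ) (𝟙 (⊤_ D)) k
      (terminal.hom_ext _ _)) := by
  -- The span `* ← * → *` has an acyclic homotopy pushout and replaces the final object; in this way
  -- a cone of a morphism of homotopy pushouts becomes an iterated homotopy pushout.
  let pt : WalkingSpan ⥤ D := span (𝟙 (⊤_ D)) (terminal.from _)
  have hpt : S.E (terminal.from ((cyl S.s).obj pt)) := S.cy_id_terminal_mem _
  let t (F : WalkingSpan ⥤ D) : F ⟶ pt :=
    { app i := match i with
        | WalkingSpan.zero => terminal.from _
        | WalkingSpan.left => terminal.from _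
        | WalkingSpan.right => terminal.from _
      naturality := by
        rintro _ (_ | _ | _) _ <;> exact terminal.hom_ext _ _ }
  have ht : ∀ {F} (a b : F ⟶ pt), a = b := fun a b => by
    ext (_ | _ | _) <;> exact terminal.hom_ext _ _
  have h₂ : t F ≫ 𝟙 pt = φ ≫ t F' := ht _ _
  refine (S.cyMap_mem_iff_of_squares (𝟙 _) (𝟙 _) (terminal.from _) (𝟙 _) (𝟙 _) (terminal.from _)
    (S.id_mem _) (S.id_mem _) hpt (S.id_mem _) (S.id_mem _) hpt ?_ (terminal.hom_ext _ _) ?_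
    (terminal.hom_ext _ _) ?_ ?_ (terminal.hom_ext _ _)).1
    (S.cyMap_cyl_map_mem φ γ (𝟙 pt) w h₂ (k₁ := k) (k₂ := S.map_comp_eq h₂) ?_)
  · rw [Category.comp_id, Category.id_comp]
  · rw [Category.comp_id, Category.id_comp]
  · rw [Category.comp_id, Category.id_comp]
  · rw [Category.comp_id, Category.id_comp]
  · rintro (_ | _ | _)
    · exact h WalkingSpan.zero
    · exact h WalkingSpan.left
    · exact h WalkingSpan.right

end Glue

end SimplicialDescentCategory

namespace SimplicialDescentCategory

variable {D : Type u} [Category.{v} D] [HasFiniteCoproducts D] [HasTerminal D]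
  (S : SimplicialDescentCategory D)

/-! ### Morphisms of the homotopy category -/

lemma isIso_Q {A B : D} {f : A ⟶ B} (hf : S.E f) : IsIso (S.E.Q.map f) :=
  (S.mem_iff_isIso f).1 hf

lemma exists_Q_obj (X : S.Ho) : ∃ A, S.E.Q.obj A = X :=
  ⟨(Localization.Construction.objEquiv S.E).symm X,
    (Localization.Construction.objEquiv S.E).apply_symm_apply X⟩

/-- Every morphism of the homotopy category is a right fraction of morphisms. -/
lemma exists_fraction {A B : D} (a : S.E.Q.obj A ⟶ S.E.Q.obj B) :
    ∃ (V : D) (k : A ⟶ V) (v : B ⟶ V), S.E v ∧ a ≫ S.E.Q.map v = S.E.Q.map k := by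
  refine loc_induction (P := fun A B a => ∃ (V : D) (k : A ⟶ V) (v : B ⟶ V), S.E v ∧
    a ≫ S.E.Q.map v = S.E.Q.map k) ?_ ?_ ?_ a
  · intro A B f
    exact ⟨B, f, 𝟙 B, S.id_mem B, by simp⟩
  · intro A B w hw
    refine ⟨B, 𝟙 B, w, hw, ?_⟩
    rw [CategoryTheory.Functor.map_id]
    exact (Localization.Construction.wIso w hw).inv_hom_id
  · rintro A B C f g ⟨V, k, v, hv, h⟩ ⟨V', k', v', hv', h'⟩
    -- Two fractions `A → V ← B` and `B → V' ← C` are composed through the homotopy pushout of `V ←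
    -- B → V'`, whose square commutes in the homotopy category.
    have hi := S.inr_mem v k' hv
    refine ⟨_, k ≫ S.inl v k', v' ≫ S.inr v k', S.comp_mem _ _ hv' hi, ?_⟩
    rw [Functor.map_comp, Functor.map_comp, Category.assoc, reassoc_of% h', ← Q_inl_eq_inr,
      reassoc_of% h]

/-! ### Equality in the homotopy category, through connected components of cospans. -/

variable {A W W₁ W₂ : D}

/-- The morphisms `A ⟶ V` together with an equivalence `W ⟶ V`. -/
structure Cospan (A W : D) where
  /-- The common target. -/
  pt : D
  /-- The first morphism. -/
  k : A ⟶ pt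
  /-- The equivalence. -/
  v : W ⟶ pt
  mem : S.E v

variable {S}

/-- Morphisms of cospans. -/
def Cospan.Rel (c c' : S.Cospan A W) : Prop :=
  ∃ t : c.pt ⟶ c'.pt, c.k ≫ t = c'.k ∧ c.v ≫ t = c'.v

/-- The cobase change of a cospan. -/
def Cospan.push (c : S.Cospan A W) (u : W ⟶ W₁) : S.Cospan A W₁ :=
  ⟨S.cy c.v u, c.k ≫ S.inl _ _, S.inr _ _, S.inr_mem _ _ c.mem⟩

/-- The restriction of a cospan along an equivalence. -/
def Cospan.pull (c : S.Cospan A W₁) (u : W ⟶ W₁) (hu : S.E u) : S.Cospan A W :=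
  ⟨c.pt, c.k, u ≫ c.v, S.comp_mem _ _ hu c.mem⟩

lemma Cospan.Rel.push {c c' : S.Cospan A W} (h : c.Rel c') (u : W ⟶ W₁) :
    (c.push u).Rel (c'.push u) := by
  obtain ⟨t, hk, hv⟩ := h
  have hv' : c.v ≫ t = 𝟙 W ≫ c'.v := by simpa using hv
  refine ⟨S.cyMap (𝟙 W) t (𝟙 W₁) hv' (by simp), ?_, ?_⟩
  · dsimp only [Cospan.push]
    rw [Category.assoc, inl_cyMap, reassoc_of% hk]
  · exact (S.inr_cyMap _ _ _ _ _).trans (Category.id_comp _)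

lemma Cospan.Rel.pull {c c' : S.Cospan A W₁} (h : c.Rel c') (u : W ⟶ W₁) (hu : S.E u) :
    (c.pull u hu).Rel (c'.pull u hu) := by
  obtain ⟨t, hk, hv⟩ := h
  exact ⟨t, hk, (Category.assoc _ _ _).trans (congrArg (u ≫ ·) hv)⟩

lemma Cospan.push_id (c : S.Cospan A W) : (c.push (𝟙 W)).Rel c :=
  ⟨S.cyDesc (𝟙 _) c.v (by simp), by
    dsimp only [Cospan.push]
    rw [Category.assoc, inl_cyDesc, Category.comp_id], S.inr_cyDesc _ _ _⟩

lemma Cospan.push_push (c : S.Cospan A W) (u : W ⟶ W₁) (u' : W₁ ⟶ W₂) :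
    ((c.push u).push u').Rel (c.push (u ≫ u')) := by
  refine ⟨S.cyDesc (S.cyMap (𝟙 _) (𝟙 _) u' (by simp) (by simp)) (S.inr _ _) (S.inr_cyMap _ _ _ _ _),
    ?_, S.inr_cyDesc _ _ _⟩
  dsimp only [Cospan.push]
  rw [Category.assoc, Category.assoc, inl_cyDesc, inl_cyMap, Category.id_comp]

lemma Cospan.push_pull (c : S.Cospan A W₁) (u : W ⟶ W₁) (hu : S.E u) :
    ((c.pull u hu).push u).Rel c := by
  have h : (u ≫ c.v) ≫ 𝟙 _ = u ≫ c.v := Category.comp_id _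
  refine ⟨S.cyDesc (𝟙 _) c.v h, ?_, S.inr_cyDesc _ _ _⟩
  dsimp only [Cospan.push, Cospan.pull]
  rw [Category.assoc, inl_cyDesc, Category.comp_id]

/-- The square defining `push` commutes only up to homotopy, so `c` has no evident strict morphism
to the right side. The cylinder `c.push (𝟙 W)` mediates between the two. -/
lemma Cospan.push_id_pull_push (c : S.Cospan A W) (u : W ⟶ W₁) (hu : S.E u) :
    (c.push (𝟙 W)).Rel ((c.push u).pull u hu) := by
  refine ⟨S.cyMap (𝟙 _) (𝟙 _) u (by simp) (by simp), ?_, S.inr_cyMap _ _ _ _ _⟩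
  dsimp only [Cospan.push, Cospan.pull]
  rw [Category.assoc, inl_cyMap, Category.id_comp]

variable (S) in
/-- The functor of connected components of cospans. -/
def cospanFunctor (A : D) : D ⥤ Type (max u v) where
  obj W := Quot (Cospan.Rel (S := S) (A := A) (W := W))
  map u := TypeCat.ofHom (Quot.map (fun c => c.push u) fun _ _ h => h.push u)
  map_id W := by
    ext x
    induction x using Quot.ind with
    | mk c => exact Quot.sound c.push_id
  map_comp u u' := by
    ext x
    induction x using Quot.ind with
    | mk c => exact (Quot.sound (c.push_push u u')).symm

/-- Restriction along an equivalence is a two-sided inverse of cobase change once strictly related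
cospans are identified. -/
lemma isInvertedBy_cospanFunctor (A : D) : S.E.IsInvertedBy (S.cospanFunctor A) := by
  intro W W₁ u hu
  refine ⟨TypeCat.ofHom (Quot.map (fun c => c.pull u hu) fun _ _ h => h.pull u hu), ?_, ?_⟩
  · ext x
    induction x using Quot.ind with
    | mk c => exact (Quot.sound (c.push_id_pull_push u hu)).symm.trans (Quot.sound c.push_id)
  · ext x
    induction x using Quot.ind with
    | mk c => exact Quot.sound (c.push_pull u hu)

/-- Two morphisms with the same image in the homotopy category are connected by cospans. -/
lemma eqvGen_of_Q_map_eq {B : D} {f g : A ⟶ B} (h : S.E.Q.map f = S.E.Q.map g) :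
    Relation.EqvGen (Cospan.Rel (S := S)) ⟨B, f, 𝟙 B, S.id_mem B⟩ ⟨B, g, 𝟙 B, S.id_mem B⟩ := by
  have e := Localization.fac (S.cospanFunctor A) (isInvertedBy_cospanFunctor A) S.E.Q
  have h₁ : (S.cospanFunctor A).map f = (S.cospanFunctor A).map g := by
    rw [← cancel_epi (e.hom.app A), ← e.hom.naturality f, ← e.hom.naturality g]
    simp only [Functor.comp_map, h]
  -- As in the lemma of Yoneda, the functor is evaluated on the identity cospan; its cobase change
  -- along `f` collapses to the cospan formed by `f` and `𝟙 B`.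
  have h₂ := congrArg (fun t => t (Quot.mk _ (⟨A, 𝟙 A, 𝟙 A, S.id_mem A⟩ : S.Cospan A A))) h₁
  have h₃ : ∀ f : A ⟶ B, Cospan.Rel ((⟨A, 𝟙 A, 𝟙 A, S.id_mem A⟩ : S.Cospan A A).push f)
      ⟨B, f, 𝟙 B, S.id_mem B⟩ := fun f => by
    refine ⟨S.cyDesc f (𝟙 B) (by simp), ?_, S.inr_cyDesc _ _ _⟩
    dsimp only [Cospan.push]
    rw [Category.assoc, inl_cyDesc, Category.id_comp]
  exact Quot.eqvGen_exact ((Quot.sound (h₃ f)).symm.trans (h₂.trans (Quot.sound (h₃ g))))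

variable (S)

/-! ### The action of the suspension and the morphisms of cones -/

/-- The action of the suspension on morphisms of the homotopy category. -/
def suspMap {A B : D} (a : S.E.Q.obj A ⟶ S.E.Q.obj B) :
    S.E.Q.obj ((susp S.s).obj A) ⟶ S.E.Q.obj ((susp S.s).obj B) :=
  S.hoSuspFac.inv.app A ≫ S.hoSusp.map a ≫ S.hoSuspFac.hom.app B

lemma suspMap_map {A B : D} (f : A ⟶ B) :
    S.suspMap (S.E.Q.map f) = S.E.Q.map ((susp S.s).map f) := by
  have h := S.hoSuspFac.hom.naturality f
  dsimp only [suspMap]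
  exact (congrArg (_ ≫ ·) h).trans (Iso.inv_hom_id_app_assoc _ _ _)

lemma suspMap_comp {A B C : D} (a : S.E.Q.obj A ⟶ S.E.Q.obj B) (b : S.E.Q.obj B ⟶ S.E.Q.obj C) :
    S.suspMap (a ≫ b) = S.suspMap a ≫ S.suspMap b := by
  simp [suspMap]

lemma suspMap_id (A : D) : S.suspMap (𝟙 (S.E.Q.obj A)) = 𝟙 _ := by
  simp [suspMap]

/-- The inclusion of the base of a cone, in the homotopy category. -/
abbrev ci {A B : D} (f : A ⟶ B) : S.E.Q.obj B ⟶ S.E.Q.obj (cone S.s f) :=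
  S.E.Q.map (S.inl f (terminal.from A))

/-- The projection of a cone to the suspension, in the homotopy category. -/
abbrev cp {A B : D} (f : A ⟶ B) : S.E.Q.obj (cone S.s f) ⟶ S.E.Q.obj ((susp S.s).obj A) :=
  S.E.Q.map (coneToSusp S.s f)

/-- The morphism `c : cone f ⟶ cone f'` of the homotopy category is compatible with the morphisms
`a` and `b` on the source and the target. -/
structure IsFill {A B A' B' : D} (f : A ⟶ B) (f' : A' ⟶ B') (a : S.E.Q.obj A ⟶ S.E.Q.obj A')
    (b : S.E.Q.obj B ⟶ S.E.Q.obj B') (c : S.E.Q.obj (cone S.s f) ⟶ S.E.Q.obj (cone S.s f')) :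
    Prop where
  inl : S.ci f ≫ c = b ≫ S.ci f'
  proj : c ≫ S.cp f' = S.cp f ≫ S.suspMap a
  isIso : IsIso a → IsIso b → IsIso c

variable {A B A' B' A'' B'' : D} {f : A ⟶ B} {f' : A' ⟶ B'} {f'' : A'' ⟶ B''} {S}

/-- Composites of `a`s or `b`s may be invertible without the factors being so. Asking for one
invertible factor on each side excludes this, which the last field of `IsFill` requires. -/
lemma IsFill.comp {a : S.E.Q.obj A ⟶ S.E.Q.obj A'} {b : S.E.Q.obj B ⟶ S.E.Q.obj B'}
    {c : S.E.Q.obj (cone S.s f) ⟶ S.E.Q.obj (cone S.s f')}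
    {a' : S.E.Q.obj A' ⟶ S.E.Q.obj A''} {b' : S.E.Q.obj B' ⟶ S.E.Q.obj B''}
    {c' : S.E.Q.obj (cone S.s f') ⟶ S.E.Q.obj (cone S.s f'')} (h : S.IsFill f f' a b c)
    (h' : S.IsFill f' f'' a' b' c') (ha : IsIso a ∨ IsIso a') (hb : IsIso b ∨ IsIso b') :
    S.IsFill f f'' (a ≫ a') (b ≫ b') (c ≫ c') where
  inl := by rw [reassoc_of% h.inl, h'.inl, Category.assoc]
  proj := by rw [Category.assoc, h'.proj, reassoc_of% h.proj, suspMap_comp]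
  isIso := by
    intro i i'
    have h₁ : IsIso a ∧ IsIso a' := by
      rcases ha with ha | ha
      · exact ⟨ha, IsIso.of_isIso_comp_left a a'⟩
      · exact ⟨IsIso.of_isIso_comp_right a a', ha⟩
    have h₂ : IsIso b ∧ IsIso b' := by
      rcases hb with hb | hb
      · exact ⟨hb, IsIso.of_isIso_comp_left b b'⟩
      · exact ⟨IsIso.of_isIso_comp_right b b', hb⟩
    have := h.isIso h₁.1 h₂.1
    have := h'.isIso h₁.2 h₂.2
    infer_instance

lemma IsFill.inv {a : S.E.Q.obj A ⟶ S.E.Q.obj A'} {b : S.E.Q.obj B ⟶ S.E.Q.obj B'}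
    {c : S.E.Q.obj (cone S.s f) ⟶ S.E.Q.obj (cone S.s f')} (h : S.IsFill f f' a b c) [IsIso a]
    [IsIso b] [IsIso c] : S.IsFill f' f (CategoryTheory.inv a) (CategoryTheory.inv b)
      (CategoryTheory.inv c) where
  inl := by rw [IsIso.comp_inv_eq, Category.assoc, h.inl, IsIso.inv_hom_id_assoc]
  proj := by
    rw [IsIso.inv_comp_eq, reassoc_of% h.proj, ← suspMap_comp, IsIso.hom_inv_id, suspMap_id,
      Category.comp_id]
  isIso _ _ := inferInstance

/-- The morphism of cones induced by a strictly commutative square. -/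
abbrev coneMap (x : A ⟶ A') (y : B ⟶ B') (h : f ≫ y = x ≫ f') : cone S.s f ⟶ cone S.s f' :=
  S.cyMap x y (𝟙 (⊤_ D)) h (terminal.hom_ext _ _)

lemma coneMap_coneToSusp (x : A ⟶ A') (y : B ⟶ B') (h : f ≫ y = x ≫ f') :
    coneMap x y h ≫ coneToSusp S.s f' = coneToSusp S.s f ≫ (susp S.s).map x := by
  refine (S.cyMap_comp _ _ _ _ _ _ _ _ _ _).trans (Eq.trans ?_
    (S.cyMap_comp _ _ _ _ _ _ _ _ _ _).symm)
  exact S.cyMap_congr ((Category.comp_id _).trans (Category.id_comp _).symm)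
    (terminal.hom_ext _ _) rfl

lemma isFill_coneMap (x : A ⟶ A') (y : B ⟶ B') (h : f ≫ y = x ≫ f') :
    S.IsFill f f' (S.E.Q.map x) (S.E.Q.map y) (S.E.Q.map (coneMap x y h)) where
  inl := by rw [← Functor.map_comp, inl_cyMap, Functor.map_comp]
  proj := by rw [suspMap_map, ← Functor.map_comp, coneMap_coneToSusp, Functor.map_comp]
  isIso hx hy := S.isIso_Q (S.cyMap_mem _ _ _ _ _ ((S.mem_iff_isIso x).2 hx)
    ((S.mem_iff_isIso y).2 hy) (S.id_mem _))

/-- A strict morphism of cospans gives a strict square, and its component on targets is an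
equivalence because both cospans carry one. Inversion and composition extend this to zigzags; the
condition on the maps `v` keeps track of `b`. -/
lemma exists_isFill_of_eqvGen {W : D} {c c' : S.Cospan A W}
    (h : Relation.EqvGen Cospan.Rel c c') : ∃ b t, IsIso b ∧ S.E.Q.map c.v ≫ b = S.E.Q.map c'.v ∧
      S.IsFill c.k c'.k (𝟙 _) b t := by
  induction h with
  | rel c c' h =>
    obtain ⟨t, hk, hv⟩ := h
    have ht : S.E t := S.of_comp_right c.mem (by rw [hv]; exact c'.mem)
    have h := isFill_coneMap (S := S) (f := c.k) (f' := c'.k) (𝟙 _) t (by simp [hk])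
    rw [CategoryTheory.Functor.map_id] at h
    exact ⟨_, _, S.isIso_Q ht, by rw [← Functor.map_comp, hv], h⟩
  | refl c =>
    exact ⟨𝟙 _, 𝟙 _, inferInstance, by simp, by simp, by simp [suspMap_id], fun _ _ => inferInstance⟩
  | symm c c' _ ih =>
    obtain ⟨b, t, hb, hv, ht⟩ := ih
    have := ht.isIso inferInstance hb
    have h := ht.inv
    rw [IsIso.inv_id] at h
    exact ⟨_, _, inferInstance, by rw [← hv]; simp, h⟩
  | trans c c' c'' _ _ ih ih' =>
    obtain ⟨b, t, hb, hv, ht⟩ := ih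
    obtain ⟨b', t', hb', hv', ht'⟩ := ih'
    have h := ht.comp ht' (Or.inl inferInstance) (Or.inl hb)
    rw [Category.comp_id] at h
    exact ⟨_, _, inferInstance, by rw [reassoc_of% hv, hv'], h⟩

/-- Both cospans have `𝟙 B` as their equivalence, and this forces the isomorphism `b` given by the
zigzag to be the identity. -/
lemma exists_isFill_of_Q_map_eq {f g : A ⟶ B} (h : S.E.Q.map f = S.E.Q.map g) :
    ∃ t, S.IsFill f g (𝟙 _) (𝟙 _) t := by
  obtain ⟨b, t, hb, hv, ht⟩ := exists_isFill_of_eqvGen (eqvGen_of_Q_map_eq h)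
  rw [CategoryTheory.Functor.map_id, Category.id_comp] at hv
  subst hv
  exact ⟨t, ht⟩

/-- A commutative square of the homotopy category extends to a morphism of cones. -/
lemma exists_isFill (f : A ⟶ B) (f' : A' ⟶ B') (a : S.E.Q.obj A ⟶ S.E.Q.obj A')
    (b : S.E.Q.obj B ⟶ S.E.Q.obj B') (w : S.E.Q.map f ≫ b = a ≫ S.E.Q.map f') :
    ∃ c, S.IsFill f f' a b c := by
  obtain ⟨V, k, v, hv, ha⟩ := S.exists_fraction a
  -- Through the cylinder `inr f' (𝟙 A')`, the arrow `f'` is isomorphic, together with its cone, to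
  -- its cobase change `inr f' v` along the denominator of `a`. After this replacement `a` is
  -- represented by the morphism `k` of `D`.
  let y₁ : S.cy f' (𝟙 A') ⟶ B' := S.cyDesc (𝟙 B') f' (by simp)
  let y₂ : S.cy f' (𝟙 A') ⟶ S.cy f' v := S.cyMap (𝟙 _) (𝟙 _) v (by simp) (by simp)
  have hy₁ : S.E y₁ := S.of_comp_right (S.inl_mem f' (𝟙 A') (S.id_mem _)) (by
    rw [inl_cyDesc]
    exact S.id_mem _)
  have hy₂ : S.E y₂ := S.cyMap_mem _ _ _ _ _ (S.id_mem _) (S.id_mem _) hv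
  have iv := S.isIso_Q hv
  have iy₁ := S.isIso_Q hy₁
  have iy₂ := S.isIso_Q hy₂
  have F₁ := isFill_coneMap (S := S) (f := S.inr f' (𝟙 A')) (f' := f') (𝟙 A') y₁ (by
    rw [inr_cyDesc, Category.id_comp])
  have F₂ := isFill_coneMap (S := S) (f := S.inr f' (𝟙 A')) (f' := S.inr f' v) v y₂
    (S.inr_cyMap _ _ _ _ _)
  have i₁ := F₁.isIso inferInstance iy₁
  have i₂ := F₂.isIso iv iy₂
  have F₃ := F₂.inv.comp F₁ (Or.inl inferInstance) (Or.inl inferInstance)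
  -- The same is done for `b`, transported to the new target. The square then becomes an equality of
  -- images of two parallel morphisms of `D`.
  obtain ⟨V', k', v', hv', hb⟩ := S.exists_fraction
    (b ≫ CategoryTheory.inv (S.E.Q.map y₁) ≫ S.E.Q.map y₂)
  have iv' := S.isIso_Q hv'
  have F₄ := isFill_coneMap (S := S) (f := f) (f' := f ≫ k') (𝟙 A) k' (by simp)
  have F₅ := isFill_coneMap (S := S) (f := k ≫ S.inr f' v) (f' := (k ≫ S.inr f' v) ≫ v') (𝟙 A)
    v' (by simp)
  have i₅ := F₅.isIso inferInstance iv'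
  have F₆ := isFill_coneMap (S := S) (f := k ≫ S.inr f' v) (f' := S.inr f' v) k (𝟙 _) (by simp)
  have e : S.E.Q.map (f ≫ k') = S.E.Q.map ((k ≫ S.inr f' v) ≫ v') := by
    have e₁ : S.E.Q.map f' ≫ CategoryTheory.inv (S.E.Q.map y₁) = S.E.Q.map (S.inr f' (𝟙 A')) := by
      rw [IsIso.comp_inv_eq, ← Functor.map_comp, inr_cyDesc]
    have e₂ : S.E.Q.map (S.inr f' (𝟙 A')) ≫ S.E.Q.map y₂ =
        S.E.Q.map v ≫ S.E.Q.map (S.inr f' v) := by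
      rw [← Functor.map_comp, inr_cyMap, Functor.map_comp]
    rw [Functor.map_comp, ← hb, Functor.map_comp, Functor.map_comp, ← ha]
    simp only [Category.assoc]
    rw [reassoc_of% w, reassoc_of% e₁, reassoc_of% e₂]
  obtain ⟨t, F₇⟩ := exists_isFill_of_Q_map_eq e
  -- The chain of arrows is `f`, `f ≫ k'`, `k ≫ inr f' v ≫ v'`, `k ≫ inr f' v`, `inr f' v`, `f'`.
  -- Only the second step is not induced by strict squares.
  have F := ((F₄.comp F₇ (Or.inr inferInstance) (Or.inr inferInstance)).comp F₅.inv
    (Or.inr inferInstance) (Or.inr inferInstance)).comp (F₆.comp F₃ (Or.inr inferInstance)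
      (Or.inr inferInstance)) (Or.inl inferInstance)
        (Or.inr inferInstance)
  have ea : a = ((S.E.Q.map (𝟙 A) ≫ 𝟙 (S.E.Q.obj A)) ≫ CategoryTheory.inv (S.E.Q.map (𝟙 A))) ≫
      S.E.Q.map k ≫ CategoryTheory.inv (S.E.Q.map v) ≫ S.E.Q.map (𝟙 A') := by
    simp [← ha]
  have eb : b = ((S.E.Q.map k' ≫ 𝟙 (S.E.Q.obj V')) ≫ CategoryTheory.inv (S.E.Q.map v')) ≫
      S.E.Q.map (𝟙 (S.cy f' v)) ≫ CategoryTheory.inv (S.E.Q.map y₂) ≫ S.E.Q.map y₁ := by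
    simp [← hb]
  rw [ea, eb]
  exact ⟨_, F⟩

end SimplicialDescentCategory

namespace SimplicialDescentCategory

variable {D : Type u} [Category.{v} D] [HasFiniteCoproducts D] [HasTerminal D]
  (S : SimplicialDescentCategory D)

/-! ### Comparison of collapses of iterated cylinders -/

section Collapse

variable {A B C Z T : D}

lemma cyDesc_congr {f : A ⟶ B} {g : A ⟶ C} {y y' : B ⟶ T} {z z' : C ⟶ T} {h : f ≫ y = g ≫ z}
    (ey : y = y') (ez : z = z') :
    S.cyDesc y z h = S.cyDesc y' z' (by rw [← ey, ← ez, h]) := by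
  subst ey ez
  rfl

lemma cyDesc_id_left_mem (h : B ⟶ Z) : S.E (S.cyDesc (f := 𝟙 B) (g := h) h (𝟙 Z) (by simp)) :=
  S.of_comp_right (S.inr_mem (𝟙 B) h (S.id_mem _)) (by
    rw [inr_cyDesc]
    exact S.id_mem _)

lemma cyDesc_id_right_mem (g : B ⟶ C) : S.E (S.cyDesc (f := g) (g := 𝟙 B) (𝟙 C) g (by simp)) :=
  S.of_comp_right (S.inl_mem g (𝟙 B) (S.id_mem _)) (by
    rw [inl_cyDesc]
    exact S.id_mem _)

variable (g : B ⟶ C) (h : B ⟶ Z)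

/-- The collapse of the second half of a cylinder. -/
def collapseRight : S.cy g (S.inl (𝟙 B) h) ⟶ S.cy g h :=
  S.cyMap (𝟙 _) (𝟙 _) (S.cyDesc h (𝟙 _) (by simp)) (by simp) (by rw [inl_cyDesc, Category.id_comp])

/-- The collapse of the first half of a cylinder. -/
def collapseLeft : S.cy g (S.inl (𝟙 B) h) ⟶ S.cy g h :=
  S.cyDesc (S.inl g h) (S.cyMap (𝟙 _) g (𝟙 _) (by simp) (by simp)) (S.inl_cyMap _ _ _ _ _).symm

lemma collapseRight_mem : S.E (S.collapseRight g h) :=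
  S.cyMap_mem _ _ _ _ _ (S.id_mem _) (S.id_mem _) (S.cyDesc_id_left_mem h)

/-- The collapse factors through `cy (𝟙 C) (inl g h)`. The first factor is an equivalence by
glueing, and the second retracts a cylinder with trivial left leg onto its right end. -/
lemma collapseLeft_mem : S.E (S.collapseLeft g h) := by
  have H : S.E (S.cyMap (f := g) (g := 𝟙 B) (f' := 𝟙 C) (g' := 𝟙 C) g (𝟙 C) g (by simp) (by simp)) :=
    S.of_comp_right (S.inl_mem g (𝟙 B) (S.id_mem _)) (by
      rw [inl_cyMap, Category.id_comp]
      exact S.inl_mem _ _ (S.id_mem _))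
  have w : S.inl (𝟙 B) h ≫ S.cyMap (f' := g) (g' := h) (𝟙 B) g (𝟙 Z) (by simp) (by simp) =
      g ≫ S.inl g h := S.inl_cyMap _ _ _ _ _
  have h₁ := S.cy_inl_mem' (f := 𝟙 B) (g := h) (f' := g) (g' := h) (𝟙 B) g (𝟙 Z) g (𝟙 C) (by simp)
    (by simp) _ _ (S.id_mem _) (S.id_mem _) H (Category.id_comp _).symm (Category.id_comp _).symm w
  have h₂ := S.comp_mem _ _ h₁ (S.cyDesc_id_left_mem (S.inl g h))
  rw [cyMap_cyDesc] at h₂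
  rwa [S.cyDesc_congr (Category.id_comp _) (Category.comp_id _)] at h₂

/-- The two collapses of a double cylinder agree in the homotopy category. -/
lemma Q_collapse_eq : S.E.Q.map (S.collapseRight g h) = S.E.Q.map (S.collapseLeft g h) := by
  let j := S.inl (𝟙 B) h
  let d : S.cy (𝟙 B) h ⟶ Z := S.cyDesc h (𝟙 _) (by simp)
  have hd : j ≫ d = h := S.inl_cyDesc _ _ _
  -- The source consists of three consecutive cylinders; `e₁`, `e₂`, `e₃` collapse the first, second
  -- and third. Collapsing two of the three in different orders gives the strict relations `E₁`,
  -- `E₂`, `E₃`.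
  let e₃ : S.cy g (S.inl (𝟙 B) j) ⟶ S.cy g j :=
    S.cyMap (𝟙 _) (𝟙 _) (S.cyMap (f' := 𝟙 B) (g' := h) (𝟙 _) (𝟙 _) d (by simp)
      (by rw [hd, Category.id_comp])) (by simp) (S.inl_cyMap _ _ _ _ _)
  let e₂ : S.cy g (S.inl (𝟙 B) j) ⟶ S.cy g j := S.collapseRight g j
  let e₁ : S.cy g (S.inl (𝟙 B) j) ⟶ S.cy g j := S.collapseLeft g j
  have he₃ : S.E e₃ := S.cyMap_mem _ _ _ _ _ (S.id_mem _) (S.id_mem _)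
    (S.cyMap_mem _ _ _ _ _ (S.id_mem _) (S.id_mem _) (S.cyDesc_id_left_mem h))
  have E₁ : e₃ ≫ S.collapseRight g h = e₂ ≫ S.collapseRight g h := by
    refine (S.cyMap_comp _ _ _ _ _ _ _ _ _ _).trans (Eq.trans ?_
      (S.cyMap_comp _ _ _ _ _ _ _ _ _ _).symm)
    refine S.cyMap_congr rfl rfl ?_
    refine (S.cyMap_cyDesc _ _ _ _ _ _ _ _).trans (Eq.trans ?_ (S.cyDesc_comp _ _ _ _).symm)
    exact S.cyDesc_congr ((Category.id_comp _).trans hd.symm)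
      ((Category.comp_id _).trans (Category.id_comp _).symm)
  have E₂ : e₃ ≫ S.collapseLeft g h = e₁ ≫ S.collapseRight g h := by
    refine (S.cyMap_cyDesc _ _ _ _ _ _ _ _).trans (Eq.trans ?_ (S.cyDesc_comp _ _ _ _).symm)
    refine S.cyDesc_congr ((Category.id_comp _).trans
      ((S.inl_cyMap _ _ _ _ _).trans (Category.id_comp _)).symm) ?_
    refine (S.cyMap_comp _ _ _ _ _ _ _ _ _ _).trans (Eq.trans ?_
      (S.cyMap_comp _ _ _ _ _ _ _ _ _ _).symm)
    exact S.cyMap_congr rfl ((Category.id_comp _).trans (Category.comp_id _).symm)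
      ((Category.comp_id _).trans (Category.id_comp _).symm)
  have E₃ : e₁ ≫ S.collapseLeft g h = e₂ ≫ S.collapseLeft g h := by
    refine (S.cyDesc_comp _ _ _ _).trans (Eq.trans ?_ (S.cyMap_cyDesc _ _ _ _ _ _ _ _).symm)
    refine S.cyDesc_congr ((S.inl_cyDesc _ _ _).trans (Category.id_comp _).symm) ?_
    refine (S.cyMap_cyDesc _ _ _ _ _ _ _ _).trans (Eq.trans ?_ (S.cyDesc_comp _ _ _ _).symm)
    exact S.cyDesc_congr (S.inl_cyMap _ _ _ _ _).symm rfl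
  have i₁ := S.isIso_Q (S.collapseRight_mem g h)
  have i₂ := S.isIso_Q (S.collapseLeft_mem g h)
  have i₃ := S.isIso_Q he₃
  have Q₁ := congrArg S.E.Q.map E₁
  have Q₂ := congrArg S.E.Q.map E₂
  have Q₃ := congrArg S.E.Q.map E₃
  simp only [Functor.map_comp] at Q₁ Q₂ Q₃
  obtain ⟨θ, hθ⟩ : ∃ θ, S.E.Q.map (S.collapseRight g h) ≫ θ = S.E.Q.map (S.collapseLeft g h) :=
    ⟨CategoryTheory.inv (S.E.Q.map (S.collapseRight g h)) ≫ S.E.Q.map (S.collapseLeft g h), by simp⟩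
  have iθ : IsIso θ := by
    have : IsIso (S.E.Q.map (S.collapseRight g h) ≫ θ) := by rw [hθ]; exact i₂
    exact IsIso.of_isIso_comp_left (S.E.Q.map (S.collapseRight g h)) θ
  rw [← hθ] at Q₂ Q₃ ⊢
  -- Writing `R` for the right collapse, one has `e₃ R θ θ = e₁ R θ = e₂ R θ = e₃ R θ`, and `e₃ R`
  -- is invertible. An invertible idempotent is the identity.
  have h₂ : θ ≫ θ = θ := by
    rw [← cancel_epi (S.E.Q.map (S.collapseRight g h)), ← cancel_epi (S.E.Q.map e₃)]
    rw [reassoc_of% Q₂, Q₃, ← reassoc_of% Q₁]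
  have h₃ : θ = 𝟙 _ := by rw [← cancel_epi θ, h₂, Category.comp_id]
  rw [h₃, Category.comp_id]

end Collapse

/-! ### Cones of composites -/

section Octahedron

variable {A B C : D} (f : A ⟶ B) (g : B ⟶ C)

/-- The morphism from the cone of `f` to the cone of `f ≫ g`. -/
abbrev octK : cone S.s f ⟶ cone S.s (f ≫ g) :=
  coneMap (𝟙 A) g (Category.id_comp _).symm

/-- The morphism from the cone of `f ≫ g` to the cone of `g`. -/
abbrev octL : cone S.s (f ≫ g) ⟶ cone S.s g :=
  coneMap f (𝟙 C) (Category.comp_id _)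

/-- The morphism from the cone of `g` to the cone of `octK`. -/
abbrev octM : cone S.s g ⟶ cone S.s (S.octK f g) :=
  coneMap (S.inl f (terminal.from A)) (S.inl (f ≫ g) (terminal.from A))
    (S.inl_cyMap _ _ _ _ _).symm

/-- The map from `A → B → C` to `B = B → C` identifies the cone of `octK f g` with the cone of `c(𝟙
B) → c(g)`, which is `c(g)` since `c(𝟙 B)` is acyclic. Up to this identification `octM f g` is the
identity in the homotopy category. -/
lemma Q_octM : IsIso (S.E.Q.map (S.octM f g)) ∧
    S.E.Q.map (S.octL f g) ≫ S.E.Q.map (S.octM f g) = S.ci (S.octK f g) := by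
  let k' : cone S.s (𝟙 B) ⟶ cone S.s g := coneMap (𝟙 B) g rfl
  let x : cone S.s f ⟶ cone S.s (𝟙 B) := coneMap f (𝟙 B) rfl
  have w : S.octK f g ≫ S.octL f g = x ≫ k' := by
    refine (S.cyMap_comp _ _ _ _ _ _ _ _ _ _).trans (Eq.trans ?_
      (S.cyMap_comp _ _ _ _ _ _ _ _ _ _).symm)
    exact S.cyMap_congr ((Category.id_comp _).trans (Category.comp_id _).symm)
      ((Category.comp_id _).trans (Category.id_comp _).symm) rfl
  let n : cone S.s (S.octK f g) ⟶ cone S.s k' := coneMap x (S.octL f g) w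
  -- Cones commute with homotopy pushouts, so `n` can be checked on the three objects of the cone
  -- spans. There it compares the cones of `𝟙 A` and `𝟙 B`, both acyclic, or is induced by
  -- identities.
  have hn : S.E n := by
    refine S.cone_cyl_mem (F := coneSpan f) (G := coneSpan (f ≫ g)) (F' := coneSpan (𝟙 B))
      (G' := coneSpan g) (α := spanHomMk (𝟙 A) g (𝟙 _) (Category.id_comp _).symm (terminal.hom_ext _ _))
      (α' := spanHomMk (𝟙 B) g (𝟙 _) rfl (terminal.hom_ext _ _))
      (spanHomMk f (𝟙 B) (𝟙 _) rfl (terminal.hom_ext _ _))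
      (spanHomMk f (𝟙 C) (𝟙 _) (Category.comp_id _) (terminal.hom_ext _ _)) ?_ ?_ w
    · ext (_ | _ | _)
      · exact (Category.id_comp _).trans (Category.comp_id _).symm
      · exact (Category.comp_id _).trans (Category.id_comp _).symm
      · rfl
    · rintro (_ | _ | _)
      · exact S.of_terminal (S.cy_id_terminal_mem _) (S.cy_id_terminal_mem _)
      · exact S.cyMap_mem _ _ _ _ _ (S.id_mem _) (S.id_mem _) (S.id_mem _)
      · exact S.cyMap_mem _ _ _ _ _ (S.id_mem _) (S.id_mem _) (S.id_mem _)
  let n₁ : cone S.s g ⟶ cone S.s k' := S.inl k' (terminal.from _)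
  have hn₁ : S.E n₁ := S.inl_mem _ _ (S.cy_id_terminal_mem B)
  let j := S.inl (𝟙 B) (terminal.from B)
  have hj : g ≫ S.inl g (terminal.from B) = j ≫ k' := (S.inl_cyMap _ _ _ _ _).symm
  let n₂ : cone S.s g ⟶ cone S.s k' := coneMap j (S.inl g (terminal.from B)) hj
  have e₁ : S.octM f g ≫ n = n₂ := by
    refine (S.cyMap_comp _ _ _ _ _ _ _ _ _ _).trans ?_
    exact S.cyMap_congr ((S.inl_cyMap _ _ _ _ _).trans (Category.id_comp _))
      ((S.inl_cyMap _ _ _ _ _).trans (Category.id_comp _)) (Category.comp_id _)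
  -- The two maps differ by sliding the cone of `g` along the cylinder on `B`. Precomposed with the
  -- right collapse of two consecutive cylinders, `n₂` becomes `n₁` precomposed with the left
  -- collapse.
  have e₂ : S.E.Q.map n₂ = S.E.Q.map n₁ := by
    let u : S.cy g j ⟶ S.cy k' (𝟙 _) := S.cyMap j (S.inl g (terminal.from B)) (𝟙 _) hj rfl
    let d : S.cy k' (𝟙 _) ⟶ cone S.s g := S.cyDesc (𝟙 _) k' ((Category.comp_id _).trans (Category.id_comp _).symm)
    let t : S.cy k' (𝟙 _) ⟶ cone S.s k' :=
      S.cyMap (𝟙 _) (𝟙 _) (terminal.from _) ((Category.comp_id _).trans (Category.id_comp _).symm) rfl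
    have h₁ : S.collapseRight g (terminal.from B) ≫ n₂ = u ≫ t := by
      refine (S.cyMap_comp _ _ _ _ _ _ _ _ _ _).trans (Eq.trans ?_
        (S.cyMap_comp _ _ _ _ _ _ _ _ _ _).symm)
      exact S.cyMap_congr ((Category.id_comp _).trans (Category.comp_id _).symm)
        ((Category.id_comp _).trans (Category.comp_id _).symm) (terminal.hom_ext _ _)
    have h₂ : S.collapseLeft g (terminal.from B) = u ≫ d := by
      refine Eq.trans ?_ (S.cyMap_cyDesc _ _ _ _ _ _ _ _).symm
      exact S.cyDesc_congr (Category.comp_id _).symm (Category.id_comp _).symm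
    have h₃ : S.E.Q.map t = S.E.Q.map d ≫ S.E.Q.map n₁ := by
      have := S.isIso_Q (S.inl_mem k' (𝟙 _) (S.id_mem _))
      rw [← cancel_epi (S.E.Q.map (S.inl k' (𝟙 _))), ← Functor.map_comp, ← Functor.map_comp_assoc,
        inl_cyDesc, inl_cyMap, CategoryTheory.Functor.map_id, Category.id_comp]
      exact (Category.id_comp _).symm
    have := S.isIso_Q (S.collapseRight_mem g (terminal.from B))
    rw [← cancel_epi (S.E.Q.map (S.collapseRight g (terminal.from B))), ← Functor.map_comp, h₁,
      Functor.map_comp, h₃, Q_collapse_eq, h₂, Functor.map_comp, Category.assoc]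
  have in₁ := S.isIso_Q hn₁
  have inn := S.isIso_Q hn
  have e₃ : S.E.Q.map (S.octM f g) ≫ S.E.Q.map n = S.E.Q.map n₁ := by
    rw [← Functor.map_comp, e₁, e₂]
  refine ⟨?_, ?_⟩
  · have : IsIso (S.E.Q.map (S.octM f g) ≫ S.E.Q.map n) := by rw [e₃]; exact in₁
    exact IsIso.of_isIso_comp_right _ (S.E.Q.map n)
  · rw [← cancel_mono (S.E.Q.map n), Category.assoc, e₃, ← Functor.map_comp, ← Functor.map_comp]
    exact congrArg S.E.Q.map (S.inl_cyMap _ _ _ _ _).symm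

end Octahedron

/-! ### The rotation of a cofiber sequence -/

section Rotation

variable {A B A' B' : D}

/-- The inclusion of a final object in a suspension. -/
abbrev suspInl (A : D) : ⊤_ D ⟶ (susp S.s).obj A :=
  S.inl (terminal.from A) (terminal.from A)

lemma inl_coneToSusp (f : A ⟶ B) :
    S.inl f (terminal.from A) ≫ coneToSusp S.s f = terminal.from B ≫ S.suspInl A :=
  S.inl_cyMap _ _ _ _ _

/-- The comparison of the cone of the inclusion `B ⟶ cone f` with the suspension. -/
def rot (f : A ⟶ B) : cone S.s (S.inl f (terminal.from A)) ⟶ (susp S.s).obj A :=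
  S.cyDesc (coneToSusp S.s f) (S.suspInl A) (S.inl_coneToSusp f)

lemma inl_rot (f : A ⟶ B) : S.inl (S.inl f (terminal.from A)) (terminal.from B) ≫ S.rot f =
    coneToSusp S.s f :=
  S.inl_cyDesc _ _ _

/-- Attaching a cone to the end `B` of `c(f)` amounts, by glueing, to replacing that end by a point,
which turns `c(f)` into `Σ A`. The remaining trivial cylinder on the point collapses. -/
lemma rot_mem (f : A ⟶ B) : S.E (S.rot f) := by
  have H : S.E (S.cyMap (f := 𝟙 B) (g := terminal.from B) (f' := 𝟙 (⊤_ D)) (g' := 𝟙 (⊤_ D))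
      (terminal.from B) (terminal.from B) (𝟙 _) (terminal.hom_ext _ _) (terminal.hom_ext _ _)) :=
    S.of_comp_right (S.inr_mem _ _ (S.id_mem _)) (by
      rw [inr_cyMap, Category.id_comp]
      exact S.inr_mem _ _ (S.id_mem _))
  have h₁ := S.cy_inl_mem (f := f) (g := terminal.from A) (f' := terminal.from A)
    (g' := terminal.from A) (𝟙 A) (terminal.from B) (𝟙 _) (terminal.from B) (𝟙 _)
    (terminal.hom_ext _ _) (terminal.hom_ext _ _) (terminal.hom_ext _ _) (terminal.hom_ext _ _)
    (S.id_mem _) (S.id_mem _) H (Category.id_comp _).symm (Category.id_comp _).symm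
    (S.inl_coneToSusp f)
  have h₂ := S.comp_mem _ _ h₁ (S.cyDesc_id_right_mem (S.suspInl A))
  have e : S.cyMap (terminal.from B) (coneToSusp S.s f) (𝟙 _) (S.inl_coneToSusp f)
      (terminal.hom_ext _ _) ≫ S.cyDesc (𝟙 _) (S.suspInl A)
        ((Category.comp_id _).trans (Category.id_comp _).symm) = S.rot f :=
    (S.cyMap_cyDesc _ _ _ _ _ _ _ _).trans
      (S.cyDesc_congr (Category.comp_id _) (Category.id_comp _))
  rw [← e]
  exact h₂

lemma inl_coneMap {f : A ⟶ B} {f' : A' ⟶ B'} (x : A ⟶ A') (y : B ⟶ B') (h : f ≫ y = x ≫ f') :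
    S.inl f (terminal.from A) ≫ coneMap x y h = y ≫ S.inl f' (terminal.from A') :=
  S.inl_cyMap _ _ _ _ _

lemma suspInl_map (x : A ⟶ A') : S.suspInl A ≫ (susp S.s).map x = S.suspInl A' :=
  (S.inl_cyMap (f := terminal.from A) (g := terminal.from A) (f' := terminal.from A')
    (g' := terminal.from A') x (𝟙 _) (𝟙 _) (terminal.hom_ext _ _) (terminal.hom_ext _ _)).trans
      (Category.id_comp _)

lemma coneMap_rot {f : A ⟶ B} {f' : A' ⟶ B'} (x : A ⟶ A') (y : B ⟶ B') (h : f ≫ y = x ≫ f') :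
    coneMap (S := S) y (coneMap x y h) (S.inl_coneMap x y h) ≫ S.rot f' =
      S.rot f ≫ (susp S.s).map x := by
  refine (S.cyMap_cyDesc _ _ _ _ _ _ _ _).trans (Eq.trans ?_ (S.cyDesc_comp _ _ _ _).symm)
  exact S.cyDesc_congr (coneMap_coneToSusp _ _ _)
    ((Category.id_comp _).trans (S.suspInl_map x).symm)

variable (B) in
/-- The suspension of `B`, as the union of two cones on `B`. -/
abbrev doubleCone : D := S.cy (S.inl (𝟙 B) (terminal.from B)) (S.inl (𝟙 B) (terminal.from B))

variable (B) in
/-- The collapse of the second cone. -/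
def pinchLeft : S.doubleCone B ⟶ (susp S.s).obj B :=
  S.cyDesc (coneToSusp S.s (𝟙 B)) (terminal.from _ ≫ S.suspInl B) (by
    rw [inl_coneToSusp, terminal.comp_from_assoc])

variable (B) in
/-- The collapse of the first cone. -/
def pinchRight : S.doubleCone B ⟶ (susp S.s).obj B :=
  S.cyDesc (terminal.from _ ≫ S.suspInl B) (coneToSusp S.s (𝟙 B)) (by
    rw [inl_coneToSusp, terminal.comp_from_assoc])

variable (B) in
/-- The collapse of the second cone to a point. -/
def doubleConeToCone : S.doubleCone B ⟶ cone S.s (S.inl (𝟙 B) (terminal.from B)) :=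
  S.cyMap (𝟙 _) (𝟙 _) (terminal.from _) ((Category.comp_id _).trans (Category.id_comp _).symm)
    (terminal.hom_ext _ _)

lemma doubleConeToCone_mem : S.E (S.doubleConeToCone B) :=
  S.cyMap_mem _ _ _ _ _ (S.id_mem _) (S.id_mem _) (S.cy_id_terminal_mem B)

lemma doubleConeToCone_rot : S.doubleConeToCone B ≫ S.rot (𝟙 B) = S.pinchLeft B := by
  refine (S.cyMap_cyDesc _ _ _ _ _ _ _ _).trans ?_
  exact S.cyDesc_congr (Category.id_comp _) rfl

lemma pinchLeft_mem : S.E (S.pinchLeft B) := by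
  rw [← doubleConeToCone_rot]
  exact S.comp_mem _ _ S.doubleConeToCone_mem (S.rot_mem _)

/-- Contracting the common base of the first cone makes two consecutive cylinders, and the two maps
are their two collapses. Compared with `doubleConeToCone_rot`, this says that `pinchLeft` and
`pinchRight` differ exactly as `rot` and the projection of the next cone do: this is the sign of the
rotation. -/
lemma Q_pinchRight : S.E.Q.map (S.pinchRight B) =
    S.E.Q.map (S.doubleConeToCone B ≫ coneToSusp S.s (S.inl (𝟙 B) (terminal.from B))) := by
  let x : S.doubleCone B ⟶ S.cy (terminal.from B) (S.inl (𝟙 B) (terminal.from B)) :=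
    S.cyMap (𝟙 _) (terminal.from _) (𝟙 _) (terminal.hom_ext _ _)
      ((Category.comp_id _).trans (Category.id_comp _).symm)
  have h₁ : x ≫ S.collapseLeft (terminal.from B) (terminal.from B) = S.pinchRight B := by
    refine (S.cyMap_cyDesc _ _ _ _ _ _ _ _).trans ?_
    exact S.cyDesc_congr rfl (Category.id_comp _)
  have h₂ : x ≫ S.collapseRight (terminal.from B) (terminal.from B) =
      S.doubleConeToCone B ≫ coneToSusp S.s (S.inl (𝟙 B) (terminal.from B)) := by
    refine (S.cyMap_comp _ _ _ _ _ _ _ _ _ _).trans (Eq.trans ?_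
      (S.cyMap_comp _ _ _ _ _ _ _ _ _ _).symm)
    exact S.cyMap_congr rfl (terminal.hom_ext _ _) (terminal.hom_ext _ _)
  refine (congrArg S.E.Q.map h₁).symm.trans (Eq.trans ?_ (congrArg S.E.Q.map h₂))
  exact (S.E.Q.map_comp _ _).trans ((congrArg (S.E.Q.map x ≫ ·) (S.Q_collapse_eq _ _).symm).trans
    (S.E.Q.map_comp _ _).symm)

lemma pinchRight_mem : S.E (S.pinchRight B) := by
  rw [mem_iff_isIso, Q_pinchRight, ← mem_iff_isIso]
  refine S.comp_mem _ _ S.doubleConeToCone_mem ?_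
  exact S.cyMap_mem _ _ _ _ _ (S.id_mem _) (S.cy_id_terminal_mem B) (S.id_mem _)

variable (B) in
/-- The pinch of a suspension to a wedge of two copies of it. -/
def pinch : S.doubleCone B ⟶ S.cy (S.suspInl B) (S.suspInl B) :=
  S.cyMap (terminal.from _) (coneToSusp S.s (𝟙 B)) (coneToSusp S.s (𝟙 B)) (S.inl_coneToSusp _)
    (S.inl_coneToSusp _)

variable (B) in
lemma suspInl_terminal :
    S.suspInl B ≫ 𝟙 _ = S.suspInl B ≫ terminal.from ((susp S.s).obj B) ≫ S.suspInl B := by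
  rw [terminal.comp_from_assoc, terminal.hom_ext (terminal.from (⊤_ D)) (𝟙 _)]
  exact (Category.comp_id _).trans (Category.id_comp _).symm

variable (B) in
lemma pinch_left :
    S.pinch B ≫ S.cyDesc (𝟙 _) (terminal.from _ ≫ S.suspInl B) (S.suspInl_terminal B) =
      S.pinchLeft B :=
  (S.cyMap_cyDesc _ _ _ _ _ _ _ _).trans (S.cyDesc_congr (Category.comp_id _)
    (terminal.comp_from_assoc _ _))

variable (B) in
lemma pinch_right :
    S.pinch B ≫ S.cyDesc (terminal.from _ ≫ S.suspInl B) (𝟙 _) (S.suspInl_terminal B).symm =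
      S.pinchRight B :=
  (S.cyMap_cyDesc _ _ _ _ _ _ _ _).trans (S.cyDesc_congr (terminal.comp_from_assoc _ _)
    (Category.comp_id _))

variable (B) in
-- Folding identifies the two cones, so the composite factors through one acyclic cone. It becomes
-- the relation `1 + (-1) = 0`.
lemma pinch_fold : S.pinch B ≫ S.cyDesc (𝟙 _) (𝟙 _) rfl =
    S.cyDesc (f := S.inl (𝟙 B) (terminal.from B)) (g := S.inl (𝟙 B) (terminal.from B)) (𝟙 _) (𝟙 _) rfl ≫
      coneToSusp S.s (𝟙 B) :=
  (S.cyMap_cyDesc _ _ _ _ _ _ _ _).trans (Eq.trans (S.cyDesc_congr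
    ((Category.comp_id _).trans (Category.id_comp _).symm)
    ((Category.comp_id _).trans (Category.id_comp _).symm)) (S.cyDesc_comp _ _ _ _).symm)

/-- The morphism of double cones induced by a morphism. -/
def doubleConeMap (x : A ⟶ B) : S.doubleCone A ⟶ S.doubleCone B :=
  S.cyMap x (coneMap x x ((Category.id_comp _).trans (Category.comp_id _).symm))
    (coneMap x x ((Category.id_comp _).trans (Category.comp_id _).symm)) (S.inl_coneMap _ _ _) (S.inl_coneMap _ _ _)

lemma doubleConeMap_pinch (x : A ⟶ B) : S.doubleConeMap x ≫ S.pinch B = S.pinch A ≫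
    S.cyMap (𝟙 _) ((susp S.s).map x) ((susp S.s).map x)
      ((S.suspInl_map x).trans (Category.id_comp _).symm)
      ((S.suspInl_map x).trans (Category.id_comp _).symm) :=
  (S.cyMap_comp _ _ _ _ _ _ _ _ _ _).trans (Eq.trans (S.cyMap_congr (terminal.hom_ext _ _)
    (coneMap_coneToSusp _ _ _) (coneMap_coneToSusp _ _ _)) (S.cyMap_comp _ _ _ _ _ _ _ _ _ _).symm)

lemma doubleConeMap_pinchLeft (x : A ⟶ B) :
    S.doubleConeMap x ≫ S.pinchLeft B = S.pinchLeft A ≫ (susp S.s).map x := by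
  refine (S.cyMap_cyDesc _ _ _ _ _ _ _ _).trans (Eq.trans ?_ (S.cyDesc_comp _ _ _ _).symm)
  refine S.cyDesc_congr (coneMap_coneToSusp _ _ _) ?_
  rw [terminal.comp_from_assoc, Category.assoc]
  exact congrArg (terminal.from _ ≫ ·) (S.suspInl_map x).symm

lemma doubleConeMap_pinchRight (x : A ⟶ B) :
    S.doubleConeMap x ≫ S.pinchRight B = S.pinchRight A ≫ (susp S.s).map x := by
  refine (S.cyMap_cyDesc _ _ _ _ _ _ _ _).trans (Eq.trans ?_ (S.cyDesc_comp _ _ _ _).symm)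
  refine S.cyDesc_congr ?_ (coneMap_coneToSusp _ _ _)
  rw [terminal.comp_from_assoc, Category.assoc]
  exact congrArg (terminal.from _ ≫ ·) (S.suspInl_map x).symm

end Rotation

end SimplicialDescentCategory

/-! ### Additive structures from natural comultiplications -/

section Comultiplication

variable {C : Type u} [Category.{v} C] [HasZeroMorphisms C]

/-- In a category whose objects have natural counital comultiplications, coproducts are
biproducts. -/
lemma hasBinaryBiproducts_of_comul [HasBinaryCoproducts C] (δ : ∀ X : C, X ⟶ X ⨿ X)
    (hl : ∀ X, δ X ≫ coprod.desc (𝟙 X) 0 = 𝟙 X) (hr : ∀ X, δ X ≫ coprod.desc 0 (𝟙 X) = 𝟙 X)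
    (hδ : ∀ {X Y : C} (f : X ⟶ Y), f ≫ δ Y = δ X ≫ coprod.map f f) : HasBinaryBiproducts C where
  has_binary_biproduct X Y := by
    let p : X ⨿ Y ⟶ X := coprod.desc (𝟙 X) 0
    let q : X ⨿ Y ⟶ Y := coprod.desc 0 (𝟙 Y)
    have hp : coprod.inl ≫ p = 𝟙 X := coprod.inl_desc _ _
    have hp' : coprod.inr ≫ p = 0 := coprod.inr_desc _ _
    have hq : coprod.inl ≫ q = 0 := coprod.inl_desc _ _
    have hq' : coprod.inr ≫ q = 𝟙 Y := coprod.inr_desc _ _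
    have h₁ : ∀ {A B : C} (a : A ⟶ B), coprod.map a (0 : A ⟶ Y) = coprod.desc (𝟙 A) 0 ≫ a ≫ coprod.inl := by
      intro A B a
      ext <;> simp [coprod.inl_desc, coprod.inr_desc]
    have h₂ : ∀ {A B : C} (a : A ⟶ B), coprod.map (0 : A ⟶ X) a = coprod.desc 0 (𝟙 A) ≫ a ≫ coprod.inr := by
      intro A B a
      ext <;> simp [coprod.inl_desc, coprod.inr_desc]
    -- Naturality of `δ` along the two inclusions reduces this to the counit laws for `X` and `Y`.
    -- By naturality again, every morphism to `X ⨿ Y` is then recovered from its two projections,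
    -- which is uniqueness for the product.
    have h : δ (X ⨿ Y) ≫ coprod.map p q = 𝟙 _ := by
      ext
      · rw [reassoc_of% (hδ coprod.inl), coprod.map_map, hp, hq, h₁, reassoc_of% (hl X)]
        simp
      · rw [reassoc_of% (hδ coprod.inr), coprod.map_map, hp', hq', h₂, reassoc_of% (hr Y)]
        simp
    have hm : ∀ {T : C} (m : T ⟶ X ⨿ Y), m = δ T ≫ coprod.map (m ≫ p) (m ≫ q) := by
      intro T m
      rw [← coprod.map_map, ← reassoc_of% (hδ m), h, Category.comp_id]
    refine HasBinaryBiproduct.mk ⟨BinaryBicone.mk (X ⨿ Y) p q coprod.inl coprod.inr hp hq hp' hq', ?_, ?_⟩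
    · refine BinaryFan.IsLimit.mk _ (fun {T} a b => δ T ≫ coprod.map a b) ?_ ?_ ?_
      · intro T a b
        change (δ T ≫ coprod.map a b) ≫ p = a
        rw [Category.assoc, coprod.map_desc]
        have := congrArg (· ≫ a) (hl T)
        simpa using this
      · intro T a b
        change (δ T ≫ coprod.map a b) ≫ q = b
        rw [Category.assoc, coprod.map_desc]
        have := congrArg (· ≫ b) (hr T)
        simpa using this
      · intro T a b m ha hb
        subst ha hb
        exact hm m
    · exact BinaryCofan.IsColimit.mk _ (fun a b => coprod.desc a b) (fun a b => coprod.inl_desc a b)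
        (fun a b => coprod.inr_desc a b) (fun a b m ha hb => coprod.hom_ext
          (ha.trans (coprod.inl_desc a b).symm) (hb.trans (coprod.inr_desc a b).symm))

open SemiadditiveOfBinaryBiproducts in
/-- A category with binary biproducts whose identities have opposites is preadditive. -/
@[reducible]
def preadditiveOfNeg [HasBinaryBiproducts C] (n : ∀ X : C, X ⟶ X)
    (hn : ∀ X, biprod.lift (𝟙 X) (n X) ≫ biprod.desc (𝟙 X) (𝟙 X) = 0) : Preadditive C where
  homGroup X Y :=
    { addCommMonoidHomOfHasBinaryBiproducts X Y with
      neg f := f ≫ n Y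
      zsmul := letI := addCommMonoidHomOfHasBinaryBiproducts X Y
        letI : Neg (X ⟶ Y) := ⟨fun f => f ≫ n Y⟩
        zsmulRec
      neg_add_cancel f := by
        letI := addCommMonoidHomOfHasBinaryBiproducts X Y
        change f ≫ n Y + f = 0
        rw [add_comm, add_eq_left_addition]
        have h : biprod.lift f (f ≫ n Y) = f ≫ biprod.lift (𝟙 Y) (n Y) := by ext <;> simp
        rw [h, Category.assoc, hn, comp_zero] }
  add_comp _ _ _ f f' g := add_comp f f' g
  comp_add _ _ _ f g g' := comp_add f g g'

end Comultiplication

namespace SimplicialDescentCategory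

variable {D : Type u} [Category.{v} D] [HasFiniteCoproducts D] [HasTerminal D]
  (S : SimplicialDescentCategory D)

/-! ### Initial and final objects and coproducts of the homotopy category -/

lemma Q_hom_ext_terminal {A : D} (a b : S.E.Q.obj A ⟶ S.E.Q.obj (⊤_ D)) : a = b := by
  have h : ∀ a : S.E.Q.obj A ⟶ S.E.Q.obj (⊤_ D), a = S.E.Q.map (terminal.from A) := fun a => by
    obtain ⟨V, k, v, hv, ha⟩ := S.exists_fraction a
    have e : v ≫ terminal.from V = 𝟙 _ := terminal.hom_ext _ _
    have e' : k ≫ terminal.from V = terminal.from A := terminal.hom_ext _ _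
    rw [← e', Functor.map_comp, ← ha, Category.assoc, ← Functor.map_comp, e]
    simp
  rw [h a, h b]

/-- The image of the final object is final in the homotopy category. -/
def isTerminalQ : IsTerminal (S.E.Q.obj (⊤_ D)) :=
  IsTerminal.ofUniqueHom
    (fun X => eqToHom (S.exists_Q_obj X).choose_spec.symm ≫ S.E.Q.map (terminal.from _))
    (fun X m => by
      rw [← cancel_epi (eqToHom (S.exists_Q_obj X).choose_spec)]
      exact S.Q_hom_ext_terminal _ _)

lemma Q_hom_ext_initial {A : D} (a b : S.E.Q.obj (⊥_ D) ⟶ S.E.Q.obj A) : a = b := by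
  have h : ∀ a : S.E.Q.obj (⊥_ D) ⟶ S.E.Q.obj A, a = S.E.Q.map (initial.to A) := fun a => by
    obtain ⟨V, k, v, hv, ha⟩ := S.exists_fraction a
    have := S.isIso_Q hv
    rw [← cancel_mono (S.E.Q.map v), ha, ← Functor.map_comp]
    exact congrArg _ (initial.hom_ext _ _)
  rw [h a, h b]

/-- The image of the initial object is initial in the homotopy category. -/
def isInitialQ : IsInitial (S.E.Q.obj (⊥_ D)) :=
  IsInitial.ofUniqueHom
    (fun X => S.E.Q.map (initial.to _) ≫ eqToHom (S.exists_Q_obj X).choose_spec)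
    (fun X m => by
      rw [← cancel_mono (eqToHom (S.exists_Q_obj X).choose_spec.symm)]
      exact S.Q_hom_ext_initial _ _)

variable {A B V W P P' T : D}

variable {S} in
/-- The morphism from a coproduct given by a cospan and a morphism to its base. -/
def Cospan.descLeft (c : S.Cospan A W) (m : P ⟶ W) : S.E.Q.obj (A ⨿ P) ⟶ S.E.Q.obj W :=
  let _ := S.isIso_Q c.mem
  S.E.Q.map (coprod.desc c.k (m ≫ c.v)) ≫ CategoryTheory.inv (S.E.Q.map c.v)

/-- With `m` fixed, the morphism built from a cospan is constant along morphisms of cospans, hence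
along the zigzag that joins `k` to `k'`. This is what makes coproducts of `D` have unique
factorizations in the homotopy category. -/
lemma Q_coprod_desc_eq {k k' : A ⟶ W} (h : S.E.Q.map k = S.E.Q.map k') (m : P ⟶ W) :
    S.E.Q.map (coprod.desc k m) = S.E.Q.map (coprod.desc k' m) := by
  have h₁ : ∀ c c' : S.Cospan A W, c.Rel c' → c.descLeft m = c'.descLeft m := by
    rintro c c' ⟨t, hk, hv⟩
    have := S.isIso_Q c.mem
    have := S.isIso_Q c'.mem
    dsimp only [Cospan.descLeft]
    have e : coprod.desc c'.k (m ≫ c'.v) = coprod.desc c.k (m ≫ c.v) ≫ t := by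
      rw [coprod.desc_comp, hk, Category.assoc, hv]
    rw [IsIso.eq_comp_inv, Category.assoc, e, Functor.map_comp]
    congr 1
    rw [IsIso.inv_comp_eq, ← hv, Functor.map_comp]
  have h₂ := congrArg (Quot.lift (fun c : S.Cospan A W => c.descLeft m) h₁)
    (Quot.eqvGen_sound (eqvGen_of_Q_map_eq h))
  have h₃ : ∀ k : A ⟶ W, (⟨W, k, 𝟙 W, S.id_mem W⟩ : S.Cospan A W).descLeft m =
      S.E.Q.map (coprod.desc k m) := fun k => by
    have := S.isIso_Q (S.id_mem W)
    dsimp only [Cospan.descLeft]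
    rw [IsIso.comp_inv_eq, ← Functor.map_comp, Category.comp_id, Category.comp_id]
  rw [← h₃, ← h₃]
  exact h₂

lemma Q_coprod_desc_eq' {k k' : A ⟶ W} (h : S.E.Q.map k = S.E.Q.map k') (m : P ⟶ W) :
    S.E.Q.map (coprod.desc m k) = S.E.Q.map (coprod.desc m k') := by
  have e : ∀ k : A ⟶ W, coprod.desc m k = (coprod.braiding P A).hom ≫ coprod.desc k m := fun k => by
    ext <;> simp [coprod.inl_desc, coprod.inr_desc]
  rw [e, e, Functor.map_comp, Functor.map_comp, S.Q_coprod_desc_eq h]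

lemma Q_coprod_hom_ext {a b : S.E.Q.obj (A ⨿ P) ⟶ S.E.Q.obj W}
    (hl : S.E.Q.map coprod.inl ≫ a = S.E.Q.map coprod.inl ≫ b)
    (hr : S.E.Q.map coprod.inr ≫ a = S.E.Q.map coprod.inr ≫ b) : a = b := by
  obtain ⟨V, k, v, hv, ha⟩ := S.exists_fraction a
  have iv := S.isIso_Q hv
  obtain ⟨V', k', v', hv', hb⟩ := S.exists_fraction (b ≫ S.E.Q.map v)
  have iv' := S.isIso_Q hv'
  rw [← cancel_mono (S.E.Q.map v), ha, ← cancel_mono (S.E.Q.map v'), hb, ← Functor.map_comp]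
  have e₁ : S.E.Q.map (coprod.inl ≫ k ≫ v') = S.E.Q.map (coprod.inl ≫ k') := by
    simp only [Functor.map_comp]
    rw [← hb, ← ha]
    simp only [Category.assoc]
    rw [reassoc_of% hl]
  have e₂ : S.E.Q.map (coprod.inr ≫ k ≫ v') = S.E.Q.map (coprod.inr ≫ k') := by
    simp only [Functor.map_comp]
    rw [← hb, ← ha]
    simp only [Category.assoc]
    rw [reassoc_of% hr]
  have e : ∀ t : A ⨿ P ⟶ V', t = coprod.desc (coprod.inl ≫ t) (coprod.inr ≫ t) := fun t => by
    ext <;> simp [coprod.inl_desc, coprod.inr_desc]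
  rw [e (k ≫ v'), e k', S.Q_coprod_desc_eq e₁, S.Q_coprod_desc_eq' e₂]

lemma exists_Q_coprod_desc (a : S.E.Q.obj A ⟶ S.E.Q.obj W) (b : S.E.Q.obj P ⟶ S.E.Q.obj W) :
    ∃ c : S.E.Q.obj (A ⨿ P) ⟶ S.E.Q.obj W,
      S.E.Q.map coprod.inl ≫ c = a ∧ S.E.Q.map coprod.inr ≫ c = b := by
  obtain ⟨V, k, v, hv, ha⟩ := S.exists_fraction a
  have iv := S.isIso_Q hv
  obtain ⟨V', k', v', hv', hb⟩ := S.exists_fraction (b ≫ S.E.Q.map v)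
  have iv' := S.isIso_Q hv'
  refine ⟨S.E.Q.map (coprod.desc (k ≫ v') k') ≫ CategoryTheory.inv (S.E.Q.map v') ≫ CategoryTheory.inv (S.E.Q.map v),
    ?_, ?_⟩
  · rw [← Functor.map_comp_assoc, coprod.inl_desc, Functor.map_comp, ← ha]
    simp
  · rw [← Functor.map_comp_assoc, coprod.inr_desc, ← hb]
    simp

/-- The localization functor preserves binary coproducts. -/
def isColimitQ (A P : D) : IsColimit (BinaryCofan.mk (S.E.Q.map (coprod.inl : A ⟶ A ⨿ P))
    (S.E.Q.map (coprod.inr : P ⟶ A ⨿ P))) := by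
  have h : ∀ {X : S.Ho} (a : S.E.Q.obj A ⟶ X) (b : S.E.Q.obj P ⟶ X), ∃ c : S.E.Q.obj (A ⨿ P) ⟶ X,
      S.E.Q.map coprod.inl ≫ c = a ∧ S.E.Q.map coprod.inr ≫ c = b := by
    intro X a b
    obtain ⟨W, rfl⟩ := S.exists_Q_obj X
    exact S.exists_Q_coprod_desc a b
  refine BinaryCofan.IsColimit.mk _ (fun a b => (h a b).choose) (fun a b => (h a b).choose_spec.1)
    (fun a b => (h a b).choose_spec.2) ?_
  intro X a b m ha hb
  obtain ⟨W, rfl⟩ := S.exists_Q_obj X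
  exact S.Q_coprod_hom_ext (ha.trans (h a b).choose_spec.1.symm) (hb.trans (h a b).choose_spec.2.symm)

instance : HasBinaryCoproducts S.Ho :=
  have : ∀ {X Y : S.Ho}, HasColimit (pair X Y) := fun {X Y} => by
    obtain ⟨A, rfl⟩ := S.exists_Q_obj X
    obtain ⟨P, rfl⟩ := S.exists_Q_obj Y
    exact ⟨⟨⟨_, S.isColimitQ A P⟩⟩⟩
  hasBinaryCoproducts_of_hasColimit_pair _

end SimplicialDescentCategory

namespace SimplicialDescentCategory

variable {D : Type u} [Category.{v} D] [HasFiniteCoproducts D] [HasTerminal D]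
  {S : SimplicialDescentCategory D}

/-! ### The zero object -/

/-- The suspension of the initial object is `* ⨿ *`, and it is initial because an equivalence
preserves initial objects. The final object is a retract of it, hence initial too. -/
lemma isZero_Q_terminal (hS : S.IsStable) : IsZero (S.E.Q.obj (⊤_ D)) := by
  have : S.hoSusp.IsEquivalence := hS
  have i := S.isIso_Q (S.cyDesc_coprod_mem initialIsInitial (terminal.from (⊥_ D))
    (terminal.from (⊥_ D)))
  let h : IsInitial (S.E.Q.obj ((⊤_ D) ⨿ ⊤_ D)) := (S.isInitialQ.isInitialObj S.hoSusp).ofIso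
    (S.hoSuspFac.app (⊥_ D) ≪≫ @asIso _ _ _ _ _ i)
  have e : S.E.Q.map (coprod.inl : ⊤_ D ⟶ (⊤_ D) ⨿ ⊤_ D) ≫ S.E.Q.map (terminal.from _) = 𝟙 _ :=
    S.Q_hom_ext_terminal _ _
  refine IsZero.of_iso ?_ (S.isTerminalQ.uniqueUpToIso S.isTerminalQ)
  refine ⟨fun X => ⟨⟨⟨S.E.Q.map coprod.inl ≫ h.to X⟩, fun f => ?_⟩⟩,
    fun X => ⟨⟨⟨S.isTerminalQ.from X⟩, fun f => S.isTerminalQ.hom_ext _ _⟩⟩⟩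
  rw [← Category.id_comp f, ← e, Category.assoc]
  exact congrArg (S.E.Q.map coprod.inl ≫ ·) (h.hom_ext _ _)

lemma hasZeroObject (hS : S.IsStable) : HasZeroObject S.Ho := ⟨⟨_, isZero_Q_terminal hS⟩⟩

lemma initial_terminal_mem (hS : S.IsStable) : S.E (initial.to (⊤_ D)) :=
  S.saturated _ (by
    rw [S.isInitialQ.hom_ext (S.E.Q.map _)
      (S.isInitialQ.uniqueUpToIso (isZero_Q_terminal hS).isInitial).hom]
    infer_instance)

variable {T P P' A B : D}

/-- A homotopy pushout along an object equivalent to the initial object is a coproduct in the homotopy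
category. -/
def isColimitQcy (a : T ⟶ P) (b : T ⟶ P') (hT : S.E (initial.to T)) :
    IsColimit (BinaryCofan.mk (S.E.Q.map (S.inl a b)) (S.E.Q.map (S.inr a b))) := by
  have h₁ := S.cyDesc_coprod_mem initialIsInitial (initial.to P) (initial.to P')
  have h₂ : S.E (S.cyMap (f := initial.to P) (g := initial.to P') (f' := a) (g' := b)
      (initial.to T) (𝟙 P) (𝟙 P') (initial.hom_ext _ _) (initial.hom_ext _ _)) :=
    S.cyMap_mem _ _ _ _ _ hT (S.id_mem _) (S.id_mem _)
  have i₁ := S.isIso_Q h₁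
  have i₂ := S.isIso_Q h₂
  refine IsColimit.ofIsoColimit (S.isColimitQ P P')
    (BinaryCofan.ext ((@asIso _ _ _ _ _ i₁).symm ≪≫ @asIso _ _ _ _ _ i₂) ?_ ?_)
  · change S.E.Q.map coprod.inl ≫ CategoryTheory.inv (S.E.Q.map _) ≫ S.E.Q.map _ = S.E.Q.map (S.inl a b)
    refine (congrArg (fun t => S.E.Q.map t ≫ CategoryTheory.inv (S.E.Q.map _) ≫ S.E.Q.map _)
      (S.inl_cyDesc (f := initial.to P) (g := initial.to P') coprod.inl coprod.inr
        (initialIsInitial.hom_ext _ _))).symm.trans ?_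
    rw [Functor.map_comp, Category.assoc, IsIso.hom_inv_id_assoc, ← Functor.map_comp, inl_cyMap,
      Category.id_comp]
  · change S.E.Q.map coprod.inr ≫ CategoryTheory.inv (S.E.Q.map _) ≫ S.E.Q.map _ = S.E.Q.map (S.inr a b)
    refine (congrArg (fun t => S.E.Q.map t ≫ CategoryTheory.inv (S.E.Q.map _) ≫ S.E.Q.map _)
      (S.inr_cyDesc (f := initial.to P) (g := initial.to P') coprod.inl coprod.inr
        (initialIsInitial.hom_ext _ _))).symm.trans ?_
    rw [Functor.map_comp, Category.assoc, IsIso.hom_inv_id_assoc, ← Functor.map_comp, inr_cyMap,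
      Category.id_comp]

lemma Q_cy_hom_ext (hS : S.IsStable) {a : ⊤_ D ⟶ P} {b : ⊤_ D ⟶ P'} {X : S.Ho}
    {t t' : S.E.Q.obj (S.cy a b) ⟶ X}
    (hl : S.E.Q.map (S.inl a b) ≫ t = S.E.Q.map (S.inl a b) ≫ t')
    (hr : S.E.Q.map (S.inr a b) ≫ t = S.E.Q.map (S.inr a b) ≫ t') : t = t' :=
  BinaryCofan.IsColimit.hom_ext (isColimitQcy a b (initial_terminal_mem hS)) hl hr

/-! ### The comultiplication of a suspension -/

lemma Q_terminal_comp [HasZeroMorphisms S.Ho] (hS : S.IsStable) (x : ⊤_ D ⟶ B) :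
    S.E.Q.map (terminal.from A ≫ x) = 0 := by
  rw [Functor.map_comp]
  rw [(isZero_Q_terminal hS).eq_of_src (S.E.Q.map x) 0, comp_zero]

variable (S B) in
/-- The pinch of a suspension, in the homotopy category. -/
def hoPinch : S.E.Q.obj ((susp S.s).obj B) ⟶ S.E.Q.obj (S.cy (S.suspInl B) (S.suspInl B)) :=
  have := S.isIso_Q (S.pinchLeft_mem (B := B))
  CategoryTheory.inv (S.E.Q.map (S.pinchLeft B)) ≫ S.E.Q.map (S.pinch B)

variable (S B) in
/-- The automorphism of a suspension that will be the multiplication by `-1`. -/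
def hoNeg : S.E.Q.obj ((susp S.s).obj B) ⟶ S.E.Q.obj ((susp S.s).obj B) :=
  have := S.isIso_Q (S.pinchLeft_mem (B := B))
  CategoryTheory.inv (S.E.Q.map (S.pinchLeft B)) ≫ S.E.Q.map (S.pinchRight B)

instance : IsIso (S.hoNeg B) := by
  have := S.isIso_Q (S.pinchLeft_mem (B := B))
  have := S.isIso_Q (S.pinchRight_mem (B := B))
  dsimp only [hoNeg]
  infer_instance

lemma pinchLeft_hoNeg : S.E.Q.map (S.pinchLeft B) ≫ S.hoNeg B = S.E.Q.map (S.pinchRight B) := by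
  have := S.isIso_Q (S.pinchLeft_mem (B := B))
  exact IsIso.hom_inv_id_assoc _ _

lemma hoPinch_left : S.hoPinch B ≫ S.E.Q.map
    (S.cyDesc (𝟙 _) (terminal.from _ ≫ S.suspInl B) (S.suspInl_terminal B)) = 𝟙 _ := by
  have := S.isIso_Q (S.pinchLeft_mem (B := B))
  dsimp only [hoPinch]
  rw [Category.assoc, ← Functor.map_comp, pinch_left, IsIso.inv_hom_id]

lemma hoPinch_right : S.hoPinch B ≫ S.E.Q.map
    (S.cyDesc (terminal.from _ ≫ S.suspInl B) (𝟙 _) (S.suspInl_terminal B).symm) = S.hoNeg B := by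
  have := S.isIso_Q (S.pinchLeft_mem (B := B))
  dsimp only [hoPinch, hoNeg]
  rw [Category.assoc, ← Functor.map_comp, pinch_right]

lemma hoPinch_fold [HasZeroMorphisms S.Ho] (hS : S.IsStable) :
    S.hoPinch B ≫ S.E.Q.map (S.cyDesc (𝟙 _) (𝟙 _) rfl) = 0 := by
  have hz : IsZero (S.E.Q.obj (cone S.s (𝟙 B))) :=
    have := S.isIso_Q (S.cy_id_terminal_mem B)
    (isZero_Q_terminal hS).of_iso (asIso (S.E.Q.map (terminal.from (S.cy (𝟙 B) (terminal.from B)))))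
  dsimp only [hoPinch]
  rw [Category.assoc, ← Functor.map_comp, pinch_fold, Functor.map_comp]
  have e : S.E.Q.map (coneToSusp S.s (𝟙 B)) = 0 := hz.eq_of_src _ _
  rw [e, comp_zero, comp_zero]

lemma map_hoNeg (x : A ⟶ B) : S.E.Q.map ((susp S.s).map x) ≫ S.hoNeg B =
    S.hoNeg A ≫ S.E.Q.map ((susp S.s).map x) := by
  have := S.isIso_Q (S.pinchLeft_mem (B := A))
  rw [← cancel_epi (S.E.Q.map (S.pinchLeft A)), ← Functor.map_comp_assoc, ← doubleConeMap_pinchLeft,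
    reassoc_of% S.pinchLeft_hoNeg, Functor.map_comp_assoc, pinchLeft_hoNeg, ← Functor.map_comp,
    ← Functor.map_comp, doubleConeMap_pinchRight]

lemma map_hoPinch (x : A ⟶ B) : S.E.Q.map ((susp S.s).map x) ≫ S.hoPinch B =
    S.hoPinch A ≫ S.E.Q.map (S.cyMap (𝟙 _) ((susp S.s).map x) ((susp S.s).map x)
      ((S.suspInl_map x).trans (Category.id_comp _).symm)
      ((S.suspInl_map x).trans (Category.id_comp _).symm)) := by
  have := S.isIso_Q (S.pinchLeft_mem (B := A))
  have := S.isIso_Q (S.pinchLeft_mem (B := B))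
  dsimp only [hoPinch]
  rw [← cancel_epi (S.E.Q.map (S.pinchLeft A)), ← Functor.map_comp_assoc, ← doubleConeMap_pinchLeft,
    Functor.map_comp_assoc, IsIso.hom_inv_id_assoc, Category.assoc, IsIso.hom_inv_id_assoc,
    ← Functor.map_comp, ← Functor.map_comp, doubleConeMap_pinch]

/-! ### The additive structure of the homotopy category -/

/-- The pinch is natural for strict morphisms only. Relations that pass to inverses and composites
extend from these to suspensions of all morphisms of the homotopy category. -/
lemma suspMap_induction (P : ∀ ⦃A B : D⦄, (S.E.Q.obj ((susp S.s).obj A) ⟶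
      S.E.Q.obj ((susp S.s).obj B)) → Prop)
    (map : ∀ ⦃A B : D⦄ (f : A ⟶ B), P (S.E.Q.map ((susp S.s).map f)))
    (inv : ∀ ⦃A B : D⦄ (a : S.E.Q.obj ((susp S.s).obj A) ⟶ S.E.Q.obj ((susp S.s).obj B))
      [IsIso a], P a → P (CategoryTheory.inv a))
    (comp : ∀ ⦃A B C : D⦄ (a : S.E.Q.obj ((susp S.s).obj A) ⟶ S.E.Q.obj ((susp S.s).obj B))
      (b : S.E.Q.obj ((susp S.s).obj B) ⟶ S.E.Q.obj ((susp S.s).obj C)), P a → P b → P (a ≫ b))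
    {A B : D} (a : S.E.Q.obj A ⟶ S.E.Q.obj B) : P (S.suspMap a) := by
  refine loc_induction (P := fun A B a => P (S.suspMap a)) ?_ ?_ ?_ a
  · intro A B f
    rw [suspMap_map]
    exact map f
  · intro A B w hw
    have i := S.isIso_Q (S.susp_map_mem w hw)
    have e : S.suspMap (Localization.Construction.wInv w hw) =
        CategoryTheory.inv (S.E.Q.map ((susp S.s).map w)) := by
      have h : S.E.Q.map w ≫ Localization.Construction.wInv w hw = 𝟙 _ :=
        (Localization.Construction.wIso w hw).hom_inv_id
      refine IsIso.eq_inv_of_hom_inv_id ?_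
      rw [← suspMap_map, ← suspMap_comp, h, suspMap_id]
    rw [e]
    exact inv _ (map w)
  · intro A B C a b ha hb
    rw [suspMap_comp]
    exact comp _ _ ha hb

lemma exists_iso_susp (hS : S.IsStable) (X : S.Ho) :
    ∃ A : D, Nonempty (X ≅ S.E.Q.obj ((susp S.s).obj A)) := by
  have : S.hoSusp.IsEquivalence := hS
  obtain ⟨A, hA⟩ := S.exists_Q_obj (S.hoSusp.objPreimage X)
  exact ⟨A, ⟨(S.hoSusp.objObjPreimageIso X).symm ≪≫ S.hoSusp.mapIso (eqToIso hA.symm) ≪≫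
    S.hoSuspFac.app A⟩⟩

lemma exists_suspMap_eq (hS : S.IsStable)
    (a : S.E.Q.obj ((susp S.s).obj A) ⟶ S.E.Q.obj ((susp S.s).obj B)) :
    ∃ b : S.E.Q.obj A ⟶ S.E.Q.obj B, S.suspMap b = a := by
  have : S.hoSusp.IsEquivalence := hS
  obtain ⟨b, hb⟩ := S.hoSusp.map_surjective (S.hoSuspFac.hom.app A ≫ a ≫ S.hoSuspFac.inv.app B)
  exact ⟨b, by simp [suspMap, hb]⟩

/-- By stability each object is isomorphic to a suspension and each morphism between suspensions is
the suspension of one, so the pinch provides natural comultiplications on the whole homotopy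
category. -/
lemma hasBinaryBiproducts [HasZeroMorphisms S.Ho] (hS : S.IsStable) : HasBinaryBiproducts S.Ho := by
  -- As `*` is also initial, the wedge over it is a coproduct. The inverse of `hoNeg` on the second
  -- summand is needed because the pinch composed with the second collapse is `hoNeg`, while a
  -- counit must give the identity.
  let w : ∀ B : D, S.E.Q.obj (S.cy (S.suspInl B) (S.suspInl B)) ⟶
      S.E.Q.obj ((susp S.s).obj B) ⨿ S.E.Q.obj ((susp S.s).obj B) := fun B =>
    (isColimitQcy (S.suspInl B) (S.suspInl B) (initial_terminal_mem hS)).desc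
      (BinaryCofan.mk coprod.inl (CategoryTheory.inv (S.hoNeg B) ≫ coprod.inr))
  have wl : ∀ B, S.E.Q.map (S.inl _ _) ≫ w B = coprod.inl := fun B =>
    (isColimitQcy (S.suspInl B) (S.suspInl B) (initial_terminal_mem hS)).fac _ ⟨WalkingPair.left⟩
  have wr : ∀ B, S.E.Q.map (S.inr _ _) ≫ w B = CategoryTheory.inv (S.hoNeg B) ≫ coprod.inr := fun B =>
    (isColimitQcy (S.suspInl B) (S.suspInl B) (initial_terminal_mem hS)).fac _ ⟨WalkingPair.right⟩
  have hl : ∀ B, S.hoPinch B ≫ w B ≫ coprod.desc (𝟙 _) 0 = 𝟙 _ := fun B => by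
    refine Eq.trans (congrArg (S.hoPinch B ≫ ·) ?_) S.hoPinch_left
    refine Q_cy_hom_ext hS ?_ ?_
    · rw [reassoc_of% wl, coprod.inl_desc, ← Functor.map_comp, inl_cyDesc]
      simp
    · rw [reassoc_of% wr, coprod.inr_desc, ← Functor.map_comp, inr_cyDesc, Q_terminal_comp hS, comp_zero]
  have hr : ∀ B, S.hoPinch B ≫ w B ≫ coprod.desc 0 (𝟙 _) = 𝟙 _ := fun B => by
    rw [← cancel_mono (S.hoNeg B), Category.id_comp, Category.assoc]
    refine Eq.trans (congrArg (S.hoPinch B ≫ ·) ?_) S.hoPinch_right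
    refine Q_cy_hom_ext hS ?_ ?_
    · rw [Category.assoc, reassoc_of% wl, coprod.inl_desc_assoc, zero_comp, ← Functor.map_comp,
        inl_cyDesc, Q_terminal_comp hS]
    · rw [Category.assoc, reassoc_of% wr, coprod.inr_desc_assoc, Category.id_comp, IsIso.inv_hom_id,
        ← Functor.map_comp, inr_cyDesc, CategoryTheory.Functor.map_id]
  have hn : ∀ {A B : D} (a : S.E.Q.obj A ⟶ S.E.Q.obj B), S.suspMap a ≫ S.hoPinch B ≫ w B =
      S.hoPinch A ≫ w A ≫ coprod.map (S.suspMap a) (S.suspMap a) := fun {A B} a => by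
    refine suspMap_induction (P := fun A B a => a ≫ S.hoPinch B ≫ w B =
      S.hoPinch A ≫ w A ≫ coprod.map a a) ?_ ?_ ?_ a
    · intro A B f
      rw [reassoc_of% S.map_hoPinch]
      congr 1
      refine Q_cy_hom_ext hS ?_ ?_
      · rw [← Functor.map_comp_assoc, inl_cyMap, Functor.map_comp_assoc, wl, reassoc_of% wl,
          coprod.inl_map]
      · rw [← Functor.map_comp_assoc, inr_cyMap, Functor.map_comp_assoc, wr, reassoc_of% wr,
          coprod.inr_map, IsIso.eq_inv_comp, ← reassoc_of% S.map_hoNeg, IsIso.hom_inv_id_assoc]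
    · intro A B a _ h
      have h' := h =≫ coprod.map (CategoryTheory.inv a) (CategoryTheory.inv a)
      simp only [Category.assoc, coprod.map_map, IsIso.hom_inv_id, coprod.map_id_id, Category.comp_id] at h'
      rw [IsIso.inv_comp_eq, h']
    · intro A B C a b ha hb
      rw [Category.assoc, hb, reassoc_of% ha, coprod.map_map]
  let δ : ∀ X : S.Ho, X ⟶ X ⨿ X := fun X =>
    let e := (exists_iso_susp hS X).choose_spec.some
    e.hom ≫ S.hoPinch _ ≫ w _ ≫ coprod.map e.inv e.inv
  refine hasBinaryBiproducts_of_comul δ ?_ ?_ ?_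
  · intro X
    let e := (exists_iso_susp hS X).choose_spec.some
    have h := hl (exists_iso_susp hS X).choose =≫ e.inv
    rw [Category.assoc, Category.assoc, coprod.desc_comp, zero_comp, Category.id_comp] at h
    change (e.hom ≫ S.hoPinch _ ≫ w _ ≫ coprod.map e.inv e.inv) ≫ _ = _
    rw [Category.assoc, Category.assoc, Category.assoc, coprod.map_desc, Category.comp_id, comp_zero, h, e.hom_inv_id]
  · intro X
    let e := (exists_iso_susp hS X).choose_spec.some
    have h := hr (exists_iso_susp hS X).choose =≫ e.inv
    rw [Category.assoc, Category.assoc, coprod.desc_comp, zero_comp, Category.id_comp] at h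
    change (e.hom ≫ S.hoPinch _ ≫ w _ ≫ coprod.map e.inv e.inv) ≫ _ = _
    rw [Category.assoc, Category.assoc, Category.assoc, coprod.map_desc, Category.comp_id, comp_zero, h, e.hom_inv_id]
  · intro X Y f
    let e := (exists_iso_susp hS X).choose_spec.some
    let e' := (exists_iso_susp hS Y).choose_spec.some
    obtain ⟨b, hb⟩ := exists_suspMap_eq hS (e.inv ≫ f ≫ e'.hom)
    have h := hn b
    rw [hb, Category.assoc, Category.assoc, e.inv_comp_eq] at h
    change f ≫ e'.hom ≫ S.hoPinch _ ≫ w _ ≫ coprod.map e'.inv e'.inv =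
      (e.hom ≫ S.hoPinch _ ≫ w _ ≫ coprod.map e.inv e.inv) ≫ _
    rw [reassoc_of% h]
    simp only [Category.assoc, coprod.map_map, e'.hom_inv_id, Category.comp_id]

/-- In terms of biproducts the pinch is the pair of `𝟙` and `hoNeg`, and its sum is the fold, which
vanishes. Hence identities of suspensions, and so of all objects, have additive inverses. -/
lemma nonempty_preadditive (hS : S.IsStable) : Nonempty (Preadditive S.Ho) := by
  have := hasZeroObject hS
  let _ := HasZeroObject.zeroMorphismsOfZeroObject (C := S.Ho)
  have := hasBinaryBiproducts hS
  have hn : ∀ B : D, biprod.lift (𝟙 _) (S.hoNeg B) ≫ biprod.desc (𝟙 _) (𝟙 _) = 0 := fun B => by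
    let r : S.E.Q.obj (S.cy (S.suspInl B) (S.suspInl B)) ⟶ _ := biprod.lift
      (S.E.Q.map (S.cyDesc (𝟙 _) (terminal.from _ ≫ S.suspInl B) (S.suspInl_terminal B)))
      (S.E.Q.map (S.cyDesc (terminal.from _ ≫ S.suspInl B) (𝟙 _) (S.suspInl_terminal B).symm))
    have hr : r ≫ biprod.desc (𝟙 _) (𝟙 _) = S.E.Q.map (S.cyDesc (𝟙 _) (𝟙 _) rfl) := by
      refine Q_cy_hom_ext hS ?_ ?_
      · have h : S.E.Q.map (S.inl _ _) ≫ r = biprod.inl := by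
          ext
          · simp only [r, Category.assoc, biprod.lift_fst, biprod.inl_fst]
            rw [← Functor.map_comp, inl_cyDesc, CategoryTheory.Functor.map_id]
          · simp only [r, Category.assoc, biprod.lift_snd, biprod.inl_snd]
            rw [← Functor.map_comp, inl_cyDesc, Q_terminal_comp hS]
        rw [reassoc_of% h, biprod.inl_desc, ← Functor.map_comp, inl_cyDesc, CategoryTheory.Functor.map_id]
      · have h : S.E.Q.map (S.inr _ _) ≫ r = biprod.inr := by
          ext
          · simp only [r, Category.assoc, biprod.lift_fst, biprod.inr_fst]
            rw [← Functor.map_comp, inr_cyDesc, Q_terminal_comp hS]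
          · simp only [r, Category.assoc, biprod.lift_snd, biprod.inr_snd]
            rw [← Functor.map_comp, inr_cyDesc, CategoryTheory.Functor.map_id]
        rw [reassoc_of% h, biprod.inr_desc, ← Functor.map_comp, inr_cyDesc, CategoryTheory.Functor.map_id]
    have h : biprod.lift (𝟙 _) (S.hoNeg B) = S.hoPinch B ≫ r := by
      ext
      · simp only [r, biprod.lift_fst, Category.assoc, hoPinch_left]
      · simp only [r, biprod.lift_snd, Category.assoc, hoPinch_right]
    rw [h, Category.assoc, hr, hoPinch_fold hS]
  refine ⟨preadditiveOfNeg (fun X => let e := (exists_iso_susp hS X).choose_spec.some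
    e.hom ≫ S.hoNeg _ ≫ e.inv) fun X => ?_⟩
  let e := (exists_iso_susp hS X).choose_spec.some
  change biprod.lift (𝟙 X) (e.hom ≫ S.hoNeg _ ≫ e.inv) ≫ _ = 0
  have h : biprod.lift (𝟙 X) (e.hom ≫ S.hoNeg _ ≫ e.inv) ≫ biprod.desc (𝟙 X) (𝟙 X) =
      e.hom ≫ (biprod.lift (𝟙 _) (S.hoNeg _) ≫ biprod.desc (𝟙 _) (𝟙 _)) ≫ e.inv := by
    have h₁ : biprod.lift (𝟙 X) (e.hom ≫ S.hoNeg _ ≫ e.inv) =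
        e.hom ≫ biprod.lift (𝟙 _) (S.hoNeg _) ≫ biprod.map e.inv e.inv := by
      ext <;> simp
    have h₂ : biprod.map e.inv e.inv ≫ biprod.desc (𝟙 X) (𝟙 X) = biprod.desc (𝟙 _) (𝟙 _) ≫ e.inv := by
      ext <;> simp
    rw [h₁, Category.assoc, Category.assoc, h₂, Category.assoc]
  rw [h, hn, zero_comp, comp_zero]

lemma hasFiniteBiproducts [Preadditive S.Ho] (hS : S.IsStable) : HasFiniteBiproducts S.Ho := by
  have := hasZeroObject hS
  have : HasFiniteCoproducts S.Ho := hasFiniteCoproducts_of_has_binary_and_initial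
  exact HasFiniteBiproducts.of_hasFiniteCoproducts

/-- For any preadditive structure the fold of the wedge is the sum of its two collapses. Composing
with the pinch gives `𝟙 + hoNeg = 0`. -/
lemma hoNeg_eq [Preadditive S.Ho] (hS : S.IsStable) : S.hoNeg B = -𝟙 _ := by
  have h : S.E.Q.map (S.cyDesc (f := S.suspInl B) (g := S.suspInl B) (𝟙 _) (𝟙 _) rfl) =
      S.E.Q.map (S.cyDesc (𝟙 _) (terminal.from _ ≫ S.suspInl B) (S.suspInl_terminal B)) +
      S.E.Q.map (S.cyDesc (terminal.from _ ≫ S.suspInl B) (𝟙 _) (S.suspInl_terminal B).symm) := by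
    refine Q_cy_hom_ext hS ?_ ?_
    · rw [Preadditive.comp_add, ← Functor.map_comp, ← Functor.map_comp, ← Functor.map_comp, inl_cyDesc,
        inl_cyDesc, inl_cyDesc, Q_terminal_comp hS, add_zero]
    · rw [Preadditive.comp_add, ← Functor.map_comp, ← Functor.map_comp, ← Functor.map_comp, inr_cyDesc,
        inr_cyDesc, inr_cyDesc, Q_terminal_comp hS, zero_add]
  rw [eq_neg_iff_add_eq_zero, add_comm, ← S.hoPinch_left, ← S.hoPinch_right, ← Preadditive.comp_add, ← h,
    hoPinch_fold hS]

/-- Rotating a cofiber sequence introduces a sign. -/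
lemma Q_coneToSusp_inl [Preadditive S.Ho] (hS : S.IsStable) (f : A ⟶ B) :
    S.E.Q.map (coneToSusp S.s (S.inl f (terminal.from A))) =
      -(S.E.Q.map (S.rot f) ≫ S.E.Q.map ((susp S.s).map f)) := by
  -- For `𝟙 B` the two sides are the two pinches of the double cone, related by `hoNeg = -𝟙`. The
  -- general case is pulled back along the morphism of arrows from `f` to `𝟙 B`.
  have h₁ : S.E.Q.map (coneToSusp S.s (S.inl (𝟙 B) (terminal.from B))) = -S.E.Q.map (S.rot (𝟙 B)) := by
    have := S.isIso_Q (S.doubleConeToCone_mem (B := B))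
    rw [← cancel_epi (S.E.Q.map (S.doubleConeToCone B)), Preadditive.comp_neg, ← Functor.map_comp,
      ← Functor.map_comp, doubleConeToCone_rot, ← Q_pinchRight, ← pinchLeft_hoNeg, hoNeg_eq hS,
      Preadditive.comp_neg, Category.comp_id]
  let x : cone S.s f ⟶ cone S.s (𝟙 B) := coneMap f (𝟙 B) rfl
  have h₂ : coneMap (S := S) (𝟙 B) x (S.inl_coneMap f (𝟙 B) rfl) ≫ coneToSusp S.s (S.inl (𝟙 B) (terminal.from B)) =
      coneToSusp S.s (S.inl f (terminal.from A)) :=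
    (coneMap_coneToSusp _ _ _).trans ((congrArg (_ ≫ ·) ((susp S.s).map_id B)).trans (Category.comp_id _))
  have h₃ := S.coneMap_rot (f := f) (f' := 𝟙 B) f (𝟙 B) rfl
  rw [← h₂, Functor.map_comp, h₁, Preadditive.comp_neg, ← Functor.map_comp, ← Functor.map_comp, ← h₃]

end SimplicialDescentCategory

/-! ### Shifts from an autoequivalence -/

section ShiftSequences

variable {C : Type u} [Category.{v} C]

/-- The sequences of objects of a category that an endofunctor relates. -/
structure SuspSeq (Φ : C ⥤ C) where
  /-- The objects of the sequence. -/
  obj : ℤ → C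
  /-- The isomorphisms between consecutive objects. -/
  iso : ∀ m n, m + 1 = n → (Φ.obj (obj m) ≅ obj n)

namespace SuspSeq

variable {Φ : C ⥤ C}

/-- Morphisms of sequences. -/
@[ext]
structure Hom (X Y : SuspSeq Φ) where
  /-- The components of the morphism. -/
  f : ∀ n, X.obj n ⟶ Y.obj n
  comm : ∀ m n h, Φ.map (f m) ≫ (Y.iso m n h).hom = (X.iso m n h).hom ≫ f n

instance : Category (SuspSeq Φ) where
  Hom := Hom
  id X := ⟨fun _ => 𝟙 _, fun _ _ _ => by simp⟩
  comp a b := ⟨fun n => a.f n ≫ b.f n, fun m n h => by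
    rw [Functor.map_comp, Category.assoc, b.comm, reassoc_of% (a.comm m n h)]⟩

lemma comp_f {X Y Z : SuspSeq Φ} (a : X ⟶ Y) (b : Y ⟶ Z) (n : ℤ) : (a ≫ b).f n = a.f n ≫ b.f n := rfl

@[ext]
lemma hom_ext {X Y : SuspSeq Φ} {a b : X ⟶ Y} (h : ∀ n, a.f n = b.f n) : a = b :=
  Hom.ext (funext h)

lemma eqToHom_f {X Y : SuspSeq Φ} (h : X = Y) (n : ℤ) :
    (eqToHom h : X ⟶ Y).f n = eqToHom (by rw [h]) := by
  subst h
  rfl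

lemma f_eqToHom {X Y : SuspSeq Φ} (a : X ⟶ Y) {m n : ℤ} (h : m = n) :
    a.f m ≫ eqToHom (by rw [h]) = eqToHom (by rw [h]) ≫ a.f n := by
  subst h
  simp

lemma map_eqToHom_iso (X : SuspSeq Φ) {m m' n n' : ℤ} (hm : m = m') (hn : n = n') (h : m + 1 = n)
    (h' : m' + 1 = n') : Φ.map (eqToHom (by rw [hm])) ≫ (X.iso m' n' h').hom =
      (X.iso m n h).hom ≫ eqToHom (by rw [hn]) := by
  subst hm hn
  simp

/-- Isomorphisms of sequences from isomorphisms of their objects. -/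
def mkIso {X Y : SuspSeq Φ} (e : ∀ n, X.obj n ≅ Y.obj n)
    (h : ∀ m n h, Φ.map (e m).hom ≫ (Y.iso m n h).hom = (X.iso m n h).hom ≫ (e n).hom) : X ≅ Y where
  hom := ⟨fun n => (e n).hom, h⟩
  inv := ⟨fun n => (e n).inv, fun m n k => by
    rw [← cancel_epi (Φ.map (e m).hom), ← Functor.map_comp_assoc, Iso.hom_inv_id,
      reassoc_of% (h m n k), Iso.hom_inv_id]
    simp⟩
  hom_inv_id := hom_ext fun n => (e n).hom_inv_id
  inv_hom_id := hom_ext fun n => (e n).inv_hom_id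

/-- The translation of sequences. -/
def translate (Φ : C ⥤ C) (k : ℤ) : SuspSeq Φ ⥤ SuspSeq Φ where
  obj X := ⟨fun n => X.obj (n + k), fun m n h => X.iso (m + k) (n + k) (by omega)⟩
  map a := ⟨fun n => a.f (n + k), fun m n h => a.comm _ _ _⟩

/-- The translations of sequences form a shift. -/
def shiftCore (Φ : C ⥤ C) : ShiftMkCore (SuspSeq Φ) ℤ where
  F := translate Φ
  zero := NatIso.ofComponents (fun X => mkIso (fun n => eqToIso (congrArg X.obj (add_zero n)))
    (fun m n h => X.map_eqToHom_iso (add_zero m) (add_zero n) _ _)) (fun a => hom_ext fun n =>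
      f_eqToHom a (add_zero n))
  add k l := NatIso.ofComponents (fun X => mkIso (fun n => eqToIso (congrArg X.obj
      (show n + (k + l) = n + l + k by omega)))
    (fun m n h => X.map_eqToHom_iso (show m + (k + l) = m + l + k by omega)
      (show n + (k + l) = n + l + k by omega) _ _)) (fun a => hom_ext fun n =>
      f_eqToHom a (show n + (k + l) = n + l + k by omega))
  assoc_hom_app k l m X := by
    refine hom_ext fun n => ?_
    rw [comp_f, comp_f, comp_f, eqToHom_f]
    -- All components of the structure isomorphisms come from equalities of integers, so coherence
    -- reduces to composing transports along `X.obj`.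
    have h : ∀ {a b c d e : ℤ} (p : a = b) (q : b = c) (r : a = d) (s : d = e) (t : e = c),
      eqToHom (congrArg X.obj p) ≫ eqToHom (congrArg X.obj q) = eqToHom (congrArg X.obj r) ≫
        eqToHom (congrArg X.obj s) ≫ eqToHom (congrArg X.obj t) := fun p q r s t => by simp
    exact h (a := n + (k + l + m)) (b := n + m + (k + l)) (c := n + m + l + k) (d := n + (k + (l + m)))
      (e := n + (l + m) + k) (by omega) (by omega) (by omega) (by omega) (by omega)
  zero_add_hom_app k X := by
    refine hom_ext fun n => ?_
    rw [comp_f, eqToHom_f]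
    have h : ∀ {a b c : ℤ} (p : a = b) (r : a = c) (s : c = b), eqToHom (congrArg X.obj p) =
      eqToHom (congrArg X.obj r) ≫ eqToHom (congrArg X.obj s) := fun p r s => by simp
    exact h (a := n + (0 + k)) (b := n + k + 0) (c := n + k) (by omega) (by omega) (by omega)
  add_zero_hom_app k X := by
    refine hom_ext fun n => ?_
    rw [comp_f, eqToHom_f]
    have h : ∀ {a b c : ℤ} (p : a = b) (r : a = c) (s : c = b), eqToHom (congrArg X.obj p) =
      eqToHom (congrArg X.obj r) ≫ eqToHom (congrArg X.obj s) := fun p r s => by simp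
    exact h (a := n + (k + 0)) (b := n + 0 + k) (c := n + k) (by omega) (by omega) (by omega)

/-- The components of index `0` of sequences. -/
def eval (Φ : C ⥤ C) : SuspSeq Φ ⥤ C where
  obj X := X.obj 0
  map a := a.f 0

/-- Consecutive components determine each other, upwards by commutation with the structure
isomorphisms and downwards by faithfulness of `Φ`. -/
lemma hom_ext_zero [Φ.Faithful] {X Y : SuspSeq Φ} {a b : X ⟶ Y} (h : a.f 0 = b.f 0) : a = b := by
  have key : ∀ m, a.f m = b.f m ↔ a.f (m + 1) = b.f (m + 1) := fun m => by
    have ha := a.comm m _ rfl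
    have hb := b.comm m _ rfl
    refine ⟨fun h => ?_, fun h => Φ.map_injective ?_⟩
    · rw [← cancel_epi (X.iso m _ rfl).hom, ← ha, ← hb, h]
    · rw [← cancel_mono (Y.iso m _ rfl).hom, ha, hb, h]
  refine hom_ext fun n => ?_
  induction n using Int.induction_on with
  | zero => exact h
  | succ n ih => exact (key _).1 ih
  | pred n ih =>
    refine (key _).2 ?_
    rw [Int.sub_add_cancel]
    exact ih

/-- The components of a morphism of sequences with given component of index `0`. -/
def extend [Φ.Full] {X Y : SuspSeq Φ} (t : X.obj 0 ⟶ Y.obj 0) (n : ℤ) :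
    X.obj n ⟶ Y.obj n :=
  match n with
  | Int.ofNat 0 => t
  | Int.ofNat (n + 1) => (X.iso (Int.ofNat n) (Int.ofNat (n + 1)) rfl).inv ≫
      Φ.map (extend t (Int.ofNat n)) ≫ (Y.iso (Int.ofNat n) (Int.ofNat (n + 1)) rfl).hom
  | Int.negSucc 0 => Φ.preimage ((X.iso (Int.negSucc 0) 0 rfl).hom ≫ t ≫
        (Y.iso (Int.negSucc 0) 0 rfl).inv)
  | Int.negSucc (n + 1) =>
      Φ.preimage ((X.iso (Int.negSucc (n + 1)) (Int.negSucc n) rfl).hom ≫ extend t (Int.negSucc n) ≫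
        (Y.iso (Int.negSucc (n + 1)) (Int.negSucc n) rfl).inv)
  termination_by n.natAbs

lemma exists_hom [Φ.Full] {X Y : SuspSeq Φ} (t : X.obj 0 ⟶ Y.obj 0) : ∃ a : X ⟶ Y, a.f 0 = t := by
  have h₀ : extend t 0 = t := by
    change extend t (Int.ofNat 0) = t
    rw [extend]
  refine ⟨⟨extend t, ?_⟩, h₀⟩
  intro m n h
  obtain rfl := h
  rcases m with m | (_ | m)
  · have h : extend t (Int.ofNat (m + 1)) = (X.iso (Int.ofNat m) (Int.ofNat (m + 1)) rfl).inv ≫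
      Φ.map (extend t (Int.ofNat m)) ≫ (Y.iso (Int.ofNat m) (Int.ofNat (m + 1)) rfl).hom := by
      rw [extend]
    exact (Iso.eq_inv_comp _).1 h |>.symm
  · have h : extend t (Int.negSucc 0) = Φ.preimage ((X.iso (Int.negSucc 0) 0 rfl).hom ≫ t ≫
        (Y.iso (Int.negSucc 0) 0 rfl).inv) := by rw [extend]
    change Φ.map (extend t (Int.negSucc 0)) ≫ (Y.iso (Int.negSucc 0) 0 rfl).hom =
      (X.iso (Int.negSucc 0) 0 rfl).hom ≫ extend t 0
    rw [h, h₀, Functor.map_preimage, Category.assoc, Category.assoc, Iso.inv_hom_id, Category.comp_id]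
  · have h : extend t (Int.negSucc (m + 1)) =
      Φ.preimage ((X.iso (Int.negSucc (m + 1)) (Int.negSucc m) rfl).hom ≫
        extend t (Int.negSucc m) ≫ (Y.iso (Int.negSucc (m + 1)) (Int.negSucc m) rfl).inv) := by
      rw [extend]
    change Φ.map (extend t (Int.negSucc (m + 1))) ≫
        (Y.iso (Int.negSucc (m + 1)) (Int.negSucc m) rfl).hom =
      (X.iso (Int.negSucc (m + 1)) (Int.negSucc m) rfl).hom ≫ extend t (Int.negSucc m)
    rw [h, Functor.map_preimage, Category.assoc, Category.assoc, Iso.inv_hom_id, Category.comp_id]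

/-- The sequence with a given object of index `0`. -/
def ofObj [Φ.IsEquivalence] (A : C) : SuspSeq Φ where
  obj
    | Int.ofNat n => n.rec A fun _ X => Φ.obj X
    | Int.negSucc n => n.rec (Φ.objPreimage A) fun _ X => Φ.objPreimage X
  iso
    | Int.ofNat n, _, rfl => Iso.refl _
    | Int.negSucc 0, _, rfl => Φ.objObjPreimageIso A
    | Int.negSucc (n + 1), _, rfl => Φ.objObjPreimageIso _

instance [Φ.IsEquivalence] : (eval Φ).IsEquivalence where
  faithful := ⟨fun h => hom_ext_zero h⟩
  full := ⟨fun t => exists_hom t⟩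
  essSurj := ⟨fun A => ⟨ofObj A, ⟨Iso.refl _⟩⟩⟩

end SuspSeq

variable (Φ : C ⥤ C) [Φ.IsEquivalence]

/-- The shift functors that an autoequivalence generates. -/
def equivShift (k : ℤ) : C ⥤ C :=
  (SuspSeq.eval Φ).inv ⋙ SuspSeq.translate Φ k ⋙ SuspSeq.eval Φ

/-- The shift that an autoequivalence generates. -/
@[reducible]
def hasShiftOfEquivalence : HasShift C ℤ :=
  letI := hasShiftMk _ ℤ (SuspSeq.shiftCore Φ)
  (Functor.FullyFaithful.ofFullyFaithful (SuspSeq.eval Φ).inv).hasShift (equivShift Φ) fun k =>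
    Functor.associator _ _ _ ≪≫ Functor.isoWhiskerLeft _ (Functor.associator _ (SuspSeq.eval Φ) _ ≪≫
      Functor.isoWhiskerLeft (SuspSeq.translate Φ k) (SuspSeq.eval Φ).asEquivalence.unitIso.symm ≪≫ Functor.rightUnitor _)

/-- The first shift functor is the given autoequivalence. -/
def shiftOneIso :
    letI := hasShiftOfEquivalence Φ
    shiftFunctor C (1 : ℤ) ≅ Φ :=
  NatIso.ofComponents (F := equivShift Φ 1) (fun A => (((SuspSeq.eval Φ).inv.obj A).iso 0 _ rfl).symm ≪≫
    Φ.mapIso ((SuspSeq.eval Φ).asEquivalence.counitIso.app A)) fun {A B} a => by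
    have h₁ := ((SuspSeq.eval Φ).inv.map a).comm 0 _ rfl
    have h₂ := (SuspSeq.eval Φ).asEquivalence.counitIso.hom.naturality a
    have h₃ := congrArg Φ.map h₂
    rw [Functor.map_comp, Functor.map_comp] at h₃
    change ((SuspSeq.eval Φ).inv.map a).f (0 + 1) ≫ (SuspSeq.iso _ 0 (0 + 1) rfl).inv ≫ Φ.map _ =
      ((SuspSeq.iso _ 0 (0 + 1) rfl).inv ≫ Φ.map _) ≫ _
    rw [Category.assoc]
    refine Eq.trans ?_ (congrArg (_ ≫ ·) h₃)
    refine (Category.assoc _ _ _).symm.trans (Eq.trans ?_ (Category.assoc _ _ _))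
    refine congrArg (· ≫ Φ.map _) ?_
    exact (Iso.comp_inv_eq _).2 (Eq.trans ((Iso.eq_inv_comp _).2 h₁.symm) (Category.assoc _ _ _).symm)

end ShiftSequences

/-! ### Fillers of morphisms of triangles. -/

open Pretriangulated

/-- Morphisms of triangles with two given components exist. -/
def HasFills {C : Type u} [Category.{v} C] [HasShift C ℤ] (T₁ T₂ : Triangle C) : Prop :=
  ∀ (a : T₁.obj₁ ⟶ T₂.obj₁) (b : T₁.obj₂ ⟶ T₂.obj₂), T₁.mor₁ ≫ b = a ≫ T₂.mor₁ →
    ∃ c : T₁.obj₃ ⟶ T₂.obj₃, T₁.mor₂ ≫ c = b ≫ T₂.mor₂ ∧ T₁.mor₃ ≫ a⟦(1 : ℤ)⟧' = c ≫ T₂.mor₃ ∧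
      (IsIso a → IsIso b → IsIso c)

lemma HasFills.of_iso {C : Type u} [Category.{v} C] [HasShift C ℤ] {T₁ T₂ T₁' T₂' : Triangle C}
    (h : HasFills T₁ T₂) (e : T₁' ≅ T₁) (e' : T₂' ≅ T₂) : HasFills T₁' T₂' := by
  intro a b w
  obtain ⟨c, h₁, h₂, h₃⟩ := h (e.inv.hom₁ ≫ a ≫ e'.hom.hom₁) (e.inv.hom₂ ≫ b ≫ e'.hom.hom₂) (by
    have c₁ := e.inv.comm₁
    have c₂ := e'.hom.comm₁
    rw [reassoc_of% c₁, reassoc_of% w, c₂]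
    simp only [Category.assoc])
  refine ⟨e.hom.hom₃ ≫ c ≫ e'.inv.hom₃, ?_, ?_, fun ha hb => ?_⟩
  · have c₁ := e.hom.comm₂
    have c₂ := e'.inv.comm₂
    rw [reassoc_of% c₁, reassoc_of% h₁, c₂]
    simp
  · have c₁ := e.hom.comm₃
    have c₂ := e'.inv.comm₃
    rw [Category.assoc, Category.assoc, ← c₂, ← reassoc_of% h₂, ← reassoc_of% c₁]
    simp only [← Functor.map_comp, Category.assoc]
    simp
  · have := h₃ inferInstance inferInstance
    infer_instance

namespace SimplicialDescentCategory

variable {D : Type u} [Category.{v} D] [HasFiniteCoproducts D] [HasTerminal D]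
  {S : SimplicialDescentCategory D}

/-! ### Cofiber triangles -/

section Triangles

variable [HasShift S.Ho ℤ] (sh : shiftFunctor S.Ho (1 : ℤ) ≅ S.hoSusp)

/-- The shift of the image of an object is the image of its suspension. -/
def shiftQ (A : D) : (S.E.Q.obj A)⟦(1 : ℤ)⟧ ≅ S.E.Q.obj ((susp S.s).obj A) :=
  sh.app (S.E.Q.obj A) ≪≫ S.hoSuspFac.app A

lemma shiftQ_naturality {A B : D} (a : S.E.Q.obj A ⟶ S.E.Q.obj B) :
    a⟦(1 : ℤ)⟧' ≫ (shiftQ sh B).hom = (shiftQ sh A).hom ≫ S.suspMap a := by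
  have h := sh.hom.naturality a
  have h' : S.hoSuspFac.hom.app A ≫ S.suspMap a = S.hoSusp.map a ≫ S.hoSuspFac.hom.app B :=
    Iso.hom_inv_id_app_assoc _ _ _
  dsimp only [shiftQ, Iso.trans_hom, Iso.app_hom]
  rw [Category.assoc, h', reassoc_of% h]

lemma shiftQ_inv_naturality {A B : D} (a : S.E.Q.obj A ⟶ S.E.Q.obj B) :
    (shiftQ sh A).inv ≫ a⟦(1 : ℤ)⟧' = S.suspMap a ≫ (shiftQ sh B).inv := by
  rw [Iso.inv_comp_eq, ← Category.assoc, Iso.eq_comp_inv]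
  exact shiftQ_naturality sh a

/-- The triangle `A ⟶ B ⟶ cone f ⟶ A⟦1⟧` of a morphism `f : A ⟶ B`. -/
abbrev coneTriangle {A B : D} (f : A ⟶ B) : Triangle S.Ho :=
  Triangle.mk (S.E.Q.map f) (S.ci f) (S.cp f ≫ (shiftQ sh A).inv)

/-- The cofiber sequences, as triangles. -/
def cofiberTriangles : Set (Triangle S.Ho) :=
  {T | S.IsCofiberSequence T.mor₁ T.mor₂ (T.mor₃ ≫ sh.hom.app T.obj₁)}

lemma mem_cofiberTriangles_iff (T : Triangle S.Ho) :
    T ∈ cofiberTriangles sh ↔ ∃ (A B : D) (f : A ⟶ B), Nonempty (T ≅ coneTriangle sh f) := by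
  have key : ∀ {A B : D} (f : A ⟶ B) (e : T.obj₁ ≅ S.E.Q.obj A) (c : T.obj₃ ⟶ S.E.Q.obj (cone S.s f)),
      (T.mor₃ ≫ sh.hom.app T.obj₁) ≫ S.hoSusp.map e.hom = c ≫ S.coneProj f ↔
        T.mor₃ ≫ e.hom⟦(1 : ℤ)⟧' = c ≫ S.cp f ≫ (shiftQ sh A).inv := fun {A B} f e c => by
    have h := sh.hom.naturality e.hom
    have h' : S.coneProj f = (S.cp f ≫ (shiftQ sh A).inv) ≫ sh.hom.app (S.E.Q.obj A) := by
      dsimp only [coneProj, shiftQ, Iso.trans_inv, Iso.app_inv]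
      rw [Category.assoc, Category.assoc, Iso.inv_hom_id_app, Category.comp_id]
    rw [Category.assoc, ← h, h', ← Category.assoc, ← Category.assoc c]
    exact cancel_mono _
  constructor
  · rintro ⟨A, B, f, e₁, e₂, e₃, h₁, h₂, h₃⟩
    exact ⟨A, B, f, ⟨Triangle.isoMk _ _ e₁ e₂ e₃ h₁ h₂ ((key f e₁ e₃.hom).1 h₃)⟩⟩
  · rintro ⟨A, B, f, ⟨e⟩⟩
    exact ⟨A, B, f, Triangle.π₁.mapIso e, Triangle.π₂.mapIso e, Triangle.π₃.mapIso e,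
      e.hom.comm₁, e.hom.comm₂, (key f (Triangle.π₁.mapIso e) e.hom.hom₃).2 e.hom.comm₃⟩

lemma coneTriangle_mem {A B : D} (f : A ⟶ B) : coneTriangle sh f ∈ cofiberTriangles sh :=
  (mem_cofiberTriangles_iff sh _).2 ⟨A, B, f, ⟨Iso.refl _⟩⟩

lemma cofiberTriangles_of_iso {T T' : Triangle S.Ho} (h : T ∈ cofiberTriangles sh)
    (e : T' ≅ T) :
    T' ∈ cofiberTriangles sh := by
  obtain ⟨A, B, f, ⟨e'⟩⟩ := (mem_cofiberTriangles_iff sh T).1 h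
  exact (mem_cofiberTriangles_iff sh T').2 ⟨A, B, f, ⟨e ≪≫ e'⟩⟩

lemma exists_cofiberTriangle {X Y : S.Ho} (f : X ⟶ Y) :
    ∃ (Z : S.Ho) (g : Y ⟶ Z) (h : Z ⟶ X⟦(1 : ℤ)⟧), Triangle.mk f g h ∈ cofiberTriangles sh := by
  obtain ⟨A, rfl⟩ := S.exists_Q_obj X
  obtain ⟨B, rfl⟩ := S.exists_Q_obj Y
  -- The numerator `k` is isomorphic to `f` as an arrow of the homotopy category, so its cone serves
  -- as a cone of `f`.
  obtain ⟨V, k, v, hv, hf⟩ := S.exists_fraction f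
  have i : IsIso (S.E.Q.map v) := S.isIso_Q hv
  refine ⟨_, S.E.Q.map v ≫ S.ci k, S.cp k ≫ (shiftQ sh A).inv,
    cofiberTriangles_of_iso sh (coneTriangle_mem sh k)
      (Triangle.isoMk _ _ (Iso.refl _) (@asIso _ _ _ _ (S.E.Q.map v) i) (Iso.refl _) ?_ ?_ ?_)⟩
  · exact hf.trans (Category.id_comp _).symm
  · exact Category.comp_id _
  · exact (congrArg (_ ≫ ·) (CategoryTheory.Functor.map_id _ _)).trans
      ((Category.comp_id _).trans (Category.id_comp _).symm)

lemma hasFills_coneTriangle {A B A' B' : D} (f : A ⟶ B) (f' : A' ⟶ B') :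
    HasFills (coneTriangle sh f) (coneTriangle sh f') := by
  intro (a : S.E.Q.obj A ⟶ S.E.Q.obj A') (b : S.E.Q.obj B ⟶ S.E.Q.obj B') w
  obtain ⟨c, hc⟩ := exists_isFill f f' a b w
  refine ⟨c, hc.inl, ?_, hc.isIso⟩
  change (S.cp f ≫ (shiftQ sh A).inv) ≫ a⟦(1 : ℤ)⟧' = c ≫ S.cp f' ≫ (shiftQ sh A').inv
  have h := hc.proj
  rw [Category.assoc, shiftQ_inv_naturality, ← Category.assoc, ← h, Category.assoc]

lemma hasFills {T₁ T₂ : Triangle S.Ho} (h₁ : T₁ ∈ cofiberTriangles sh)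
    (h₂ : T₂ ∈ cofiberTriangles sh) : HasFills T₁ T₂ := by
  obtain ⟨A, B, f, ⟨e⟩⟩ := (mem_cofiberTriangles_iff sh _).1 h₁
  obtain ⟨A', B', f', ⟨e'⟩⟩ := (mem_cofiberTriangles_iff sh _).1 h₂
  exact (hasFills_coneTriangle sh f f').of_iso e e'

lemma contractible_mem [HasZeroMorphisms S.Ho] [HasZeroObject S.Ho] (hS : S.IsStable) (X : S.Ho) :
    contractibleTriangle X ∈ cofiberTriangles sh := by
  obtain ⟨A, rfl⟩ := S.exists_Q_obj X
  have hz : IsZero (S.E.Q.obj (cone S.s (𝟙 A))) :=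
    have := S.isIso_Q (S.cy_id_terminal_mem A)
    (isZero_Q_terminal hS).of_iso (asIso (S.E.Q.map (terminal.from (S.cy (𝟙 A) (terminal.from A)))))
  refine cofiberTriangles_of_iso sh (coneTriangle_mem sh (𝟙 A)) (Triangle.isoMk _ _ (Iso.refl _)
    (Iso.refl _) ((isZero_zero _).iso hz) ?_ (hz.eq_of_tgt _ _) ((isZero_zero _).eq_of_src _ _))
  exact (congrArg (_ ≫ ·) (CategoryTheory.Functor.map_id _ _)).symm

variable [Preadditive S.Ho]

/-- The equivalence `rot f` identifies the shift with the cone of `B → c(f)`, and the sign in the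
rotated triangle is the one found in `Q_coneToSusp_inl`. -/
lemma rotate_coneTriangle_mem (hS : S.IsStable) {A B : D} (f : A ⟶ B) :
    (coneTriangle sh f).rotate ∈ cofiberTriangles sh := by
  have i := S.isIso_Q (S.rot_mem f)
  let e : (S.E.Q.obj A)⟦(1 : ℤ)⟧ ≅ S.E.Q.obj (cone S.s (S.inl f (terminal.from A))) :=
    shiftQ sh A ≪≫ (@asIso _ _ _ _ (S.E.Q.map (S.rot f)) i).symm
  refine cofiberTriangles_of_iso sh (coneTriangle_mem sh (S.inl f (terminal.from A)))
    (Triangle.isoMk _ _ (Iso.refl _) (Iso.refl _) e ?_ ?_ ?_)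
  · exact (Category.comp_id _).trans (Category.id_comp _).symm
  · change (S.cp f ≫ (shiftQ sh A).inv) ≫ (shiftQ sh A).hom ≫ CategoryTheory.inv (S.E.Q.map (S.rot f)) =
      𝟙 _ ≫ S.ci (S.inl f (terminal.from A))
    rw [Category.assoc, Iso.inv_hom_id_assoc, IsIso.comp_inv_eq, Category.id_comp, ← Functor.map_comp,
      inl_rot]
  · change (-(S.E.Q.map f)⟦(1 : ℤ)⟧') ≫ (𝟙 (S.E.Q.obj B))⟦(1 : ℤ)⟧' = ((shiftQ sh A).hom ≫ CategoryTheory.inv (S.E.Q.map (S.rot f))) ≫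
      S.cp (S.inl f (terminal.from A)) ≫ (shiftQ sh B).inv
    rw [CategoryTheory.Functor.map_id, Category.comp_id, ← Category.assoc, Iso.eq_comp_inv,
      Preadditive.neg_comp, shiftQ_naturality, suspMap_map, Category.assoc]
    refine Eq.trans ?_ (congrArg (fun t => (shiftQ sh A).hom ≫ CategoryTheory.inv (S.E.Q.map (S.rot f)) ≫ t)
      (Q_coneToSusp_inl hS f)).symm
    rw [Preadditive.comp_neg, IsIso.inv_hom_id_assoc, Preadditive.comp_neg]

lemma rotate_mem (hS : S.IsStable) {T : Triangle S.Ho} (h : T ∈ cofiberTriangles sh) :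
    T.rotate ∈ cofiberTriangles sh := by
  obtain ⟨A, B, f, ⟨e⟩⟩ := (mem_cofiberTriangles_iff sh _).1 h
  exact cofiberTriangles_of_iso sh (rotate_coneTriangle_mem sh hS f) ((rotate S.Ho).mapIso e)

/-- The first morphism is completed to some cofiber triangle. After three rotations both triangles
are cofiber sequences starting with the same morphism, up to shift and sign, so there is an
invertible filler. It descends because the shift is fully faithful, and the signs cancel. -/
lemma mem_of_rotate_mem (hS : S.IsStable) {T : Triangle S.Ho} (h : T.rotate ∈ cofiberTriangles sh) :
    T ∈ cofiberTriangles sh := by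
  obtain ⟨Z, g, k, h'⟩ := exists_cofiberTriangle sh T.mor₁
  have H := hasFills sh (rotate_mem sh hS (rotate_mem sh hS h))
    (rotate_mem sh hS (rotate_mem sh hS (rotate_mem sh hS h')))
  obtain ⟨c, h₁, h₂, h₃⟩ := H (𝟙 (T.obj₁⟦(1 : ℤ)⟧)) (𝟙 (T.obj₂⟦(1 : ℤ)⟧))
    ((Category.comp_id _).trans (Category.id_comp _).symm)
  obtain ⟨c, rfl⟩ : ∃ c' : T.obj₃ ⟶ Z, c'⟦(1 : ℤ)⟧' = c :=
    (shiftFunctor S.Ho (1 : ℤ)).map_surjective c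
  have i : IsIso ((shiftFunctor S.Ho (1 : ℤ)).map c) := h₃ (IsIso.id (T.obj₁⟦(1 : ℤ)⟧)) (IsIso.id (T.obj₂⟦(1 : ℤ)⟧))
  have i' : IsIso c := isIso_of_reflects_iso c (shiftFunctor S.Ho (1 : ℤ))
  change (-T.mor₂⟦(1 : ℤ)⟧') ≫ c⟦(1 : ℤ)⟧' = 𝟙 _ ≫ (-g⟦(1 : ℤ)⟧') at h₁
  change (-T.mor₃⟦(1 : ℤ)⟧') ≫ (𝟙 (T.obj₁⟦(1 : ℤ)⟧))⟦(1 : ℤ)⟧' = c⟦(1 : ℤ)⟧' ≫ (-k⟦(1 : ℤ)⟧') at h₂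
  refine cofiberTriangles_of_iso sh h' (Triangle.isoMk _ _ (Iso.refl _) (Iso.refl _) (@asIso _ _ _ _ c i') ?_ ?_ ?_)
  · exact (Category.comp_id _).trans (Category.id_comp _).symm
  · change T.mor₂ ≫ c = 𝟙 _ ≫ g
    apply (shiftFunctor S.Ho (1 : ℤ)).map_injective
    rw [Functor.map_comp, Category.id_comp]
    rw [Preadditive.neg_comp, Category.id_comp] at h₁
    exact neg_injective h₁
  · change T.mor₃ ≫ (𝟙 T.obj₁)⟦(1 : ℤ)⟧' = c ≫ k
    apply (shiftFunctor S.Ho (1 : ℤ)).map_injective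
    rw [Functor.map_comp, Functor.map_comp, CategoryTheory.Functor.map_id]
    rw [Preadditive.neg_comp, Preadditive.comp_neg] at h₂
    exact neg_injective h₂

variable [∀ n : ℤ, (shiftFunctor S.Ho n).Additive]

/-- The pretriangulated structure of the homotopy category. -/
@[reducible]
def pretriangulated [HasZeroObject S.Ho] (hS : S.IsStable) : Pretriangulated S.Ho where
  distinguishedTriangles := cofiberTriangles sh
  isomorphic_distinguished _ h _ e := cofiberTriangles_of_iso sh h e
  contractible_distinguished := contractible_mem sh hS
  distinguished_cocone_triangle := exists_cofiberTriangle sh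
  rotate_distinguished_triangle _ := ⟨rotate_mem sh hS, mem_of_rotate_mem sh hS⟩
  complete_distinguished_triangle_morphism _ _ h₁ h₂ a b w := by
    obtain ⟨c, hc, hc', -⟩ := hasFills sh h₁ h₂ a b w
    exact ⟨c, hc, hc'⟩

/-- The octahedron of two composable morphisms. -/
def coneOctahedron [HasZeroObject S.Ho] (hS : S.IsStable) {A B C : D} (f : A ⟶ B) (g : B ⟶ C) :
    letI := pretriangulated sh hS
    Triangulated.Octahedron (S.E.Q.map_comp f g).symm (coneTriangle_mem sh f) (coneTriangle_mem sh g)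
      (coneTriangle_mem sh (f ≫ g)) :=
  let _ := pretriangulated sh hS
  { m₁ := S.E.Q.map (S.octK f g)
    m₃ := S.E.Q.map (S.octL f g)
    comm₁ := by
      rw [← Functor.map_comp, ← Functor.map_comp]
      exact congrArg S.E.Q.map (S.inl_coneMap _ _ _)
    comm₂ := by
      have h := (isFill_coneMap (S := S) (𝟙 A) g (Category.id_comp (f ≫ g)).symm).proj
      rw [CategoryTheory.Functor.map_id, suspMap_id, Category.comp_id] at h
      exact (Category.assoc _ _ _).symm.trans (congrArg (· ≫ _) h)
    comm₃ := by
      rw [← Functor.map_comp]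
      exact congrArg S.E.Q.map ((S.inl_coneMap _ _ _).trans (Category.id_comp _))
    comm₄ := by
      have h := (isFill_coneMap (S := S) f (𝟙 C) (Category.comp_id (f ≫ g))).proj
      rw [Category.assoc, shiftQ_inv_naturality, ← Category.assoc, ← Category.assoc]
      exact congrArg (· ≫ _) h.symm
    mem := by
      have i := (S.Q_octM f g).1
      refine cofiberTriangles_of_iso sh (coneTriangle_mem sh (S.octK f g)) (Triangle.isoMk _ _ (Iso.refl _)
        (Iso.refl _) (@asIso _ _ _ _ (S.E.Q.map (S.octM f g)) i) ?_ ?_ ?_)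
      · exact (Category.comp_id _).trans (Category.id_comp _).symm
      · exact (S.Q_octM f g).2.trans (Category.id_comp _).symm
      · change ((S.cp g ≫ (shiftQ sh B).inv) ≫ (S.ci f)⟦(1 : ℤ)⟧') ≫ (𝟙 (S.E.Q.obj (cone S.s f)))⟦(1 : ℤ)⟧' =
          S.E.Q.map (S.octM f g) ≫ S.cp (S.octK f g) ≫ (shiftQ sh (cone S.s f)).inv
        have h := (isFill_coneMap (S := S) (f := g) (f' := S.octK f g) (S.inl f (terminal.from A))
            (S.inl (f ≫ g) (terminal.from A)) (S.inl_cyMap _ _ _ _ _).symm).proj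
        rw [CategoryTheory.Functor.map_id, Category.comp_id, Category.assoc, shiftQ_inv_naturality,
          ← Category.assoc, ← Category.assoc]
        exact congrArg (· ≫ _) h.symm }

/-- Composable morphisms of the homotopy category are isomorphic to images of composable morphisms
of `D`: the second fraction is taken after inverting the denominator of the first. The octahedron is
then the strict one. -/
lemma isTriangulated [HasZeroObject S.Ho] (hS : S.IsStable) :
    letI := pretriangulated sh hS
    IsTriangulated S.Ho := by
  let _ := pretriangulated sh hS
  refine IsTriangulated.mk' fun X₁ X₂ X₃ u u' => ?_
  obtain ⟨A, rfl⟩ := S.exists_Q_obj X₁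
  obtain ⟨B, rfl⟩ := S.exists_Q_obj X₂
  obtain ⟨C, rfl⟩ := S.exists_Q_obj X₃
  obtain ⟨V, f, v, hv, hf⟩ := S.exists_fraction u
  have iv := S.isIso_Q hv
  obtain ⟨W, g, w, hw, hg⟩ := S.exists_fraction (CategoryTheory.inv (S.E.Q.map v) ≫ u')
  have iw := S.isIso_Q hw
  refine ⟨_, _, _, _, _, _, S.E.Q.map f, S.E.Q.map g, Iso.refl _, asIso (S.E.Q.map v),
    asIso (S.E.Q.map w), ?_, ?_, _, _, coneTriangle_mem sh f, _, _, coneTriangle_mem sh g,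
    S.ci (f ≫ g), S.cp (f ≫ g) ≫ (shiftQ sh A).inv, ?_, ?_⟩
  · exact hf.trans (Category.id_comp _).symm
  · rw [Category.assoc, IsIso.inv_comp_eq] at hg
    exact hg
  · rw [← Functor.map_comp]
    exact coneTriangle_mem sh (f ≫ g)
  · have h := coneOctahedron sh hS f g
    exact ⟨⟨h.m₁, h.m₃, h.comm₁, h.comm₂, h.comm₃, h.comm₄, h.mem⟩⟩

end Triangles

lemma nonempty_triangulatedStructure (hS : S.IsStable) : Nonempty S.TriangulatedStructure := by
  obtain ⟨_⟩ := nonempty_preadditive hS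
  have := hasZeroObject hS
  have : S.hoSusp.IsEquivalence := hS
  have := hasFiniteBiproducts hS
  let _ := hasShiftOfEquivalence S.hoSusp
  -- Each shift functor is an equivalence, hence preserves products and is additive for the
  -- structure already chosen.
  have : ∀ n : ℤ, (shiftFunctor S.Ho n).Additive := fun n =>
    Functor.additive_of_preserves_binary_products _
  let sh : shiftFunctor S.Ho (1 : ℤ) ≅ S.hoSusp := shiftOneIso S.hoSusp
  let _ := pretriangulated sh hS
  have := isTriangulated sh hS
  exact ⟨{ shiftIso := sh, distinguished_iff := fun T => Iff.rfl }⟩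

end SimplicialDescentCategory

/-! ### Functors that commute with the first shift -/

/-- The transitions are bijections, so recursion from `0` runs in both directions. -/
lemma exists_intSection {T : ℤ → Type*} (E : ∀ n, T n ≃ T (n + 1)) (t : T 0) :
    ∃ e : ∀ n, T n, e 0 = t ∧ ∀ n, e (n + 1) = E n (e n) := by
  let p : ∀ n : ℕ, T (Int.ofNat n) := fun n => n.rec t fun k x => E (Int.ofNat k) x
  let q : ∀ n : ℕ, T (Int.negSucc n) := fun n =>
    n.rec ((E (Int.negSucc 0)).symm t) fun k x => (E (Int.negSucc (k + 1))).symm x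
  refine ⟨fun n => Int.rec p q n, rfl, ?_⟩
  rintro (n | (_ | n))
  · rfl
  · exact ((E (Int.negSucc 0)).apply_symm_apply t).symm
  · exact ((E (Int.negSucc (n + 1))).apply_symm_apply (q n)).symm

section CommShiftOfOne

variable {C : Type u} [Category.{v} C] {C' : Type u'} [Category.{v'} C'] [HasShift C ℤ]
  [HasShift C' ℤ] {G : C ⥤ C'} (α : shiftFunctor C (1 : ℤ) ⋙ G ≅ G ⋙ shiftFunctor C' (1 : ℤ))

open Functor

/-- A commutation isomorphism with the first shift translates between the commutation
isomorphisms with consecutive shifts. -/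
def isoAddOne (n : ℤ) : (shiftFunctor C n ⋙ G ≅ G ⋙ shiftFunctor C' n) ≃
    (shiftFunctor C (n + 1) ⋙ G ≅ G ⋙ shiftFunctor C' (n + 1)) :=
  (((FullyFaithful.ofFullyFaithful (shiftFunctor C' (1 : ℤ))).whiskeringRight C).isoEquiv).trans
    (Iso.isoCongr
      (isoWhiskerRight (shiftFunctorAdd' C n 1 (n + 1) rfl) G ≪≫ Functor.associator _ _ _ ≪≫
        isoWhiskerLeft _ α ≪≫ (Functor.associator _ _ _).symm).symm
      (Functor.associator _ _ _ ≪≫ isoWhiskerLeft G (shiftFunctorAdd' C' n 1 (n + 1) rfl).symm))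

lemma isoAddOne_apply (n : ℤ) (e : shiftFunctor C n ⋙ G ≅ G ⋙ shiftFunctor C' n) :
    isoAddOne α n e = CommShift.isoAdd' rfl e α := by
  ext X
  simp [isoAddOne, FullyFaithful.isoEquiv, FullyFaithful.whiskeringRight]

/-- A functor that commutes with the first shift commutes with all shifts. -/
theorem exists_commShift : ∃ h : G.CommShift ℤ, h.commShiftIso 1 = α := by
  obtain ⟨e, h₀, h₁⟩ := exists_intSection (isoAddOne α) (CommShift.isoZero G ℤ)
  have h₂ : ∀ a b, e (a + b) = CommShift.isoAdd (e a) (e b) := fun a b => by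
    -- Additivity at `b` and at `b + 1` are equivalent, by associativity and by injectivity of the
    -- passage to the next shift. This drives the induction on `b` in both directions.
    have key : ∀ b c (h : a + b = c) b' (_ : b + 1 = b') d (h' : a + b' = d), e c = CommShift.isoAdd' h (e a) (e b) ↔
        e d = CommShift.isoAdd' h' (e a) (e b') := fun b c h b' hb d h' => by
      subst hb
      obtain rfl : c + 1 = d := by omega
      rw [h₁, h₁, isoAddOne_apply α b, ← CommShift.isoAdd'_assoc (e a) (e b) α h rfl (by omega),
        ← isoAddOne_apply, (isoAddOne α c).apply_eq_iff_eq]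
    have : ∀ c (h : a + b = c), e c = CommShift.isoAdd' h (e a) (e b) := by
      induction b using Int.induction_on with
      | zero =>
        intro c h
        obtain rfl : a = c := by omega
        rw [h₀, CommShift.isoAdd'_isoZero]
      | succ n ih => exact fun c h => (key _ _ rfl _ rfl _ _).1 (ih _ _)
      | pred n ih =>
        intro c h
        exact (key _ _ h _ (Int.sub_add_cancel _ _) _ rfl).2 (ih _ rfl)
    exact this _ rfl
  have h₃ : e 1 = α := by
    have h₄ : e (0 + 1) = CommShift.isoAdd' rfl (CommShift.isoZero G ℤ) α := by
      rw [h₁, isoAddOne_apply, h₀]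
    have h₅ : ∀ (n : ℤ) (hn : 0 + 1 = n), e n = CommShift.isoAdd' hn (CommShift.isoZero G ℤ) α := by
      rintro _ rfl
      exact h₄
    exact (h₅ 1 (zero_add 1)).trans (CommShift.isoZero_isoAdd'_ α)
  exact ⟨{ commShiftIso := e, commShiftIso_zero := h₀, commShiftIso_add := h₂ }, h₃⟩

end CommShiftOfOne

/-! ### The comparison of the cylinders of a descent functor -/

section DescentFunctor

variable {D : Type u} [Category.{v} D] [HasFiniteCoproducts D]
  {D' : Type u'} [Category.{v'} D'] [HasFiniteCoproducts D'] {F : D ⥤ D'}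

lemma isIso_sigmaι {J : Type} [Finite J] (X : J → D) (j : J) (h : ∀ i, i = j) :
    IsIso (Sigma.ι X j) := by
  refine ⟨Sigma.desc fun i => eqToHom (congrArg X (h i)), ?_, Sigma.hom_ext _ _ fun i => ?_⟩
  · simp
  · obtain rfl := h i
    simp

variable (F) in
/-- The comparison of the cylinder of the image of a span with the image of its cylinder. -/
def cylComparison (H : WalkingSpan ⥤ D) : Cyl.obj ((H ⋙ F) ⋙ SimplicialObject.const D') ⟶
    (degreewise F).obj (Cyl.obj (H ⋙ SimplicialObject.const D)) where
  app n := constDesc fun σ => F.map (constIn H n σ)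
  naturality n m θ := by
    refine const_hom_ext fun σ => ?_
    have h₁ := constIn_map (H ⋙ F) θ σ
    have h₂ := congrArg F.map (constIn_map H θ σ)
    rw [Functor.map_comp, Functor.map_comp] at h₂
    have h₃ := constIn_constDesc (F := H ⋙ F) (n := n) fun σ => F.map (constIn H n σ)
    have h₄ := constIn_constDesc (F := H ⋙ F) (n := m) fun σ => F.map (constIn H m σ)
    refine (Category.assoc _ _ _).symm.trans ((congrArg (· ≫ constDesc _) h₁).trans ?_)
    refine (Category.assoc _ _ _).trans ((congrArg (_ ≫ ·) (h₄ _)).trans (h₂.symm.trans ?_))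
    exact (congrArg (· ≫ _) (h₃ σ)).symm.trans (Category.assoc _ _ _)

lemma constIn_cylComparison_app (H : WalkingSpan ⥤ D) (n : SimplexCategoryᵒᵖ)
    (σ : n.unop ⟶ ⦋1⦌) : constIn (H ⋙ F) n σ ≫ (cylComparison F H).app n = F.map (constIn H n σ) :=
  constIn_constDesc (F := H ⋙ F) _ _

instance (n : SimplexCategory) : Nonempty (n ⟶ ⦋1⦌) := ⟨SimplexCategory.const n ⦋1⦌ 0⟩

lemma cylComparison_naturality {H K : WalkingSpan ⥤ D} (α : H ⟶ K) :
    Cyl.map (Functor.whiskerRight (Functor.whiskerRight α F) (SimplicialObject.const D')) ≫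
      cylComparison F K = cylComparison F H ≫
        (degreewise F).map (Cyl.map (Functor.whiskerRight α (SimplicialObject.const D))) := by
  refine NatTrans.ext (funext fun n => const_hom_ext fun σ => ?_)
  have h₁ := constIn_app (Functor.whiskerRight α F) n σ
  have h₂ := congrArg F.map (constIn_app α n σ)
  rw [Functor.map_comp, Functor.map_comp] at h₂
  rw [NatTrans.comp_app, NatTrans.comp_app, reassoc_of% h₁,
    reassoc_of% (constIn_cylComparison_app (F := F) H n σ), constIn_cylComparison_app]
  exact h₂.symm

lemma inl_cylComparison (H : WalkingSpan ⥤ D) :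
    Cyl.inl ((H ⋙ F) ⋙ SimplicialObject.const D') ≫ cylComparison F H =
      (constDegreewise F).inv.app (H.obj WalkingSpan.left) ≫
        (degreewise F).map (Cyl.inl (H ⋙ SimplicialObject.const D)) := by
  refine NatTrans.ext (funext fun n => ?_)
  have h₁ := constIn_cylComparison_app (F := F) H n (SimplexCategory.const n.unop ⦋1⦌ 1)
  refine (Category.assoc _ _ _).trans ((congrArg (_ ≫ ·) h₁).trans ?_)
  exact (F.map_comp _ _).symm.trans (Category.id_comp _).symm

variable [HasTerminal D] [HasTerminal D'] {S : SimplicialDescentCategory D}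
  {S' : SimplicialDescentCategory D'}

namespace IsDescentFunctor

/-- Only binary coproducts are assumed to be preserved, so the induction starts with one summand.
This suffices for cylinders, since `Δ[1]` has simplices in every degree. -/
lemma sigmaComparison_mem_aux (hF : IsDescentFunctor S S' F) (J : Type) :
    ∀ (_ : Finite J) (_ : Nonempty J) (X : J → D), S'.E (sigmaComparison F X) := by
  refine fun hJ => Finite.induction_empty_option (P := fun J => ∀ (_ : Finite J) (_ : Nonempty J)
    (X : J → D), S'.E (sigmaComparison F X)) ?_ ?_ ?_ J hJ
  · intro α β e ih _ _ X
    have : Finite α := Finite.of_equiv β e.symm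
    have h := ih this e.nonempty (fun a => X (e a))
    have h' : sigmaComparison F X = (Sigma.reindex e (fun b => F.obj (X b))).inv ≫
        sigmaComparison F (fun a => X (e a)) ≫ F.map (Sigma.reindex e X).hom := by
      rw [Iso.eq_inv_comp]
      refine Sigma.hom_ext _ _ fun a => ?_
      have h₁ := Sigma.ι_reindex_hom e (fun b => F.obj (X b)) a
      have h₂ := Sigma.ι_reindex_hom e X a
      have h₃ := ι_comp_sigmaComparison F (fun a => X (e a)) a
      rw [← Category.assoc, h₁, ι_comp_sigmaComparison, ← Category.assoc]
      refine Eq.trans ?_ (congrArg (· ≫ F.map (Sigma.reindex e X).hom) h₃.symm)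
      rw [← h₂]
      exact F.map_comp _ _
    rw [h']
    exact S'.comp_mem _ _ (S'.mem_of_isIso _) (S'.comp_mem _ _ h (S'.mem_of_isIso _))
  · exact fun _ h => (IsEmpty.false h.some).elim
  · intro α _ ih _ _ X
    rcases isEmpty_or_nonempty α with hα | hα
    · have h : ∀ i : Option α, i = none := fun i => by
        rcases i with _ | i
        · rfl
        · exact hα.elim i
      have h₁ := isIso_sigmaι X none h
      have h₂ := isIso_sigmaι (fun i => F.obj (X i)) none h
      have h₃ : IsIso (sigmaComparison F X) := by
        have h₄ : IsIso (Sigma.ι (fun i => F.obj (X i)) none ≫ sigmaComparison F X) := by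
          rw [ι_comp_sigmaComparison]
          infer_instance
        exact IsIso.of_isIso_comp_left (Sigma.ι (fun i => F.obj (X i)) none) _
      exact S'.mem_of_isIso _
    · have h := ih inferInstance hα (fun a => X (some a))
      have h' : sigmaComparison F X = (sigmaOptionIso (fun a => F.obj (X a))).hom ≫
          coprod.map (𝟙 _) (sigmaComparison F (fun a => X (some a))) ≫
            coprodComparison F (X none) (∐ fun a => X (some a)) ≫
              F.map (sigmaOptionIso X).inv := by
        refine Sigma.hom_ext _ _ fun j => ?_
        rcases j with _ | a
        · simp [sigmaOptionIso, coprod.inl_desc, coprodComparison_inl_assoc, ← F.map_comp]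
        · simp [sigmaOptionIso, coprod.inr_desc, coprodComparison_inr_assoc, ← F.map_comp]
      rw [h']
      exact S'.comp_mem _ _ (S'.mem_of_isIso _) (S'.comp_mem _ _
        (S'.coprod_map_mem _ _ (S'.id_mem _) h) (S'.comp_mem _ _ (hF.coprodComparison_mem _ _)
          (S'.mem_of_isIso _)))

/-- Descent functors preserve nonempty finite coproducts up to equivalence. -/
lemma sigmaComparison_mem (hF : IsDescentFunctor S S' F) {J : Type} [hJ : Finite J]
    [hJ' : Nonempty J] (X : J → D) : S'.E (sigmaComparison F X) :=
  hF.sigmaComparison_mem_aux J hJ hJ' X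

lemma cylComparison_app_mem (hF : IsDescentFunctor S S' F) (H : WalkingSpan ⥤ D)
    (n : SimplexCategoryᵒᵖ) : S'.E ((cylComparison F H).app n) :=
  hF.sigmaComparison_mem fun σ : n.unop ⟶ ⦋1⦌ => H.obj (position σ)

end IsDescentFunctor

end DescentFunctor

/-! ### The image of a cone under a descent functor -/

section Comparison

variable {D : Type u} [Category.{v} D] [HasFiniteCoproducts D] [HasTerminal D]
  {D' : Type u'} [Category.{v'} D'] [HasFiniteCoproducts D'] [HasTerminal D']
  {S : SimplicialDescentCategory D} {S' : SimplicialDescentCategory D'} {F : D ⥤ D'}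

/-- The comparison of the image of a simple object with the simple of the image. -/
def simpleComparison (Θ : (S'.E.functorCategory (SimplicialObject D)).Q.obj (S.s ⋙ F) ≅
      (S'.E.functorCategory (SimplicialObject D)).Q.obj (degreewise F ⋙ S'.s))
    (X : SimplicialObject D) :
    S'.E.Q.obj (F.obj (S.s.obj X)) ⟶ S'.E.Q.obj (S'.s.obj ((degreewise F).obj X)) :=
  (locEval S'.E Θ.hom).app X

variable (Θ : (S'.E.functorCategory (SimplicialObject D)).Q.obj (S.s ⋙ F) ≅
      (S'.E.functorCategory (SimplicialObject D)).Q.obj (degreewise F ⋙ S'.s))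

instance (X : SimplicialObject D) : IsIso (simpleComparison Θ X) :=
  isIso_locEval_app S'.E Θ.hom X

lemma simpleComparison_naturality {X Y : SimplicialObject D} (f : X ⟶ Y) :
    S'.E.Q.map (F.map (S.s.map f)) ≫ simpleComparison Θ Y =
      simpleComparison Θ X ≫ S'.E.Q.map (S'.s.map ((degreewise F).map f)) :=
  (locEval S'.E Θ.hom).naturality f

lemma simpleComparison_lam (h : CompatibleLam S S' F Θ.hom) (B : D) :
    simpleComparison Θ ((SimplicialObject.const D).obj B) ≫
      S'.E.Q.map (S'.s.map ((constDegreewise F).hom.app B)) ≫ S'.E.Q.map (S'.lam.app (F.obj B)) =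
        S'.E.Q.map (F.map (S.lam.app B)) := by
  have h₁ := congrArg (fun t => (locEval S'.E t).app B) h
  rw [locEval_comp, locEval_map, locEval_map, NatTrans.comp_app, locEval_locPrecomp] at h₁
  have h₂ : ((Functor.associator (SimplicialObject.const D) (degreewise F) S'.s).inv.app B ≫
      S'.s.map ((constDegreewise F).hom.app B) ≫
        (Functor.associator F (SimplicialObject.const D') S'.s).hom.app B ≫
          S'.lam.app (F.obj B) ≫ F.rightUnitor.hom.app B) =
      S'.s.map ((constDegreewise F).hom.app B) ≫ S'.lam.app (F.obj B) := by
    refine (Category.id_comp _).trans (congrArg (_ ≫ ·) ((Category.id_comp _).trans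
      (Category.comp_id _)))
  have h₃ : ((Functor.associator (SimplicialObject.const D) S.s F).inv.app B ≫
      F.map (S.lam.app B) ≫ F.leftUnitor.hom.app B) = F.map (S.lam.app B) :=
    (Category.id_comp _).trans (Category.comp_id _)
  refine Eq.trans (congrArg (_ ≫ ·) ((S'.E.Q.map_comp _ _).symm.trans
    (congrArg S'.E.Q.map h₂.symm))) (h₁.trans (congrArg S'.E.Q.map h₃))

/-- Compatibility is given for `λ`; it passes to the sections `ρ` because `λ'` is invertible in the
homotopy category. It is what identifies the inclusions of the bases of cones. -/
lemma map_rho_simpleComparison (h : CompatibleLam S S' F Θ.hom) (B : D) :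
    S'.E.Q.map (F.map (S.rho.app B)) ≫ simpleComparison Θ ((SimplicialObject.const D).obj B) ≫
      S'.E.Q.map (S'.s.map ((constDegreewise F).hom.app B)) =
        S'.E.Q.map (S'.rho.app (F.obj B)) := by
  have h₁ := simpleComparison_lam Θ h B
  have : IsIso (S'.E.Q.map (S'.lam.app (F.obj B))) := (S'.mem_iff_isIso _).1 (S'.lam_mem _)
  have h₂ := congrArg (fun t => S'.E.Q.map (F.map t)) (S.rho_lam B)
  have h₃ := congrArg S'.E.Q.map (S'.rho_lam (F.obj B))
  rw [F.map_comp, Functor.map_comp] at h₂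
  rw [Functor.map_comp] at h₃
  rw [← cancel_mono (S'.E.Q.map (S'.lam.app (F.obj B)))]
  refine (Category.assoc _ _ _).trans ((congrArg (_ ≫ ·) ((Category.assoc _ _ _).trans h₁)).trans ?_)
  refine h₂.trans (Eq.trans ?_ h₃.symm)
  exact (congrArg S'.E.Q.map (F.map_id B))

/-- The inclusion of the left end of the cylinder of a span. -/
def cylLeft (S : SimplicialDescentCategory D) (H : WalkingSpan ⥤ D) :
    H.obj WalkingSpan.left ⟶ (cyl S.s).obj H :=
  S.rho.app _ ≫ S.s.map (Cyl.inl (H ⋙ SimplicialObject.const D))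

lemma cylLeft_map {H K : WalkingSpan ⥤ D} (α : H ⟶ K) :
    cylLeft S H ≫ (cyl S.s).map α = α.app WalkingSpan.left ≫ cylLeft S K := by
  have h := S.rho.naturality (α.app WalkingSpan.left)
  have h2 := congrArg S.s.map (Cyl.inl_map (Functor.whiskerRight α (SimplicialObject.const D)))
  refine (Category.assoc _ _ _).trans ?_
  refine (congrArg (S.rho.app _ ≫ ·) ((S.s.map_comp _ _).symm.trans
    (h2.trans (S.s.map_comp _ _)))).trans ?_
  refine (Category.assoc _ _ _).symm.trans (Eq.trans ?_ (Category.assoc _ _ _))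
  exact congrArg (· ≫ S.s.map (Cyl.inl (K ⋙ SimplicialObject.const D))) h.symm

variable (hF : IsDescentFunctor S S' F)

lemma IsDescentFunctor.isIso_cylComparison (hF : IsDescentFunctor S S' F) (H : WalkingSpan ⥤ D) :
    IsIso (S'.E.Q.map (S'.s.map (cylComparison F H))) :=
  (S'.mem_iff_isIso _).1 (S'.simple_mem _ fun n => hF.cylComparison_app_mem H n)

/-- The comparison of the image of the cylinder of a span with the cylinder of its image. -/
def cylIso (H : WalkingSpan ⥤ D) :
    S'.E.Q.obj (F.obj ((cyl S.s).obj H)) ≅ S'.E.Q.obj ((cyl S'.s).obj (H ⋙ F)) :=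
  have := hF.isIso_cylComparison H
  asIso (simpleComparison Θ (Cyl.obj (H ⋙ SimplicialObject.const D))) ≪≫
    (asIso (S'.E.Q.map (S'.s.map (cylComparison F H)))).symm

lemma cylIso_hom_comp (H : WalkingSpan ⥤ D) :
    (cylIso Θ hF H).hom ≫ S'.E.Q.map (S'.s.map (cylComparison F H)) =
      simpleComparison Θ (Cyl.obj (H ⋙ SimplicialObject.const D)) := by
  have := hF.isIso_cylComparison H
  exact (Category.assoc _ _ _).trans ((congrArg (_ ≫ ·) (IsIso.inv_hom_id _)).trans
    (Category.comp_id _))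

lemma cylIso_naturality {H K : WalkingSpan ⥤ D} (α : H ⟶ K) :
    S'.E.Q.map (F.map ((cyl S.s).map α)) ≫ (cylIso Θ hF K).hom =
      (cylIso Θ hF H).hom ≫ S'.E.Q.map ((cyl S'.s).map (Functor.whiskerRight α F)) := by
  have := hF.isIso_cylComparison K
  have h := congrArg (fun t => S'.E.Q.map (S'.s.map t)) (cylComparison_naturality (F := F) α)
  rw [S'.s.map_comp, S'.s.map_comp, Functor.map_comp, Functor.map_comp] at h
  rw [← cancel_mono (S'.E.Q.map (S'.s.map (cylComparison F K)))]
  refine (Category.assoc _ _ _).trans ((congrArg (_ ≫ ·) (cylIso_hom_comp Θ hF K)).trans ?_)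
  refine (simpleComparison_naturality Θ _).trans ?_
  refine Eq.trans ?_ (Category.assoc _ _ _).symm
  refine Eq.trans ?_ (congrArg (_ ≫ ·) h.symm)
  exact (congrArg (· ≫ _) (cylIso_hom_comp Θ hF H)).symm.trans (Category.assoc _ _ _)

lemma map_cylLeft_cylIso (h : CompatibleLam S S' F Θ.hom) (H : WalkingSpan ⥤ D) :
    S'.E.Q.map (F.map (cylLeft S H)) ≫ (cylIso Θ hF H).hom = S'.E.Q.map (cylLeft S' (H ⋙ F)) := by
  have := hF.isIso_cylComparison H
  rw [← cancel_mono (S'.E.Q.map (S'.s.map (cylComparison F H)))]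
  refine (Category.assoc _ _ _).trans ((congrArg (_ ≫ ·) (cylIso_hom_comp Θ hF H)).trans ?_)
  have h₁ := simpleComparison_naturality Θ (Cyl.inl (H ⋙ SimplicialObject.const D))
  have h₂ := map_rho_simpleComparison Θ h (H.obj WalkingSpan.left)
  have h₃ : (degreewise F).map (Cyl.inl (H ⋙ SimplicialObject.const D)) =
    (constDegreewise F).hom.app (H.obj WalkingSpan.left) ≫
      Cyl.inl ((H ⋙ F) ⋙ SimplicialObject.const D') ≫ cylComparison F H :=
    (Iso.inv_comp_eq ((constDegreewise F).app _)).1 (inl_cylComparison (F := F) H).symm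
  have h₄ := congrArg (fun t => S'.E.Q.map (S'.s.map t)) h₃
  rw [S'.s.map_comp, S'.s.map_comp, Functor.map_comp, Functor.map_comp] at h₄
  have h₅ : S'.E.Q.map (F.map (cylLeft S H)) = S'.E.Q.map (F.map (S.rho.app _)) ≫
    S'.E.Q.map (F.map (S.s.map (Cyl.inl (H ⋙ SimplicialObject.const D)))) :=
    (congrArg S'.E.Q.map (F.map_comp _ _)).trans (S'.E.Q.map_comp _ _)
  have h₆ : S'.E.Q.map (cylLeft S' (H ⋙ F)) = S'.E.Q.map (S'.rho.app _) ≫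
    S'.E.Q.map (S'.s.map (Cyl.inl ((H ⋙ F) ⋙ SimplicialObject.const D'))) := S'.E.Q.map_comp _ _
  rw [h₅, h₆]
  refine (Category.assoc _ _ _).trans ((congrArg (_ ≫ ·) (h₁.trans
    (congrArg (_ ≫ ·) h₄))).trans ?_)
  refine Eq.trans ?_ (congrArg (· ≫ _) (congrArg (· ≫ _) h₂))
  simp only [Category.assoc]
  rfl

end Comparison

/-! ### The image of the point in the spans defining cones and suspensions. -/

section SpanComparison

variable {D : Type u} [Category.{v} D] [HasTerminal D]
  {D' : Type u'} [Category.{v'} D'] [HasTerminal D'] {F : D ⥤ D'}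

variable (F) in
/-- The comparison of the image of the span that defines a cone with the span that defines the cone
of the image. -/
def coneSpanComparison {A B : D} (f : A ⟶ B) : coneSpan f ⋙ F ⟶ coneSpan (F.map f) where
  app
    | WalkingSpan.zero => 𝟙 _
    | WalkingSpan.left => 𝟙 _
    | WalkingSpan.right => terminal.from _
  naturality := by
    rintro _ _ (_ | _ | _)
    · simp
    · exact (Category.comp_id _).trans (Category.id_comp _).symm
    · exact terminal.hom_ext _ _

variable (F) in
/-- The comparison of the image of the span that defines a suspension with the span that defines the
suspension of the image. -/
def suspSpanComparison (A : D) : suspSpan A ⋙ F ⟶ suspSpan (F.obj A) where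
  app
    | WalkingSpan.zero => 𝟙 _
    | WalkingSpan.left => terminal.from _
    | WalkingSpan.right => terminal.from _
  naturality := by
    rintro _ _ (_ | _ | _)
    · simp
    · exact terminal.hom_ext _ _
    · exact terminal.hom_ext _ _

lemma coneSpanComparison_toSusp {A B : D} (f : A ⟶ B) :
    Functor.whiskerRight (coneSpanToSusp f) F ≫ suspSpanComparison F A =
      coneSpanComparison F f ≫ coneSpanToSusp (F.map f) := by
  refine NatTrans.ext (funext ?_)
  rintro (_ | _ | _)
  · exact (congrArg (· ≫ 𝟙 _) (F.map_id A))
  · exact terminal.hom_ext _ _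
  · exact terminal.hom_ext _ _

lemma suspSpanComparison_naturality {A B : D} (f : A ⟶ B) :
    Functor.whiskerRight (suspSpanMap f) F ≫ suspSpanComparison F B =
      suspSpanComparison F A ≫ suspSpanMap (F.map f) := by
  refine NatTrans.ext (funext ?_)
  rintro (_ | _ | _)
  · exact (Category.comp_id _).trans (Category.id_comp _).symm
  · exact terminal.hom_ext _ _
  · exact terminal.hom_ext _ _

end SpanComparison

/-! ### Cones and suspensions of images under a descent functor. -/

section ConeComparison

variable {D : Type u} [Category.{v} D] [HasFiniteCoproducts D] [HasTerminal D]
  {D' : Type u'} [Category.{v'} D'] [HasFiniteCoproducts D'] [HasTerminal D']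
  {S : SimplicialDescentCategory D} {S' : SimplicialDescentCategory D'} {F : D ⥤ D'}

namespace IsDescentFunctor

lemma isIso_cyl_coneSpanComparison (hF : IsDescentFunctor S S' F) {A B : D} (f : A ⟶ B) :
    IsIso (S'.E.Q.map ((cyl S'.s).map (coneSpanComparison F f))) := by
  refine (S'.mem_iff_isIso _).1 (S'.cyl_map_mem _ ?_)
  rintro (_ | _ | _)
  exacts [S'.id_mem _, S'.id_mem _, hF.terminal_mem]

lemma isIso_cyl_suspSpanComparison (hF : IsDescentFunctor S S' F) (A : D) :
    IsIso (S'.E.Q.map ((cyl S'.s).map (suspSpanComparison F A))) := by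
  refine (S'.mem_iff_isIso _).1 (S'.cyl_map_mem _ ?_)
  rintro (_ | _ | _)
  exacts [S'.id_mem _, hF.terminal_mem, hF.terminal_mem]

variable (Θ : (S'.E.functorCategory (SimplicialObject D)).Q.obj (S.s ⋙ F) ≅
      (S'.E.functorCategory (SimplicialObject D)).Q.obj (degreewise F ⋙ S'.s))
  (hF : IsDescentFunctor S S' F)

/-- The comparison of the image of a cone with the cone of the image. -/
def coneIso {A B : D} (f : A ⟶ B) :
    S'.E.Q.obj (F.obj (cone S.s f)) ≅ S'.E.Q.obj (cone S'.s (F.map f)) :=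
  cylIso Θ hF (coneSpan f) ≪≫ @asIso _ _ _ _ (S'.E.Q.map ((cyl S'.s).map (coneSpanComparison F f)))
    (hF.isIso_cyl_coneSpanComparison f)

/-- The comparison of the image of a suspension with the suspension of the image. -/
def suspIso (A : D) :
    S'.E.Q.obj (F.obj ((susp S.s).obj A)) ≅ S'.E.Q.obj ((susp S'.s).obj (F.obj A)) :=
  cylIso Θ hF (suspSpan A) ≪≫ @asIso _ _ _ _ (S'.E.Q.map ((cyl S'.s).map (suspSpanComparison F A)))
    (hF.isIso_cyl_suspSpanComparison A)

lemma map_coneInl_coneIso (h : CompatibleLam S S' F Θ.hom) {A B : D} (f : A ⟶ B) :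
    S'.E.Q.map (F.map (S.coneInl f)) ≫ (hF.coneIso Θ f).hom =
      S'.E.Q.map (S'.coneInl (F.map f)) := by
  have h₁ := map_cylLeft_cylIso Θ hF h (coneSpan f)
  have h₂ : cylLeft S' (coneSpan f ⋙ F) ≫ (cyl S'.s).map (coneSpanComparison F f) =
    cylLeft S' (coneSpan (F.map f)) :=
    (cylLeft_map (coneSpanComparison F f)).trans (Category.id_comp _)
  refine (Category.assoc _ _ _).symm.trans ((congrArg (· ≫ _) h₁).trans ?_)
  exact (S'.E.Q.map_comp _ _).symm.trans (congrArg S'.E.Q.map h₂)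

lemma map_coneToSusp_suspIso {A B : D} (f : A ⟶ B) :
    S'.E.Q.map (F.map (coneToSusp S.s f)) ≫ (hF.suspIso Θ A).hom =
      (hF.coneIso Θ f).hom ≫ S'.E.Q.map (coneToSusp S'.s (F.map f)) := by
  have h₁ := cylIso_naturality Θ hF (coneSpanToSusp f)
  have h₂ := congrArg (fun t => S'.E.Q.map ((cyl S'.s).map t)) (coneSpanComparison_toSusp (F := F) f)
  rw [Functor.map_comp, Functor.map_comp, Functor.map_comp, Functor.map_comp] at h₂
  refine (Category.assoc _ _ _).symm.trans ((congrArg (· ≫ _) h₁).trans ?_)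
  exact (Category.assoc _ _ _).trans ((congrArg (_ ≫ ·) h₂).trans (Category.assoc _ _ _).symm)

lemma suspIso_naturality {A B : D} (f : A ⟶ B) :
    S'.E.Q.map (F.map ((susp S.s).map f)) ≫ (hF.suspIso Θ B).hom =
      (hF.suspIso Θ A).hom ≫ S'.E.Q.map ((susp S'.s).map (F.map f)) := by
  have h₁ := cylIso_naturality Θ hF (suspSpanMap f)
  have h₂ := congrArg (fun t => S'.E.Q.map ((cyl S'.s).map t))
    (suspSpanComparison_naturality (F := F) f)
  rw [Functor.map_comp, Functor.map_comp, Functor.map_comp, Functor.map_comp] at h₂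
  refine (Category.assoc _ _ _).symm.trans ((congrArg (· ≫ _) h₁).trans ?_)
  exact (Category.assoc _ _ _).trans ((congrArg (_ ≫ ·) h₂).trans (Category.assoc _ _ _).symm)

/-- The functor induced by a descent functor is compatible with the localization functors. -/
def hoFac : S.E.Q ⋙ hF.hoFunctor ≅ F ⋙ S'.E.Q :=
  locFunctorFac F hF.map_mem

/-- The comparison of the suspension functors, on objects of `D`. -/
def hoSuspComparison₀ : S.E.Q ⋙ S.hoSusp ⋙ hF.hoFunctor ≅ S.E.Q ⋙ hF.hoFunctor ⋙ S'.hoSusp :=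
  NatIso.ofComponents (fun A => hF.hoFunctor.mapIso (S.hoSuspFac.app A) ≪≫
    hF.hoFac.app ((susp S.s).obj A) ≪≫ hF.suspIso Θ A ≪≫ (S'.hoSuspFac.app (F.obj A)).symm ≪≫
      S'.hoSusp.mapIso (hF.hoFac.app A).symm) fun {A B} f => by
    have h₁ := congrArg hF.hoFunctor.map (S.hoSuspFac.hom.naturality f)
    have h₂ := hF.hoFac.hom.naturality ((susp S.s).map f)
    have h₃ := hF.suspIso_naturality Θ f
    have h₄ := S'.hoSuspFac.inv.naturality (F.map f)
    have h₅ := congrArg S'.hoSusp.map (hF.hoFac.inv.naturality f)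
    rw [Functor.map_comp, Functor.map_comp] at h₁ h₅
    refine (Category.assoc _ _ _).symm.trans ((congrArg (· ≫ _) h₁).trans ?_)
    refine (Category.assoc _ _ _).trans (Eq.trans (congrArg (_ ≫ ·) ?_)
      (Category.assoc _ _ _).symm)
    refine (Category.assoc _ _ _).symm.trans ((congrArg (· ≫ _) h₂).trans ?_)
    refine (Category.assoc _ _ _).trans (Eq.trans (congrArg (_ ≫ ·) ?_)
      (Category.assoc _ _ _).symm)
    refine (Category.assoc _ _ _).symm.trans ((congrArg (· ≫ _) h₃).trans ?_)
    refine (Category.assoc _ _ _).trans (Eq.trans (congrArg (_ ≫ ·) ?_)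
      (Category.assoc _ _ _).symm)
    refine (Category.assoc _ _ _).symm.trans ((congrArg (· ≫ _) h₄).trans ?_)
    refine (Category.assoc _ _ _).trans (Eq.trans (congrArg (_ ≫ ·) ?_)
      (Category.assoc _ _ _).symm)
    exact h₅

/-- The functor induced by a descent functor commutes with the suspension functors. -/
def hoSuspComparison : S.hoSusp ⋙ hF.hoFunctor ≅ hF.hoFunctor ⋙ S'.hoSusp :=
  (Localization.whiskeringLeftFunctor' S.E.Q S.E S'.Ho).preimageIso (hF.hoSuspComparison₀ Θ)

lemma hoSuspComparison_hom_app (A : D) : (hF.hoSuspComparison Θ).hom.app (S.E.Q.obj A) =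
    hF.hoFunctor.map (S.hoSuspFac.hom.app A) ≫ hF.hoFac.hom.app ((susp S.s).obj A) ≫
      (hF.suspIso Θ A).hom ≫ S'.hoSuspFac.inv.app (F.obj A) ≫
        S'.hoSusp.map (hF.hoFac.inv.app A) :=
  congrArg (fun t => t.app A)
    (((Localization.whiskeringLeftFunctor' S.E.Q S.E S'.Ho)).map_preimage
      (hF.hoSuspComparison₀ Θ).hom)

end IsDescentFunctor

end ConeComparison

open Pretriangulated SimplicialDescentCategory

/-! ### Descent functors preserve distinguished triangles. -/

section TriangulatedFunctor

variable {D : Type u} [Category.{v} D] [HasFiniteCoproducts D] [HasTerminal D]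
  {D' : Type u'} [Category.{v'} D'] [HasFiniteCoproducts D'] [HasTerminal D']
  {S : SimplicialDescentCategory D} {S' : SimplicialDescentCategory D'} {F : D ⥤ D'}

namespace IsDescentFunctor

variable (Θ : (S'.E.functorCategory (SimplicialObject D)).Q.obj (S.s ⋙ F) ≅
      (S'.E.functorCategory (SimplicialObject D)).Q.obj (degreewise F ⋙ S'.s))
  (hF : IsDescentFunctor S S' F) [HasShift S.Ho ℤ] [HasShift S'.Ho ℤ]
  (sh : shiftFunctor S.Ho (1 : ℤ) ≅ S.hoSusp) (sh' : shiftFunctor S'.Ho (1 : ℤ) ≅ S'.hoSusp)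

/-- The functor induced by a descent functor commutes with shift functors that are isomorphic to the
suspensions. -/
def shiftComparison : shiftFunctor S.Ho (1 : ℤ) ⋙ hF.hoFunctor ≅
    hF.hoFunctor ⋙ shiftFunctor S'.Ho (1 : ℤ) :=
  Functor.isoWhiskerRight sh hF.hoFunctor ≪≫ hF.hoSuspComparison Θ ≪≫
    (Functor.isoWhiskerLeft hF.hoFunctor sh').symm

/-- On images of objects of `D` the abstract comparison of shifts is the concrete `suspIso`, as
required for the last square of the comparison of cone triangles. -/
lemma map_shiftQ_inv_shiftComparison (A : D) :
    hF.hoFunctor.map (shiftQ sh A).inv ≫ (hF.shiftComparison Θ sh sh').hom.app (S.E.Q.obj A) ≫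
      (hF.hoFac.hom.app A)⟦(1 : ℤ)⟧' =
    hF.hoFac.hom.app ((susp S.s).obj A) ≫ (hF.suspIso Θ A).hom ≫ (shiftQ sh' (F.obj A)).inv := by
  have h₁ := sh'.inv.naturality (hF.hoFac.hom.app A)
  have h₂ : hF.hoFunctor.map (shiftQ sh A).inv ≫ hF.hoFunctor.map (sh.hom.app (S.E.Q.obj A)) ≫
      hF.hoFunctor.map (S.hoSuspFac.hom.app A) = 𝟙 _ := by
    rw [← Functor.map_comp, ← Functor.map_comp]
    refine (congrArg hF.hoFunctor.map (Iso.inv_hom_id (shiftQ sh A))).trans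
      (CategoryTheory.Functor.map_id _ _)
  have h₃ : S'.hoSusp.map (hF.hoFac.inv.app A) ≫ S'.hoSusp.map (hF.hoFac.hom.app A) = 𝟙 _ := by
    rw [← Functor.map_comp, Iso.inv_hom_id_app]
    exact CategoryTheory.Functor.map_id _ _
  have h₄ : (hF.shiftComparison Θ sh sh').hom.app (S.E.Q.obj A) =
      hF.hoFunctor.map (sh.hom.app (S.E.Q.obj A)) ≫
        (hF.hoFunctor.map (S.hoSuspFac.hom.app A) ≫ hF.hoFac.hom.app ((susp S.s).obj A) ≫
      (hF.suspIso Θ A).hom ≫ S'.hoSuspFac.inv.app (F.obj A) ≫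
        S'.hoSusp.map (hF.hoFac.inv.app A)) ≫ sh'.inv.app (hF.hoFunctor.obj (S.E.Q.obj A)) := by
    rw [← hoSuspComparison_hom_app]
    rfl
  rw [h₄]
  simp only [Category.assoc]
  rw [reassoc_of% h₂]
  refine congrArg (_ ≫ ·) (congrArg (_ ≫ ·) ?_)
  refine (congrArg (_ ≫ ·) ((congrArg (_ ≫ ·) h₁.symm).trans ?_))
  exact (Category.assoc _ _ _).symm.trans ((congrArg (· ≫ _) h₃).trans (Category.id_comp _))

variable [hF.hoFunctor.CommShift ℤ]

/-- The functor induced by a descent functor sends the triangle of a morphism to the triangle of its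
image. -/
def mapTriangleConeIso (h : CompatibleLam S S' F Θ.hom)
    (hG : hF.hoFunctor.commShiftIso (1 : ℤ) = hF.shiftComparison Θ sh sh') {A B : D} (f : A ⟶ B) :
    hF.hoFunctor.mapTriangle.obj (coneTriangle sh f) ≅ coneTriangle sh' (F.map f) :=
  Triangle.isoMk _ _ (hF.hoFac.app A) (hF.hoFac.app B) (hF.hoFac.app _ ≪≫ hF.coneIso Θ f)
    (hF.hoFac.hom.naturality f)
    (by
      have h₁ := hF.hoFac.hom.naturality (S.coneInl f)
      have h₂ := hF.map_coneInl_coneIso Θ h f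
      refine (Category.assoc _ _ _).symm.trans ((congrArg (· ≫ _) h₁).trans ?_)
      exact (Category.assoc _ _ _).trans (congrArg (_ ≫ ·) h₂))
    (by
      have h₁ := hF.hoFac.hom.naturality (coneToSusp S.s f)
      have h₂ := hF.map_coneToSusp_suspIso Θ f
      have h₃ := hF.map_shiftQ_inv_shiftComparison Θ sh sh' A
      rw [← hG] at h₃
      have h₄ := hF.hoFunctor.map_comp (S.cp f) (shiftQ sh A).inv
      change (hF.hoFunctor.map (S.cp f ≫ (shiftQ sh A).inv) ≫
        (hF.hoFunctor.commShiftIso (1 : ℤ)).hom.app (S.E.Q.obj A)) ≫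
          (hF.hoFac.hom.app A)⟦(1 : ℤ)⟧' = (hF.hoFac.hom.app _ ≫ (hF.coneIso Θ f).hom) ≫
            S'.cp (F.map f) ≫ (shiftQ sh' (F.obj A)).inv
      rw [h₄]
      refine (Category.assoc _ _ _).trans ((Category.assoc _ _ _).trans
        ((congrArg (_ ≫ ·) h₃).trans ?_))
      refine (Category.assoc _ _ _).symm.trans ((congrArg (· ≫ _) h₁).trans ?_)
      refine (Category.assoc _ _ _).trans (Eq.trans (congrArg (_ ≫ ·) ?_)
        (Category.assoc _ _ _).symm)
      exact (Category.assoc _ _ _).symm.trans ((congrArg (· ≫ _) h₂).trans (Category.assoc _ _ _)))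

end IsDescentFunctor

/-- The functor induced by a descent functor on homotopy categories is triangulated. -/
theorem IsDescentFunctor.isTriangulatedFunctor (hF : IsDescentFunctor S S' F)
    (T : S.TriangulatedStructure) (T' : S'.TriangulatedStructure) :
    IsTriangulatedFunctor T T' hF.hoFunctor := by
  let := T.preadditive
  let := T.hasZeroObject
  let := T.hasShift
  let := T.additive_shiftFunctor
  let := T.pretriangulated
  let := T'.preadditive
  let := T'.hasZeroObject
  let := T'.hasShift
  let := T'.additive_shiftFunctor
  let := T'.pretriangulated
  obtain ⟨Θ, h, _⟩ := hF.exists_comparison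
  -- The commutation with the shift by `1` is prescribed by `Θ`; `hG` records that the extension to
  -- `ℤ` retains it, so that triangles are compared through `suspIso`.
  obtain ⟨hc, hG⟩ := exists_commShift (hF.shiftComparison Θ T.shiftIso T'.shiftIso)
  refine ⟨hc, ⟨fun X hX => ?_⟩⟩
  obtain ⟨A, B, f, ⟨e⟩⟩ := (mem_cofiberTriangles_iff T.shiftIso X).1 ((T.distinguished_iff X).1 hX)
  exact (T'.distinguished_iff _).2 ((mem_cofiberTriangles_iff T'.shiftIso _).2 ⟨_, _, F.map f,
    ⟨hF.hoFunctor.mapTriangle.mapIso e ≪≫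
      hF.mapTriangleConeIso Θ T.shiftIso T'.shiftIso h hG f⟩⟩)

end TriangulatedFunctor

end SimplicialDescent

theorem mainTheorem1 {D : Type u} [Category.{v} D] [HasFiniteCoproducts D] [HasTerminal D]
    (S : SimplicialDescent.SimplicialDescentCategory D) (hS : S.IsStable) :
    Nonempty S.TriangulatedStructure ∧
      ∀ {D' : Type u'} [Category.{v'} D'] [HasFiniteCoproducts D'] [HasTerminal D']
        (S' : SimplicialDescent.SimplicialDescentCategory D') (_ : S'.IsStable) (F : D ⥤ D')
        (hF : SimplicialDescent.IsDescentFunctor S S' F)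
        (T : S.TriangulatedStructure) (T' : S'.TriangulatedStructure),
        SimplicialDescent.IsTriangulatedFunctor T T' hF.hoFunctor :=
  ⟨S.nonempty_triangulatedStructure hS, fun _ _ _ hF T T' => hF.isTriangulatedFunctor T T'⟩
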